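/- Let $R$ be a field and let $D$ be a cocommutative Hopf algebra over $R$ with comultiplication $\Delta$ (written $\Delta(d)=\sum d_{(1)}\otimes d_{(2)}$) and counit $\varepsilon$. Assume that $D$ is pointed (every simple subcoalgebra is one-dimensional) and that its irreducible component containing $1$ is of Birkhoff--Witt type: every primitive $x\in D$ lies in an infinite divided power sequence $1=d_0,\ x=d_1,\ d_2,\dots$, i.e. $\Delta(d_n)=\sum_{i=0}^n d_i\otimes d_{n-i}$ for all $n$. A $D$-module algebra is a commutative $R$-algebra $A$ which is a $D$-module with $d(ab)=\sum (d_{(1)}a)(d_{(2)}b)$ and $d(1)=\varepsilon(d)1$. Its constants are $A^D=\{a\in A: da=\varepsilon(d)a \text{ for all } d\in D\}$, and similarly for any $D$-module. It is AS (artinian simple) if it is nonzero, artinian as a ring, and has no $D$-stable ideals other than $0$ and $A$; then $A^D$ is a field. A module over the smash product $K\#D$ is a $K$-module and $D$-module $V$ with $d(av)=\sum (d_{(1)}a)(d_{(2)}v)$; if $K$ is AS, $V$ is automatically free over $K$, and its rank is called the $K$-rank. On tensor products over $K$ of $K\#D$-modules, $D$ acts diagonally. Let $K\subset L$ be an inclusion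 of AS $D$-module algebras. For $S\subset L$, let $K\langle S\rangle$ denote the smallest AS $D$-module subalgebra of $L$ including $K$ and $S$. We say that $L/K$ is - finitely generated, if $L=K\langle S\rangle$ for some finite $S\subset L$; - a minimal splitting algebra for a $K\#D$-module $V$, if there is an injective $L\#D$-linear map $L\otimes_K V\to L^\Lambda$ for some set $\Lambda$, and $L=K\langle S\rangle$ for $S=\bigcup_f f(V)$, where $f$ runs over $\operatorname{Hom}_{K\#D}(V,L)$; - a Picard--Vessiot (PV) extension, if $K^D=L^D$ and there is a $D$-module subalgebra $K\subset A\subset L$ whose total quotient ring is $L$ and such that $(A\otimes_K A)^D$ generates $A\otimes_K A$ as a left $A$-module. **Theorem.** Let $K$ be an AS $D$-module algebra such that the field $K^D$ is algebraically closed, and let $V$ be a $K\#D$-module of finite $K$-rank. Then there exists an AS $D$-module algebra $L$ including $K$ such that $L^D=K^D$ and $L/K$ is a minimal splitting algebra for $V$. Every such $L/K$ is a finitely generated PV extension. Any two such algebras $L_1,L_2$ are isomorphic by a $D$-linear isomorphism of $K$-algebras. -/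

import Mathlib

open scoped TensorProduct

universe u v w x w₁ w₂

namespace PVTheory

section Coalgebras

variable (R D : Type*) [Field R] [Ring D] [HopfAlgebra R D]

/-- A subcoalgebra of `D`: a subspace `C` with `Δ(C) ⊆ C ⊗ C`. -/
def IsSubcoalgebra (C : Submodule R D) : Prop :=
  ∀ c ∈ C, Coalgebra.comul (R := R) c ∈ LinearMap.range (TensorProduct.map C.subtype C.subtype)

/-- A simple subcoalgebra: a nonzero subcoalgebra whose only subcoalgebras are `0` and itself. -/
structure IsSimpleSubcoalgebra (C : Submodule R D) : Prop where
  isSubcoalgebra : IsSubcoalgebra R D C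
  ne_bot : C ≠ ⊥
  eq_of_le : ∀ C' : Submodule R D, IsSubcoalgebra R D C' → C' ≤ C → C' = ⊥ ∨ C' = C

/-- `D` is pointed: every simple subcoalgebra is one-dimensional. -/
def IsPointed : Prop :=
  ∀ C : Submodule R D, IsSimpleSubcoalgebra R D C → Module.finrank R C = 1

variable {D} in
/-- Primitive elements: `Δ(x) = x ⊗ 1 + 1 ⊗ x`. -/
def IsPrimitive (x : D) : Prop :=
  Coalgebra.comul (R := R) x = x ⊗ₜ[R] 1 + 1 ⊗ₜ[R] x

variable {D} in
/-- Divided power sequences of infinite length: `d₀ = 1` and `Δ(dₙ) = ∑_{i=0}^{n} dᵢ ⊗ dₙ₋ᵢ`.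
Their members automatically lie in the irreducible component of `1`. -/
structure IsDividedPowerSequence (d : ℕ → D) : Prop where
  zero : d 0 = 1
  comul : ∀ n, Coalgebra.comul (R := R) (d n) =
    ∑ i ∈ Finset.range (n + 1), d i ⊗ₜ[R] d (n - i)

/-- The irreducible component of `1` in `D` is of Birkhoff-Witt type: every primitive element `x`
lies in a divided power sequence `1, x, d₂, d₃, …` of infinite length. -/
def IsBirkhoffWitt : Prop :=
  ∀ x : D, IsPrimitive R x → ∃ d : ℕ → D, IsDividedPowerSequence R d ∧ d 1 = x

end Coalgebras

section Sweedler

variable {R D : Type*} [Field R] [Ring D] [HopfAlgebra R D]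
variable {M N P : Type*}
  [AddCommGroup M] [Module R M] [Module D M] [IsScalarTower R D M]
  [AddCommGroup N] [Module R N] [Module D N] [IsScalarTower R D N]
  [AddCommGroup P] [Module R P]

/-- The orbit map `d ↦ d m`. -/
def act (m : M) : D →ₗ[R] M := (LinearMap.toSpanSingleton D M m).restrictScalars R

@[simp] theorem act_apply (m : M) (d : D) : act (R := R) m d = d • m := rfl

/-- `sweedler β m n d` is the sum `∑ β(d₍₁₎ m, d₍₂₎ n)` for an `R`-bilinear map `β`. -/
def sweedler (β : M →ₗ[R] N →ₗ[R] P) (m : M) (n : N) : D →ₗ[R] P :=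
  TensorProduct.lift (β.compl₁₂ (act m) (act n)) ∘ₗ Coalgebra.comul

theorem sweedler_eq_sum (β : M →ₗ[R] N →ₗ[R] P) (m : M) (n : N) (d : D)
    {ι : Type*} (𝓡 : Coalgebra.Repr R d ι) :
    sweedler β m n d = ∑ i ∈ 𝓡.index, β (𝓡.left i • m) (𝓡.right i • n) := by
  simp [sweedler, ← 𝓡.eq, map_sum]

/-- If `m` is `D`-invariant then `∑ β(d₍₁₎ m, d₍₂₎ n) = β(m, d n)`. -/
theorem sweedler_of_invariant (β : M →ₗ[R] N →ₗ[R] P) (m : M) (n : N) (d : D)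
    (hm : ∀ c : D, c • m = Coalgebra.counit (R := R) c • m) :
    sweedler β m n d = β m (d • n) := by
  let 𝓡 := Coalgebra.Repr.arbitrary R d
  rw [sweedler_eq_sum β m n d 𝓡]
  have h := Coalgebra.sum_counit_smul 𝓡
  conv_rhs => rw [← h]
  simp [Finset.sum_smul, hm]

theorem sweedler_add_left (β : M →ₗ[R] N →ₗ[R] P) (m m' : M) (n : N) (d : D) :
    sweedler β (m + m') n d = sweedler β m n d + sweedler β m' n d := by
  simp [sweedler_eq_sum β _ _ d (Coalgebra.Repr.arbitrary R d), Finset.sum_add_distrib]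

theorem sweedler_add_right (β : M →ₗ[R] N →ₗ[R] P) (m : M) (n n' : N) (d : D) :
    sweedler β m (n + n') d = sweedler β m n d + sweedler β m n' d := by
  simp [sweedler_eq_sum β _ _ d (Coalgebra.Repr.arbitrary R d), Finset.sum_add_distrib]

end Sweedler

section ModuleAlgebras

variable (R D : Type*) [Field R] [Ring D] [HopfAlgebra R D]

/-- A (commutative) `D`-module algebra: an `R`-algebra and `D`-module `A` with
`d(ab) = ∑ (d₍₁₎ a)(d₍₂₎ b)` and `d(1) = ε(d) 1`. -/
class IsModuleAlgebra (A : Type*) [CommRing A] [Algebra R A] [Module D A]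
    [IsScalarTower R D A] : Prop where
  smul_one : ∀ d : D, d • (1 : A) = algebraMap R A (Coalgebra.counit d)
  smul_mul : ∀ (d : D) (a b : A), d • (a * b) = sweedler (LinearMap.mul R A) a b d

/-- A module over the smash product `K # D`: a `K`-module and `D`-module `V` (with the same
underlying `R`-space) such that `d(a v) = ∑ (d₍₁₎ a)(d₍₂₎ v)`. -/
class IsSmashModule (K V : Type*) [CommRing K] [Algebra R K] [Module D K] [IsScalarTower R D K]
    [AddCommGroup V] [Module R V] [Module K V] [Module D V]
    [IsScalarTower R K V] [IsScalarTower R D V] : Prop where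
  smul_smul : ∀ (d : D) (a : K) (v : V),
    d • (a • v) = sweedler (Algebra.lsmul R R V : K →ₐ[R] Module.End R V).toLinearMap a v d

/-- An inclusion `K ⊂ L` of `D`-module algebras. -/
class IsExtension (K L : Type*) [CommRing K] [Module D K] [CommRing L] [Module D L]
    [Algebra K L] : Prop where
  map_smul : ∀ (d : D) (a : K), algebraMap K L (d • a) = d • algebraMap K L a
  injective : Function.Injective (algebraMap K L)

/-- `A` is AS: artinian as a ring, and simple as a `D`-module algebra, i.e. nonzero and without
non-trivial `D`-stable ideals. -/
class IsAS (A : Type*) [CommRing A] [Module D A] : Prop where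
  artinian : IsArtinianRing A
  nontrivial : Nontrivial A
  eq_bot_or_eq_top : ∀ I : Ideal A, (∀ (d : D), ∀ a ∈ I, d • a ∈ I) → I = ⊥ ∨ I = ⊤

instance (K L : Type*) [CommRing K] [Algebra R K] [Module D K] [IsScalarTower R D K]
    [CommRing L] [Algebra R L] [Module D L] [IsScalarTower R D L] [Algebra K L]
    [IsScalarTower R K L] [IsModuleAlgebra R D L] [IsExtension D K L] :
    IsSmashModule R D K L where
  smul_smul d a v := by
    rw [Algebra.smul_def, IsModuleAlgebra.smul_mul (R := R)]
    simp only [sweedler_eq_sum _ _ _ d (Coalgebra.Repr.arbitrary R d)]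
    simp [← IsExtension.map_smul, Algebra.smul_def]

end ModuleAlgebras

section Constants

variable (R D A : Type*) [Field R] [Ring D] [HopfAlgebra R D]
  [CommRing A] [Algebra R A] [Module D A] [IsScalarTower R D A] [IsModuleAlgebra R D A]

/-- The constants `A^D = {a | d a = ε(d) a for all d}`. -/
def constants : Subalgebra R A where
  carrier := {a | ∀ d : D, d • a = Coalgebra.counit (R := R) d • a}
  mul_mem' {a b} ha hb d := by
    rw [IsModuleAlgebra.smul_mul (R := R), sweedler_of_invariant _ _ _ _ ha, hb]
    simp
  add_mem' {a b} ha hb d := by rw [smul_add, smul_add, ha, hb]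
  algebraMap_mem' r d := by
    rw [Algebra.algebraMap_eq_smul_one, smul_algebra_smul_comm,
      IsModuleAlgebra.smul_one (R := R), Algebra.algebraMap_eq_smul_one, smul_comm]

variable {R D A} in
theorem mem_constants {a : A} :
    a ∈ constants R D A ↔ ∀ d : D, d • a = Coalgebra.counit (R := R) d • a := Iff.rfl

/-- Nonzero constants of an AS algebra are invertible, with constant inverse. -/
theorem exists_inv_constants [IsAS D A] {x : constants R D A} (hx : x ≠ 0) :
    ∃ y : constants R D A, x * y = 1 := by
  obtain ⟨x, hc⟩ := x
  have hst : ∀ d : D, ∀ a ∈ Ideal.span {x}, d • a ∈ Ideal.span {x} := by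
    intro d a ha
    obtain ⟨b, rfl⟩ := Ideal.mem_span_singleton'.1 ha
    rw [mul_comm, IsModuleAlgebra.smul_mul (R := R), sweedler_of_invariant _ _ _ _ hc]
    exact Ideal.mem_span_singleton.2 ⟨_, rfl⟩
  have hx' : x ≠ 0 := fun h => hx (Subtype.ext h)
  rcases IsAS.eq_bot_or_eq_top _ hst with h | h
  · exact absurd (Ideal.span_singleton_eq_bot.1 h) hx'
  · obtain ⟨y, hy⟩ := Ideal.mem_span_singleton'.1 (h ▸ Submodule.mem_top : (1 : A) ∈ _)
    refine ⟨⟨y, fun d => ?_⟩, Subtype.ext (by simpa [mul_comm] using hy)⟩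
    have h1 : x * (d • y) = Coalgebra.counit (R := R) d • (1 : A) := by
      have h2 := IsModuleAlgebra.smul_mul (R := R) d x y
      rw [sweedler_of_invariant _ _ _ _ hc, mul_comm x y, hy,
        IsModuleAlgebra.smul_one (R := R), Algebra.algebraMap_eq_smul_one] at h2
      exact h2.symm
    calc d • y = (y * x) * (d • y) := by rw [hy, one_mul]
      _ = y * (x * (d • y)) := mul_assoc _ _ _
      _ = Coalgebra.counit (R := R) d • y := by rw [h1]; simp

/-- The constants of an AS algebra form a field. -/
noncomputable instance constantsField [IsAS D A] : Field (constants R D A) :=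
  haveI : Nontrivial A := IsAS.nontrivial D
  IsField.toField
    { exists_pair_ne := exists_pair_ne _
      mul_comm := mul_comm
      mul_inv_cancel := fun hx => exists_inv_constants R D A hx }

end Constants

section Tensor

variable (R : Type*) {D : Type*} (K : Type*) {M N : Type*} [Field R] [Ring D] [HopfAlgebra R D]
  [CommRing K] [Algebra R K] [Module D K] [IsScalarTower R D K]
  [AddCommGroup M] [Module R M] [Module K M] [Module D M]
  [IsScalarTower R K M] [IsScalarTower R D M]
  [AddCommGroup N] [Module R N] [Module K N] [Module D N]
  [IsScalarTower R K N] [IsScalarTower R D N]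

variable (M N) in
/-- The `R`-bilinear map `(m, n) ↦ m ⊗ n` into the tensor product over `K`. -/
def tmulBilin : M →ₗ[R] N →ₗ[R] M ⊗[K] N :=
  LinearMap.mk₂ R (fun m n => m ⊗ₜ[K] n) (fun _ _ _ => TensorProduct.add_tmul _ _ _)
    (fun _ _ _ => rfl) (fun _ _ _ => TensorProduct.tmul_add _ _ _)
    (fun _ _ _ => TensorProduct.tmul_smul _ _ _)

@[simp] theorem tmulBilin_apply (m : M) (n : N) : tmulBilin R K M N m n = m ⊗ₜ[K] n := rfl

/-- The Sweedler sums that define the diagonal action are `K`-balanced; this uses cocommutativity. -/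
theorem sweedler_tmul_balanced [Coalgebra.IsCocomm R D] [IsSmashModule R D K M]
    [IsSmashModule R D K N] (d : D) (a : K) (m : M) (n : N) :
    sweedler (tmulBilin R K M N) (a • m) n d = sweedler (tmulBilin R K M N) m (a • n) d := by
  let g₁ : D ⊗[R] D →ₗ[R] M := TensorProduct.lift
    ((Algebra.lsmul R R M : K →ₐ[R] Module.End R M).toLinearMap.compl₁₂
      (act (R := R) (D := D) a) (act m))
  let g₂ : D ⊗[R] D →ₗ[R] N := TensorProduct.lift
    ((Algebra.lsmul R R N : K →ₐ[R] Module.End R N).toLinearMap.compl₁₂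
      (act (R := R) (D := D) a) (act n))
  let T₁ : (D ⊗[R] D) ⊗[R] D →ₗ[R] M ⊗[K] N :=
    TensorProduct.lift ((tmulBilin R K M N).compl₁₂ g₁ (act (R := R) (D := D) n))
  let T₂ : D ⊗[R] (D ⊗[R] D) →ₗ[R] M ⊗[K] N :=
    TensorProduct.lift ((tmulBilin R K M N).compl₁₂ (act (R := R) (D := D) m) g₂)
  have e₁ : act (R := R) (D := D) (a • m) = g₁ ∘ₗ Coalgebra.comul :=
    LinearMap.ext fun c => IsSmashModule.smul_smul (R := R) c a m
  have e₂ : act (R := R) (D := D) (a • n) = g₂ ∘ₗ Coalgebra.comul :=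
    LinearMap.ext fun c => IsSmashModule.smul_smul (R := R) c a n
  have h₁ : sweedler (tmulBilin R K M N) (a • m) n d =
      T₁ (Coalgebra.comul.rTensor D (Coalgebra.comul (R := R) d)) := by
    rw [sweedler, e₁]
    exact LinearMap.congr_fun (TensorProduct.ext' fun _ _ => rfl : TensorProduct.lift
      ((tmulBilin R K M N).compl₁₂ (g₁ ∘ₗ Coalgebra.comul) (act n)) =
        T₁ ∘ₗ Coalgebra.comul.rTensor D) _
  have h₂ : sweedler (tmulBilin R K M N) m (a • n) d =
      T₂ (Coalgebra.comul.lTensor D (Coalgebra.comul (R := R) d)) := by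
    rw [sweedler, e₂]
    exact LinearMap.congr_fun (TensorProduct.ext' fun _ _ => rfl : TensorProduct.lift
      ((tmulBilin R K M N).compl₁₂ (act m) (g₂ ∘ₗ Coalgebra.comul)) =
        T₂ ∘ₗ Coalgebra.comul.lTensor D) _
  have h₃ : T₂ ∘ₗ (TensorProduct.assoc R D D D).toLinearMap =
      T₁ ∘ₗ (TensorProduct.comm R D D).toLinearMap.rTensor D := by
    refine TensorProduct.ext_threefold fun x y z => ?_
    change (x • m) ⊗ₜ[K] ((y • a) • (z • n)) = ((y • a) • (x • m)) ⊗ₜ[K] (z • n)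
    rw [TensorProduct.tmul_smul, TensorProduct.smul_tmul']
  rw [h₁, h₂, ← Coalgebra.coassoc_apply]
  have h₄ := LinearMap.congr_fun h₃ (Coalgebra.comul.rTensor D (Coalgebra.comul (R := R) d))
  refine Eq.trans ?_ h₄.symm
  rw [LinearMap.comp_apply, ← LinearMap.rTensor_comp_apply, Coalgebra.comm_comp_comul]

/-- The diagonal action `d(m ⊗ n) = ∑ d₍₁₎ m ⊗ d₍₂₎ n` of `D` on `M ⊗[K] N`, for
`K # D`-modules `M` and `N`. -/
def tensorAct [Coalgebra.IsCocomm R D] [IsSmashModule R D K M] [IsSmashModule R D K N] (d : D) :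
    M ⊗[K] N →+ M ⊗[K] N :=
  TensorProduct.liftAddHom
    (AddMonoidHom.mk' (fun m => AddMonoidHom.mk' (fun n => sweedler (tmulBilin R K M N) m n d)
        (fun n n' => sweedler_add_right _ m n n' d))
      (fun m m' => AddMonoidHom.ext fun n => sweedler_add_left _ m m' n d))
    (fun a m n => sweedler_tmul_balanced R K d a m n)

theorem tensorAct_tmul [Coalgebra.IsCocomm R D] [IsSmashModule R D K M] [IsSmashModule R D K N]
    (d : D) (m : M) (n : N) :
    tensorAct R K d (m ⊗ₜ[K] n) = sweedler (tmulBilin R K M N) m n d := rfl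

end Tensor

section Stable

variable {R D K L : Type*} [Field R] [Ring D] [HopfAlgebra R D]
  [CommRing K] [Algebra R K]
  [CommRing L] [Algebra R L] [Module D L] [IsScalarTower R D L]
  [Algebra K L] [IsScalarTower R K L]

variable (D) in
/-- The `K`-subalgebra `A` of `L` is a `D`-module subalgebra. -/
class IsStable (A : Subalgebra K L) : Prop where
  smul_mem : ∀ (d : D) (a : L), a ∈ A → d • a ∈ A

instance (A : Subalgebra K L) [IsStable D A] : Module D A where
  smul d a := ⟨d • (a : L), IsStable.smul_mem (A := A) d a a.2⟩
  one_smul a := Subtype.ext (one_smul D (a : L))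
  mul_smul c d a := Subtype.ext (mul_smul c d (a : L))
  smul_zero d := Subtype.ext (smul_zero d)
  smul_add d a b := Subtype.ext (smul_add d (a : L) b)
  add_smul c d a := Subtype.ext (add_smul c d (a : L))
  zero_smul a := Subtype.ext (zero_smul D (a : L))

@[simp] theorem coe_stable_smul (A : Subalgebra K L) [IsStable D A] (d : D) (a : A) :
    ((d • a : A) : L) = d • (a : L) := rfl

instance (A : Subalgebra K L) [IsStable D A] : IsScalarTower R D A where
  smul_assoc r d a := Subtype.ext (smul_assoc r d (a : L))

instance (A : Subalgebra K L) [IsStable D A] [IsModuleAlgebra R D L] : IsModuleAlgebra R D A where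
  smul_one d := Subtype.ext (IsModuleAlgebra.smul_one (R := R) d)
  smul_mul d a b := Subtype.ext (by
    rw [coe_stable_smul, Subalgebra.coe_mul, IsModuleAlgebra.smul_mul (R := R)]
    simp only [sweedler_eq_sum _ _ _ d (Coalgebra.Repr.arbitrary R d)]
    simp)

instance (A : Subalgebra K L) [IsStable D A] [Module D K] [IsExtension D K L] : IsExtension D K A where
  map_smul d a := Subtype.ext (IsExtension.map_smul d a)
  injective := fun _ _ h =>
    IsExtension.injective D (K := K) (L := L) (congrArg Subtype.val h)

end Stable

section Extensions

variable (R D K : Type*) (L : Type v) [Field R] [Ring D] [HopfAlgebra R D]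
  [CommRing K] [Algebra R K] [Module D K] [IsScalarTower R D K] [IsModuleAlgebra R D K]
  [CommRing L] [Algebra R L] [Module D L] [IsScalarTower R D L] [IsModuleAlgebra R D L]
  [Algebra K L] [IsScalarTower R K L]

/-- `K^D = L^D` inside `L`. -/
def SameConstants : Prop :=
  (constants R D K).map (IsScalarTower.toAlgHom R K L) = constants R D L

variable {K L} in
/-- `K⟨S⟩`: the smallest AS `D`-module subalgebra of `L` including `K` and `S`, as the
intersection of all of them. -/
def adjoinAS (S : Set L) : Subalgebra K L :=
  sInf {B | ∃ _ : IsStable D B, IsAS D B ∧ S ⊆ B}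

/-- `L/K` is finitely generated: `L = K⟨u₁, …, uₘ⟩`. -/
def IsFinitelyGenerated : Prop :=
  ∃ S : Finset L, adjoinAS D (S : Set L) = (⊤ : Subalgebra K L)

variable [Coalgebra.IsCocomm R D] [IsExtension D K L]

variable {K L} in
/-- The set `H = (A ⊗[K] A)^D` of `D`-invariants, for a `D`-module subalgebra `A`. -/
def tensorConstants (A : Subalgebra K L) [IsStable D A] : Set (A ⊗[K] A) :=
  {t | ∀ d : D, tensorAct R K d t = Coalgebra.counit (R := R) d • t}

/-- `L/K` is a Picard-Vessiot extension: `K^D = L^D`, and there is a `D`-module subalgebra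
`K ⊂ A ⊂ L` whose total quotient ring is `L` and such that `(A ⊗[K] A)^D` generates the left
`A`-module `A ⊗[K] A`. -/
structure IsPVExtension : Prop where
  sameConstants : SameConstants R D K L
  exists_principal : ∃ (A : Subalgebra K L) (_ : IsStable D A),
    IsFractionRing A L ∧ Submodule.span A (tensorConstants R D A) = ⊤

variable (V : Type w)
  [AddCommGroup V] [Module R V] [Module K V] [Module D V]
  [IsScalarTower R K V] [IsScalarTower R D V] [IsSmashModule R D K V]

/-- `V` splits in `L/K`: there is an `L # D`-linear injection of `L ⊗[K] V` into some power
`L^Λ`. (The universe of `Λ` is no restriction: the factors that occur are given by elements of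
`Hom_{K#D}(V, L)`, and repeated ones can be left out.) -/
def Splits : Prop :=
  ∃ (Λ : Type (max v w)) (φ : L ⊗[K] V →ₗ[L] (Λ → L)),
    (∀ (d : D) (t : L ⊗[K] V), φ (tensorAct R K d t) = d • φ t) ∧ Function.Injective φ

/-- `L/K` is a minimal splitting algebra for `V`: `V` splits in `L/K`, and `L = K⟨V⟩` is the
smallest AS `D`-module subalgebra including `K` and `f(V)` for all `f ∈ Hom_{K#D}(V, L)`. -/
structure IsMinimalSplittingAlgebra : Prop where
  splits : Splits R D K L V
  adjoin_eq_top : adjoinAS D {x : L | ∃ f : V →ₗ[K] L, (∀ (d : D) (v : V), f (d • v) = d • f v) ∧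
    ∃ v, f v = x} = (⊤ : Subalgebra K L)

end Extensions

end PVTheory

open PVTheory

set_option linter.unusedSectionVars false

/-! A splitting algebra arises by adjoining a fundamental matrix: an invertible matrix whose columns
are the values, on a `K`-basis of `V`, of `D`-linear maps from `V`. Two fundamental matrices over
the same algebra differ by a matrix of constants, because both satisfy the same linear system over
`K` (`mem_constants_of_valueMatrix_mulVec`, `exists_constant_coefficients`). This fact drives
everything. Comparing the two copies of the matrix in `A ⊗ A` gives the Picard–Vessiot property
(`span_tensorConstants_principalAlgebra`), and it shows that the entries of one matrix already
generate a minimal splitting algebra (`eq_top_of_hom_basis_mem`).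

For existence, `V` has a fundamental matrix `X` in the coinduced algebra `Hom_R(D, K)`
(`exists_fundamental_matrix`). Pass from `K[X, 1/det X]` to a `D`-simple image `A`
(`exists_isDSimple_range`) and take fractions. A constant fraction lies in `A`, since its ideal of
denominators is stable. A constant `c` of `A` outside `K` would have all `c - l` invertible for `l ∈
K^D`. As `K^D` is algebraically closed, the powers of `c` would be independent over `K^D`, hence
over `K`, and Chevalley's theorem would yield a constant `l` with `c - l` not invertible
(`IsDSimple.exists_algebraMap_eq`).

For uniqueness, take a `D`-simple image of `L₁ ⊗ A₂`. Its constants still come from `K^D`, so the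
two fundamental matrices differ there by an invertible matrix over `K^D`, and `A₁` and `A₂` have the
same image. Since `L₁` embeds, this gives a surjection `A₂ → A₁`
(`exists_surjective_principalAlgebra`). By symmetry there is one in the other direction, and for
noetherian rings both are then bijective.

The structure of `D` enters through two results. Pointedness makes convolution invertibility a
condition at grouplike elements only (`isUnit_conv`); this gives invertible determinants and
stability under inverses. The Birkhoff–Witt condition makes grouplikes and divided powers generate
`D` (`adjoin_groupLike_dividedPower`). Divided powers preserve the nilradical and, in positive
degree, kill idempotents. Hence an AS algebra is a finite product of fields whose factors are
permuted transitively by the grouplikes, which yields bases (`exists_basis`) and the AS property of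
rings of fractions (`isAS_fractions`). -/

namespace PVTheory

/-! ### Subcoalgebras as submodules over the commutative algebra of contractions -/

section Contraction

variable {R D : Type*} [Field R] [AddCommGroup D] [Module R D] [Coalgebra R D]

/-- The operator `d ↦ ∑ f(d₍₂₎) d₍₁₎` on a coalgebra attached to a linear functional `f`. -/
def contract (f : D →ₗ[R] R) : D →ₗ[R] D :=
  (TensorProduct.rid R D).toLinearMap ∘ₗ f.lTensor D ∘ₗ Coalgebra.comul

theorem contract_apply (f : D →ₗ[R] R) (d : D) :
    contract f d = TensorProduct.rid R D (f.lTensor D (Coalgebra.comul (R := R) d)) := rfl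

theorem contract_repr (f : D →ₗ[R] R) {d : D} {ι : Type*} (𝓡 : Coalgebra.Repr R d ι) :
    contract f d = ∑ i ∈ 𝓡.index, f (𝓡.right i) • 𝓡.left i := by
  rw [contract_apply, ← 𝓡.eq]
  simp

theorem contract_counit (d : D) : contract (Coalgebra.counit (R := R)) d = d := by
  rw [contract_apply, Coalgebra.lTensor_counit_comul]
  simp

theorem contract_add (f g : D →ₗ[R] R) : contract (f + g) = contract f + contract g := by
  ext d
  simp [contract_apply, LinearMap.lTensor_add]

theorem contract_smul (r : R) (f : D →ₗ[R] R) : contract (r • f) = r • contract f := by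
  ext d
  simp [contract_apply, LinearMap.lTensor_smul]

/-- By coassociativity both sides apply `f ⊗ g` to the last two factors of the iterated
comultiplication. Contractions therefore form an algebra, commutative when `D` is cocommutative. -/
theorem contract_contract (f g : D →ₗ[R] R) (d : D) :
    contract f (contract g d) =
      contract (WithConv.toConv f * WithConv.toConv g : WithConv (D →ₗ[R] R)).ofConv d := by
  let T : D ⊗[R] (D ⊗[R] D) →ₗ[R] D := (TensorProduct.rid R D).toLinearMap ∘ₗ
    (LinearMap.mul' R R ∘ₗ TensorProduct.map f g).lTensor D
  have h₁ : contract f (contract g d) = T (TensorProduct.assoc R D D D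
      (Coalgebra.comul.rTensor D (Coalgebra.comul (R := R) d))) := by
    have : contract f ∘ₗ (TensorProduct.rid R D).toLinearMap ∘ₗ g.lTensor D =
        T ∘ₗ (TensorProduct.assoc R D D D).toLinearMap ∘ₗ
          Coalgebra.comul.rTensor D := by
      refine TensorProduct.ext' fun a b => ?_
      simp only [LinearMap.comp_apply, LinearMap.lTensor_tmul, LinearEquiv.coe_coe,
        TensorProduct.rid_tmul, map_smul, LinearMap.rTensor_tmul]
      rw [contract_repr f (Coalgebra.Repr.arbitrary R a)]
      conv_rhs => rw [← (Coalgebra.Repr.arbitrary R a).eq]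
      simp [T, TensorProduct.sum_tmul, Finset.smul_sum, smul_smul, mul_comm]
    exact LinearMap.congr_fun this (Coalgebra.comul d)
  rw [h₁, Coalgebra.coassoc_apply]
  have : T ∘ₗ Coalgebra.comul.lTensor D = (TensorProduct.rid R D).toLinearMap ∘ₗ
      (WithConv.toConv f * WithConv.toConv g : WithConv (D →ₗ[R] R)).ofConv.lTensor D :=
    TensorProduct.ext' fun a b => by simp [T, LinearMap.convMul_def]
  exact LinearMap.congr_fun this (Coalgebra.comul d)

theorem counit_contract (f : D →ₗ[R] R) (d : D) :
    Coalgebra.counit (R := R) (contract f d) = f d := by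
  have h := Coalgebra.sum_counit_smul (Coalgebra.Repr.arbitrary R d)
  rw [contract_repr f (Coalgebra.Repr.arbitrary R d)]
  conv_rhs => rw [← h]
  simp [mul_comm]

/-- Elements of a tensor product are separated by functionals on the second factor. -/
theorem tmul_ext_functional {M N : Type*} [AddCommGroup M] [Module R M] [AddCommGroup N]
    [Module R N] {s t : M ⊗[R] N}
    (h : ∀ f : N →ₗ[R] R, TensorProduct.rid R M (f.lTensor M s) =
      TensorProduct.rid R M (f.lTensor M t)) : s = t := by
  classical
  let b := Module.Basis.ofVectorSpace R N
  refine (TensorProduct.equivFinsuppOfBasisRight (M := M) b).injective (Finsupp.ext fun i => ?_)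
  have key : ∀ s : M ⊗[R] N, TensorProduct.equivFinsuppOfBasisRight b s i =
      TensorProduct.rid R M ((b.coord i).lTensor M s) := by
    intro s
    induction s with
    | zero => simp
    | add x y hx hy => simp [hx, hy]
    | tmul x y => simp
  rw [key, key, h]

/-- Lets grouplike and primitive elements be recognised by testing one functional at a time. -/
theorem comul_eq_iff {d : D} {t : D ⊗[R] D} :
    Coalgebra.comul (R := R) d = t ↔
      ∀ f : D →ₗ[R] R, contract f d = TensorProduct.rid R D (f.lTensor D t) :=
  ⟨fun h f => by rw [contract_apply, h], fun h => tmul_ext_functional h⟩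

variable [Coalgebra.IsCocomm R D]

theorem contract_comm (f g : D →ₗ[R] R) (d : D) :
    contract f (contract g d) = contract g (contract f d) := by
  rw [contract_contract, contract_contract, mul_comm]

theorem contract_eq_lid (f : D →ₗ[R] R) (d : D) :
    contract f d = TensorProduct.lid R D (f.rTensor D (Coalgebra.comul (R := R) d)) := by
  rw [contract_apply]
  conv_lhs => rw [← Coalgebra.comm_comul R d]
  have : (TensorProduct.rid R D).toLinearMap ∘ₗ f.lTensor D ∘ₗ
      (TensorProduct.comm R D D).toLinearMap = (TensorProduct.lid R D).toLinearMap ∘ₗ f.rTensor D :=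
    TensorProduct.ext' fun a b => by simp
  exact LinearMap.congr_fun this _

variable (R D) in
/-- The subalgebra of operators `contract f`. -/
def contractSubalgebra : Subalgebra R (Module.End R D) where
  carrier := Set.range contract
  mul_mem' := by
    rintro _ _ ⟨f, rfl⟩ ⟨g, rfl⟩
    exact ⟨_, LinearMap.ext fun d => (contract_contract f g d).symm⟩
  add_mem' := by
    rintro _ _ ⟨f, rfl⟩ ⟨g, rfl⟩
    exact ⟨_, contract_add f g⟩
  algebraMap_mem' r := ⟨r • Coalgebra.counit, by
    ext d; simp [contract_smul, contract_counit, Algebra.algebraMap_eq_smul_one]⟩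

variable (R D) in
/-- The commutative algebra of operators `contract f`; its submodules in `D` are the
subcoalgebras of `D`. -/
def ContractAlg : Type _ := contractSubalgebra R D

instance : CommRing (ContractAlg R D) :=
  { (contractSubalgebra R D).toRing with
    mul_comm := by
      rintro ⟨_, f, rfl⟩ ⟨_, g, rfl⟩
      exact Subtype.ext (LinearMap.ext fun d => contract_comm f g d) }

instance : Algebra R (ContractAlg R D) :=
  inferInstanceAs (Algebra R (contractSubalgebra R D))

instance : Module (ContractAlg R D) D where
  smul a d := a.1 d
  one_smul _ := rfl
  mul_smul _ _ _ := rfl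
  smul_zero a := map_zero a.1
  smul_add a := map_add a.1
  add_smul _ _ _ := rfl
  zero_smul _ := rfl

variable (R) in
/-- `contract f` as an element of `ContractAlg R D`. -/
def contractOp (f : D →ₗ[R] R) : ContractAlg R D := ⟨contract f, f, rfl⟩

@[simp] theorem contractOp_smul (f : D →ₗ[R] R) (d : D) : contractOp R f • d = contract f d := rfl

theorem exists_contractOp (a : ContractAlg R D) : ∃ f, a = contractOp R f := by
  obtain ⟨_, f, rfl⟩ := a
  exact ⟨f, rfl⟩

instance : IsScalarTower R (ContractAlg R D) D where
  smul_assoc _ _ _ := rfl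

/-- A subspace stable under all `contract f`, as a `ContractAlg`-submodule. -/
def ofContractStable (N : Submodule R D) (h : ∀ f : D →ₗ[R] R, ∀ d ∈ N, contract f d ∈ N) :
    Submodule (ContractAlg R D) D where
  __ := N.toAddSubmonoid
  smul_mem' := by
    rintro ⟨_, f, rfl⟩ d hd
    exact h f d hd

@[simp] theorem mem_ofContractStable {N : Submodule R D} {h} {d : D} :
    d ∈ ofContractStable (R := R) N h ↔ d ∈ N := Iff.rfl

theorem contract_mem (N : Submodule (ContractAlg R D) D) (f : D →ₗ[R] R) {d : D} (hd : d ∈ N) :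
    contract f d ∈ N := N.smul_mem (contractOp R f) hd

/-- Finitely generated `ContractAlg`-submodules are finite-dimensional. -/
theorem finite_span_finset (s : Finset D) :
    Module.Finite R (Submodule.span (ContractAlg R D) (s : Set D)) := by
  classical
  let 𝓡 := fun x : D => Coalgebra.Repr.arbitrary R x
  -- All contractions of `x` lie in the span of the left factors of one fixed expression for `Δ(x)`.
  let T : Finset D := s.biUnion fun x => (𝓡 x).index.image (𝓡 x).left
  have h : (Submodule.span (ContractAlg R D) (s : Set D)).restrictScalars R ≤
      Submodule.span R (T : Set D) := by
    intro y hy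
    obtain ⟨a, -, rfl⟩ := Submodule.mem_span_finset.1
      (show y ∈ Submodule.span (ContractAlg R D) (s : Set D) from hy)
    refine Submodule.sum_mem _ fun x hx => ?_
    obtain ⟨f, hf⟩ := exists_contractOp (a x)
    rw [hf, contractOp_smul, contract_repr f (𝓡 x)]
    exact Submodule.sum_mem _ fun i hi => Submodule.smul_mem _ _
      (Submodule.subset_span (Finset.mem_coe.2 (Finset.mem_biUnion.2
        ⟨x, hx, Finset.mem_image_of_mem _ hi⟩)))
  have : Module.Finite R (Submodule.span R (T : Set D)) := Module.Finite.span_finset R _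
  exact Module.Finite.of_injective (Submodule.inclusion h) (Submodule.inclusion_injective h)

theorem finite_span_singleton (x : D) :
    Module.Finite R (Submodule.span (ContractAlg R D) {x}) := by
  have h := finite_span_finset (R := R) {x}
  rwa [Finset.coe_singleton] at h

/-- A `ContractAlg`-submodule is a subcoalgebra. -/
theorem comul_mem_range_map (N : Submodule (ContractAlg R D) D) {c : D} (hc : c ∈ N) :
    Coalgebra.comul (R := R) c ∈ LinearMap.range
      (TensorProduct.map (N.restrictScalars R).subtype (N.restrictScalars R).subtype) := by
  obtain ⟨π, hπ⟩ := (N.restrictScalars R).subtype.exists_leftInverse_of_injective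
    (Submodule.ker_subtype _)
  have hπ' : ∀ y ∈ N, ((π y : N.restrictScalars R) : D) = y := fun y hy =>
    congrArg Subtype.val (LinearMap.congr_fun hπ ⟨y, hy⟩)
  -- A linear projection onto `N`. It fixes `Δ(c)` in the left factor because contractions of `c`
  -- stay in `N`, and in the right factor by cocommutativity.
  let p := (N.restrictScalars R).subtype ∘ₗ π
  have h₁ : p.rTensor D (Coalgebra.comul (R := R) c) = Coalgebra.comul c := by
    refine tmul_ext_functional fun f => ?_
    have : (TensorProduct.rid R D).toLinearMap ∘ₗ f.lTensor D ∘ₗ p.rTensor D =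
        p ∘ₗ (TensorProduct.rid R D).toLinearMap ∘ₗ f.lTensor D :=
      TensorProduct.ext' fun a b => by simp
    exact (LinearMap.congr_fun this _).trans (hπ' _ (contract_mem N f hc))
  have h₂ : p.lTensor D (Coalgebra.comul (R := R) c) = Coalgebra.comul c := by
    have : p.lTensor D ∘ₗ (TensorProduct.comm R D D).toLinearMap =
        (TensorProduct.comm R D D).toLinearMap ∘ₗ p.rTensor D :=
      TensorProduct.ext' fun a b => by simp
    have := LinearMap.congr_fun this (Coalgebra.comul (R := R) c)
    simp only [LinearMap.comp_apply, LinearEquiv.coe_coe, h₁, Coalgebra.comm_comul] at this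
    exact this
  refine ⟨TensorProduct.map π π (Coalgebra.comul c), ?_⟩
  rw [← LinearMap.comp_apply, ← TensorProduct.map_comp]
  change TensorProduct.map p p _ = _
  conv_rhs => rw [← h₂, ← h₁]
  exact (LinearMap.congr_fun (LinearMap.lTensor_comp_rTensor D p p) _).symm

theorem contract_mem_of_comul_mem {N : Submodule R D} {c : D}
    (hc : Coalgebra.comul (R := R) c ∈ LinearMap.range
      (TensorProduct.map N.subtype N.subtype)) (f : D →ₗ[R] R) : contract f c ∈ N := by
  obtain ⟨t, ht⟩ := hc
  rw [contract_apply, ← ht]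
  clear ht
  induction t with
  | zero => simp
  | add a b ha hb =>
    simp only [map_add]
    exact N.add_mem ha hb
  | tmul a b => simpa using N.smul_mem _ a.2

end Contraction

/-! ### Grouplike eigenvectors modulo a subcoalgebra -/

section Socle

/-- If `I ^ N` moves `x` into `H` and `x ∉ H`, then some multiple of `x` outside of `H` is moved
into `H` by `I`. -/
theorem exists_smul_notMem_of_pow {A M : Type*} [CommRing A] [AddCommGroup M] [Module A M]
    (H : Submodule A M) (I : Ideal A) {x : M} (hx : x ∉ H) (N : ℕ)
    (h : ∀ a ∈ I ^ N, a • x ∈ H) : ∃ b : A, b • x ∉ H ∧ ∀ a ∈ I, a • b • x ∈ H := by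
  induction N with
  | zero => exact absurd (by simpa using h 1 (by simp)) hx
  | succ N ih =>
    by_cases hN : ∀ a ∈ I ^ N, a • x ∈ H
    · exact ih hN
    · push Not at hN
      obtain ⟨b, hb, hbx⟩ := hN
      refine ⟨b, hbx, fun a ha => ?_⟩
      rw [smul_smul]
      exact h _ (by rw [pow_succ']; exact Ideal.mul_mem_mul ha hb)

/-- Fitting's lemma for a cyclic module of finite length. -/
theorem exists_pow_smul_eq_zero {A M : Type*} [CommRing A] [AddCommGroup M] [Module A M]
    (m : Ideal A) (x : M) [IsArtinian A (Submodule.span A {x})]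
    [IsNoetherian A (Submodule.span A {x})] :
    ∃ (r : A) (N : ℕ), r - 1 ∈ m ∧ ∀ a ∈ m ^ N, a • r • x = 0 := by
  obtain ⟨N, hN⟩ := IsArtinian.monotone_stabilizes
    (⟨fun n => OrderDual.toDual (m ^ n • (⊤ : Submodule A (Submodule.span A {x}))),
      fun i j hij => Submodule.smul_mono_left (Ideal.pow_le_pow_right hij)⟩ :
      ℕ →o (Submodule A (Submodule.span A {x}))ᵒᵈ)
  have h : m ^ N • (⊤ : Submodule A (Submodule.span A {x})) = m ^ (N + 1) • ⊤ :=
    hN (N + 1) (Nat.le_succ N)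
  -- Nakayama's lemma for the stable power: an element congruent to `1` modulo `m` kills it.
  obtain ⟨r, hr, h0⟩ := Submodule.exists_sub_one_mem_and_smul_eq_zero_of_fg_of_le_smul m
    (m ^ N • (⊤ : Submodule A (Submodule.span A {x}))) (IsNoetherian.noetherian _)
    (by rw [← mul_smul, ← pow_succ', ← h])
  refine ⟨r, N, hr, fun a ha => ?_⟩
  rw [smul_comm]
  exact congrArg Subtype.val (h0 (a • ⟨x, Submodule.mem_span_singleton_self x⟩)
    (Submodule.smul_mem_smul ha trivial))

theorem isArtinian_of_finite_tower (k : Type*) {A M : Type*} [Field k] [CommRing A] [Algebra k A]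
    [AddCommGroup M] [Module A M] [Module k M] [IsScalarTower k A M] (W : Submodule A M)
    (h : Module.Finite k W) : IsArtinian A W :=
  isArtinian_of_tower k inferInstance

theorem isNoetherian_of_finite_tower (k : Type*) {A M : Type*} [Field k] [CommRing A] [Algebra k A]
    [AddCommGroup M] [Module A M] [Module k M] [IsScalarTower k A M] (W : Submodule A M)
    (h : Module.Finite k W) : IsNoetherian A W :=
  isNoetherian_of_tower k inferInstance

variable {R D : Type*} [Field R] [Ring D] [HopfAlgebra R D] [Coalgebra.IsCocomm R D]

theorem contract_groupLike {g : D} (hg : IsGroupLikeElem R g) (f : D →ₗ[R] R) :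
    contract f g = f g • g := by
  rw [contract_apply, hg.comul_eq_tmul_self]
  simp

/-- In a pointed cocommutative coalgebra, an element killed by a maximal ideal of `ContractAlg` is a
multiple of a grouplike element. -/
theorem exists_groupLike_of_isMaximal (hD : IsPointed R D) {m : Ideal (ContractAlg R D)}
    (hm : m.IsMaximal) {y : D} (hy : y ≠ 0) (hmy : ∀ a ∈ m, a • y = 0) :
    ∃ g : D, IsGroupLikeElem R g ∧ g ∈ Submodule.span (ContractAlg R D) {y} ∧
      Ideal.torsionOf (ContractAlg R D) D g = m := by
  set S := Submodule.span (ContractAlg R D) {y} with hS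
  have hyS : y ∈ S := Submodule.mem_span_singleton_self y
  -- A scalar outside `m` is invertible modulo `m`, so every nonzero multiple of `y` regenerates `y`
  -- and `S` is simple.
  have hgen : ∀ z ∈ S, z ≠ 0 → y ∈ Submodule.span (ContractAlg R D) {z} := by
    intro z hz hz0
    obtain ⟨a, rfl⟩ := Submodule.mem_span_singleton.1 hz
    have ha : a ∉ m := fun h => hz0 (hmy a h)
    obtain ⟨b, c, hc, hb⟩ := hm.exists_inv ha
    refine Submodule.mem_span_singleton.2 ⟨b, ?_⟩
    rw [smul_smul, ← add_zero ((b * a) • y), ← hmy c hc, ← add_smul, hb, one_smul]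
  have hsimple : IsSimpleSubcoalgebra R D (S.restrictScalars R) := by
    refine ⟨fun c hc => comul_mem_range_map S hc, ?_, fun C' hC' hle => ?_⟩
    · intro h
      exact hy ((Submodule.mem_bot R).1 (h ▸ hyS))
    · by_cases h0 : C' = ⊥
      · exact Or.inl h0
      · right
        obtain ⟨z, hz, hz0⟩ := Submodule.exists_mem_ne_zero_of_ne_bot h0
        refine le_antisymm hle fun w hw => ?_
        have h1 : Submodule.span (ContractAlg R D) {z} ≤ ofContractStable (R := R) C'
            fun f d hd => contract_mem_of_comul_mem (hC' d hd) f :=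
          (Submodule.span_singleton_le_iff_mem _ _).2 hz
        have h2 : S ≤ _ := (Submodule.span_singleton_le_iff_mem _ _).2 (hgen z (hle hz) hz0)
        exact h1 (h2 hw)
  have h1 := finrank_eq_one_iff_of_nonzero' (K := R) (⟨y, hyS⟩ : S.restrictScalars R)
    (fun h => hy (congrArg Subtype.val h)) |>.1 (hD _ hsimple)
  have hχ : ∀ f : D →ₗ[R] R, ∃ r : R, contract f y = r • y := by
    intro f
    obtain ⟨r, hr⟩ := h1 ⟨contract f y, contract_mem S f hyS⟩
    exact ⟨r, (congrArg Subtype.val hr).symm⟩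
  -- By pointedness each contraction is a scalar on the line through `y`, and the counit reads the
  -- scalar off. This forces `ε(y) ≠ 0`, and `y / ε(y)` is grouplike.
  have hεy : ∀ f : D →ₗ[R] R, f y • y = Coalgebra.counit (R := R) y • contract f y := by
    intro f
    obtain ⟨r, hr⟩ := hχ f
    have := counit_contract f y
    rw [hr, map_smul] at this
    rw [← this, hr, smul_eq_mul, smul_smul, mul_comm]
  have hε : Coalgebra.counit (R := R) y ≠ 0 := by
    intro h0
    obtain ⟨φ, hφ⟩ := Module.Projective.exists_dual_ne_zero R hy
    have := hεy φ
    rw [h0, zero_smul, smul_eq_zero] at this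
    exact this.elim hφ hy
  set e := Coalgebra.counit (R := R) y with he
  have hgl : IsGroupLikeElem R (e⁻¹ • y) := by
    refine ⟨by simp [← he, hε], comul_eq_iff.2 fun f => ?_⟩
    rw [map_smul, LinearMap.lTensor_tmul, TensorProduct.rid_tmul, map_smul, smul_smul, smul_eq_mul,
      mul_assoc, mul_comm (f y), ← mul_assoc, ← smul_smul, hεy, smul_smul]
    congr 1
    field_simp
  refine ⟨e⁻¹ • y, hgl, Submodule.smul_of_tower_mem _ _ hyS, ?_⟩
  refine (hm.eq_of_le ?_ fun a ha => ?_).symm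
  · rw [Ne, Ideal.eq_top_iff_one, Ideal.mem_torsionOf_iff, one_smul]
    exact hgl.ne_zero
  · rw [Ideal.mem_torsionOf_iff, smul_comm, hmy a ha, smul_zero]

/-- A subcoalgebra `C` of a pointed cocommutative Hopf algebra that is not contained in the
subcoalgebra `H` has an element outside of `H` that is grouplike-eigen modulo `H`. -/
theorem exists_contract_sub_mem (hD : IsPointed R D) {H C : Submodule (ContractAlg R D) D}
    (hHC : ¬ C ≤ H) : ∃ x ∈ C, x ∉ H ∧ ∃ g ∈ C, IsGroupLikeElem R g ∧
      (∀ f : D →ₗ[R] R, contract f x - f g • x ∈ H) ∧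
      ∃ N, ∀ a ∈ Ideal.torsionOf (ContractAlg R D) D g ^ N, a • x = 0 := by
  obtain ⟨x₀, hx₀C, hx₀⟩ := SetLike.not_le_iff_exists.1 hHC
  obtain ⟨m, hm, hIm⟩ := Ideal.exists_le_maximal
    (Ideal.torsionOf (ContractAlg R D) (D ⧸ H) (H.mkQ x₀)) (by
      rw [Ne, Ideal.eq_top_iff_one, Ideal.mem_torsionOf_iff, one_smul]
      simpa using hx₀)
  have hW := finite_span_singleton (R := R) x₀
  have : IsArtinian (ContractAlg R D) (Submodule.span (ContractAlg R D) {x₀}) :=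
    isArtinian_of_finite_tower R _ hW
  have : IsNoetherian (ContractAlg R D) (Submodule.span (ContractAlg R D) {x₀}) :=
    isNoetherian_of_finite_tower R _ hW
  -- As `r ≡ 1` modulo `m`, it is not among the annihilators of `x₀` modulo `H`, all of which lie in
  -- `m`. So `r • x₀` is still outside `H`, and now a power of `m` kills it.
  obtain ⟨r, N, hr, hN⟩ := exists_pow_smul_eq_zero m x₀
  have hrx : r • x₀ ∉ H := by
    intro h
    have : r ∈ m := hIm (by
      rw [Ideal.mem_torsionOf_iff, ← map_smul]
      exact (Submodule.Quotient.mk_eq_zero H).2 h)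
    exact hm.ne_top ((Ideal.eq_top_iff_one _).2 (by simpa using m.sub_mem this hr))
  obtain ⟨b, hb, hbH⟩ := exists_smul_notMem_of_pow H m hrx N fun a ha => by
    rw [hN a ha]; exact H.zero_mem
  have hr0 : r • x₀ ∉ (⊥ : Submodule (ContractAlg R D) D) := fun h => by
    rw [Submodule.mem_bot] at h
    exact hrx (h ▸ H.zero_mem)
  -- The same descent with `H` replaced by `0` gives a true eigenvector inside `C`. It produces the
  -- grouplike `g` with annihilator `m`, which then identifies the eigenvalues of `b • r • x₀`
  -- modulo `H`.
  obtain ⟨c, hc, hc0⟩ := exists_smul_notMem_of_pow ⊥ m hr0 N fun a ha => by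
    rw [hN a ha]; exact Submodule.zero_mem _
  obtain ⟨g, hg, hgy, hgm⟩ := exists_groupLike_of_isMaximal hD hm
    (y := c • r • x₀) (by simpa using hc) (fun a ha => by simpa using hc0 a ha)
  have hle : Submodule.span (ContractAlg R D) {c • r • x₀} ≤ C :=
    (Submodule.span_singleton_le_iff_mem _ _).2 (C.smul_mem _ (C.smul_mem _ hx₀C))
  refine ⟨b • r • x₀, C.smul_mem _ (C.smul_mem _ hx₀C), hb, g, hle hgy, hg, fun f => ?_,
    N, fun a ha => ?_⟩
  · have hmem : contractOp R f - algebraMap R _ (f g) ∈ m := by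
      rw [← hgm, Ideal.mem_torsionOf_iff, sub_smul, contractOp_smul, contract_groupLike hg,
        algebraMap_smul, sub_self]
    have := hbH _ hmem
    rwa [sub_smul, contractOp_smul, algebraMap_smul] at this
  · rw [hgm] at ha
    rw [smul_comm, hN a ha, smul_zero]

end Socle

/-! ### Convolution invertibility is detected by grouplike elements -/

section UnitCriterion

variable {R D : Type*} [Field R] [Ring D] [HopfAlgebra R D] [Coalgebra.IsCocomm R D]
variable {B : Type*} [CommRing B] [Algebra R B]

/-- The map `d ↦ ∑ f(d₍₁₎) ⊗ d₍₂₎`. -/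
def leftTwist (f : D →ₗ[R] B) : D →ₗ[R] B ⊗[R] D := f.rTensor D ∘ₗ Coalgebra.comul

/-- Contractions determine `Δ(x)` modulo the kernel of `π` in the right factor; cocommutativity
allows contracting the left factor instead of the right. -/
theorem lTensor_leftTwist {M : Type*} [AddCommGroup M] [Module R M] (f : D →ₗ[R] B)
    (π : D →ₗ[R] M) (x : D) (t : D ⊗[R] M)
    (h : ∀ φ : D →ₗ[R] R, π (contract φ x) = TensorProduct.lid R M (φ.rTensor M t)) :
    π.lTensor B (leftTwist f x) = f.rTensor M t := by
  have h₁ : π.lTensor D (Coalgebra.comul (R := R) x) = t := by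
    refine (TensorProduct.comm R D M).injective (tmul_ext_functional fun φ => ?_)
    have key : (TensorProduct.rid R M).toLinearMap ∘ₗ φ.lTensor M ∘ₗ
        (TensorProduct.comm R D M).toLinearMap =
        (TensorProduct.lid R M).toLinearMap ∘ₗ φ.rTensor M :=
      TensorProduct.ext' fun a b => by simp
    have key₂ : (TensorProduct.lid R M).toLinearMap ∘ₗ φ.rTensor M ∘ₗ π.lTensor D =
        π ∘ₗ (TensorProduct.lid R D).toLinearMap ∘ₗ φ.rTensor D :=
      TensorProduct.ext' fun a b => by simp
    have e₁ := LinearMap.congr_fun key (π.lTensor D (Coalgebra.comul (R := R) x))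
    have e₂ := LinearMap.congr_fun key t
    have e₃ := LinearMap.congr_fun key₂ (Coalgebra.comul (R := R) x)
    simp only [LinearMap.comp_apply, LinearEquiv.coe_coe] at e₁ e₂ e₃
    rw [e₁, e₂, e₃, ← h φ, contract_eq_lid]
  rw [← h₁, leftTwist, LinearMap.comp_apply, ← LinearMap.comp_apply (π.lTensor B),
    ← LinearMap.comp_apply (f.rTensor M), LinearMap.lTensor_comp_rTensor,
    LinearMap.rTensor_comp_lTensor]

variable (B) in
/-- The `B`-submodule of `B ⊗ D` generated by a subcoalgebra `H` of `D`. -/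
def baseSub (H : Submodule (ContractAlg R D) D) : Submodule B (B ⊗[R] D) :=
  LinearMap.range ((H.restrictScalars R).subtype.baseChange B)

theorem baseSub_le_iff {H : Submodule (ContractAlg R D) D} {N : Submodule B (B ⊗[R] D)} :
    baseSub B H ≤ N ↔ ∀ h ∈ H, (1 : B) ⊗ₜ[R] h ∈ N := by
  constructor
  · intro hle h hh
    exact hle ⟨1 ⊗ₜ ⟨h, hh⟩, by simp⟩
  · rintro hN _ ⟨t, rfl⟩
    induction t with
    | zero => simp
    | add a b ha hb => rw [map_add]; exact N.add_mem ha hb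
    | tmul b h =>
      have : b ⊗ₜ[R] (h : D) = b • ((1 : B) ⊗ₜ[R] (h : D)) := by
        rw [TensorProduct.smul_tmul', smul_eq_mul, mul_one]
      rw [LinearMap.baseChange_tmul, Submodule.subtype_apply, this]
      exact N.smul_mem _ (hN _ h.2)

theorem tmul_mem_baseSub {H : Submodule (ContractAlg R D) D} (b : B) {h : D} (hh : h ∈ H) :
    b ⊗ₜ[R] h ∈ baseSub B H := ⟨b ⊗ₜ ⟨h, hh⟩, by simp⟩

theorem baseSub_mono {H H' : Submodule (ContractAlg R D) D} (h : H ≤ H') :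
    baseSub B H ≤ baseSub B H' :=
  baseSub_le_iff.2 fun _ hx => tmul_mem_baseSub 1 (h hx)

theorem mem_baseSub_iff {H : Submodule (ContractAlg R D) D} {t : B ⊗[R] D} :
    t ∈ baseSub B H ↔ (H.restrictScalars R).mkQ.lTensor B t = 0 := by
  rw [(lTensor_exact B (LinearMap.exact_subtype_mkQ (H.restrictScalars R))
    (Submodule.mkQ_surjective _)) t]
  rfl

/-- If `f` is invertible at all grouplike elements then `d ↦ ∑ f(d₍₁₎) ⊗ d₍₂₎` extends to
an automorphism of `B ⊗ D`. -/
theorem bijective_leftTwist (hD : IsPointed R D) (f : D →ₗ[R] B)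
    (hf : ∀ g : D, IsGroupLikeElem R g → IsUnit (f g)) :
    Function.Bijective ((leftTwist f).liftBaseChange B) := by
  set F := (leftTwist f).liftBaseChange B with hF
  have hF1 : ∀ x, F (1 ⊗ₜ x) = leftTwist f x := fun x => by simp [hF]
  have hstable : ∀ W : Submodule (ContractAlg R D) D, ∀ t ∈ baseSub B W, F t ∈ baseSub B W := by
    intro W
    have : baseSub B W ≤ (baseSub B W).comap F := baseSub_le_iff.2 fun h hh => by
      rw [Submodule.mem_comap, hF1, mem_baseSub_iff, lTensor_leftTwist f _ h 0, map_zero]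
      intro φ
      rw [map_zero, map_zero]
      exact (Submodule.Quotient.mk_eq_zero _).2 (contract_mem W φ hh)
    exact this
  have hsurj : ∀ W : Submodule (ContractAlg R D) D, Module.Finite R W →
      baseSub B W ≤ (baseSub B W).map F := by
    intro W hW
    have : IsNoetherian (ContractAlg R D) W := isNoetherian_of_finite_tower R _ hW
    -- The subcoalgebras of `W` on which `F` is already onto. A maximal one exists as `W` is
    -- noetherian, and an eigenvector outside it would enlarge it.
    let P : Set (Submodule (ContractAlg R D) W) := {H | baseSub B (H.map W.subtype) ≤
      (baseSub B (H.map W.subtype)).map F}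
    obtain ⟨H₀, hH₀, hmax⟩ := wellFounded_gt.has_min P ⟨⊥, by
      refine baseSub_le_iff.2 fun h hh => ?_
      rw [Submodule.map_bot, Submodule.mem_bot] at hh
      rw [hh, TensorProduct.tmul_zero]
      exact Submodule.zero_mem _⟩
    set H := H₀.map W.subtype with hH
    have hHW : H ≤ W := by
      rintro _ ⟨y, -, rfl⟩
      exact y.2
    by_cases hWH : W ≤ H
    · exact le_antisymm hWH hHW ▸ hH₀
    exfalso
    obtain ⟨x, hxW, hxH, g, -, hg, hx, -⟩ := exists_contract_sub_mem hD hWH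
    -- Modulo `H` the comultiplication of `x` is `g ⊗ x`, so `F` multiplies `1 ⊗ x` by the unit `f
    -- g`.
    have hFx : leftTwist f x - f g ⊗ₜ x ∈ baseSub B H := by
      rw [mem_baseSub_iff, map_sub, lTensor_leftTwist f _ x
        (g ⊗ₜ (H.restrictScalars R).mkQ x)]
      · simp
      · intro φ
        rw [LinearMap.rTensor_tmul, TensorProduct.lid_tmul, ← map_smul, ← sub_eq_zero, ← map_sub]
        exact (Submodule.Quotient.mk_eq_zero _).2 (hx φ)
    obtain ⟨u, hu⟩ := hf g hg
    have hH'W : H ⊔ Submodule.span _ {x} ≤ W :=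
      sup_le hHW ((Submodule.span_singleton_le_iff_mem _ _).2 hxW)
    set H' := H ⊔ Submodule.span (ContractAlg R D) {x} with hH'
    have hxH' : x ∈ H' := Submodule.mem_sup_right (Submodule.mem_span_singleton_self x)
    have hle : baseSub B H ≤ (baseSub B H').map F :=
      le_trans hH₀ (Submodule.map_mono (baseSub_mono le_sup_left))
    have hx1 : (1 : B) ⊗ₜ[R] x ∈ (baseSub B H').map F := by
      have h1 : F ((↑u⁻¹ : B) ⊗ₜ x) - 1 ⊗ₜ x ∈ baseSub B H := by
        have := (baseSub B H).smul_mem (↑u⁻¹ : B) hFx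
        rw [smul_sub, TensorProduct.smul_tmul', smul_eq_mul, ← hu, Units.inv_mul] at this
        simpa [hF] using this
      have h2 := Submodule.sub_mem _
        (Submodule.mem_map_of_mem (f := F) (tmul_mem_baseSub (↑u⁻¹ : B) hxH')) (hle h1)
      simpa using h2
    have hmem : (H'.comap W.subtype) ∈ P := by
      have e : (H'.comap W.subtype).map W.subtype = H' := by
        rw [Submodule.map_comap_subtype, inf_eq_right.2 hH'W]
      change baseSub B ((H'.comap W.subtype).map W.subtype) ≤ _
      rw [e]
      refine baseSub_le_iff.2 fun h hh => ?_
      obtain ⟨y, hy, z, hz, rfl⟩ := Submodule.mem_sup.1 hh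
      rw [TensorProduct.tmul_add]
      refine Submodule.add_mem _ (hle (tmul_mem_baseSub 1 hy)) ?_
      obtain ⟨a, rfl⟩ := Submodule.mem_span_singleton.1 hz
      obtain ⟨φ, rfl⟩ := exists_contractOp a
      rw [contractOp_smul, ← sub_add_cancel (contract φ x) (φ g • x), TensorProduct.tmul_add]
      refine Submodule.add_mem _ (hle (tmul_mem_baseSub 1 (hx φ))) ?_
      rw [TensorProduct.tmul_smul]
      exact Submodule.smul_of_tower_mem _ _ hx1
    refine hmax _ hmem (lt_of_le_of_ne (fun y hy => ?_) fun h => hxH ?_)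
    · exact Submodule.mem_sup_left (Submodule.mem_map_of_mem (f := W.subtype) hy)
    · have : (⟨x, hxW⟩ : W) ∈ H'.comap W.subtype := hxH'
      rw [← h] at this
      exact Submodule.mem_map_of_mem (f := W.subtype) this
  have hinj : ∀ W : Submodule (ContractAlg R D) D, Module.Finite R W →
      ∀ t ∈ baseSub B W, F t = 0 → t = 0 := by
    intro W hW t ht h0
    have : Module.Finite R (W.restrictScalars R) := hW
    have : Module.Finite B (baseSub B W) := Module.Finite.range _
    -- Injectivity comes for free: a surjective endomorphism of a finitely generated module over a
    -- commutative ring is injective.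
    let G : baseSub B W →ₗ[B] baseSub B W := F.restrict (hstable W)
    have hG : Function.Surjective G := by
      rintro ⟨y, hy⟩
      obtain ⟨z, hz, rfl⟩ := hsurj W hW hy
      exact ⟨⟨z, hz⟩, rfl⟩
    have := OrzechProperty.injective_of_surjective_endomorphism G hG
      (a₁ := ⟨t, ht⟩) (a₂ := 0) (Subtype.ext (by simpa [G] using h0))
    exact congrArg Subtype.val this
  constructor
  · rw [injective_iff_map_eq_zero]
    intro t ht
    obtain ⟨W, hW, htW⟩ : ∃ W : Submodule (ContractAlg R D) D, Module.Finite R W ∧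
        t ∈ baseSub B W := by
      obtain ⟨S, rfl⟩ := TensorProduct.exists_finset t
      classical
      refine ⟨_, finite_span_finset (R := R) (S.image Prod.snd),
        Submodule.sum_mem _ fun i hi => tmul_mem_baseSub _ (Submodule.subset_span ?_)⟩
      exact Finset.mem_coe.2 (Finset.mem_image_of_mem _ hi)
    exact hinj W hW t htW ht
  · rw [← LinearMap.range_eq_top, eq_top_iff]
    rintro t -
    induction t with
    | zero => exact Submodule.zero_mem _
    | add a b ha hb => exact Submodule.add_mem _ ha hb
    | tmul b x =>
      have hx := hsurj _ (finite_span_singleton (R := R) x)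
        (tmul_mem_baseSub b (Submodule.mem_span_singleton_self x))
      exact LinearMap.map_le_range hx

/-- A linear map from a pointed cocommutative Hopf algebra to a commutative algebra is convolution
invertible if its values at grouplike elements are. -/
theorem isUnit_conv (hD : IsPointed R D) (f : WithConv (D →ₗ[R] B))
    (hf : ∀ g : D, IsGroupLikeElem R g → IsUnit (f g)) : IsUnit f := by
  let e := LinearEquiv.ofBijective _ (bijective_leftTwist hD f.ofConv hf)
  let ε : B ⊗[R] D →ₗ[B] B :=
    (Algebra.linearMap R B ∘ₗ (Coalgebra.counit (R := R) (A := D))).liftBaseChange B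
  -- If the twist by `f` is `e`, convolving with `f` amounts to composing with `e`; so the inverse
  -- is the counit composed with `e⁻¹`.
  let h' : B ⊗[R] D →ₗ[B] B := ε ∘ₗ e.symm.toLinearMap
  let h : D →ₗ[R] B := h'.restrictScalars R ∘ₗ TensorProduct.mk R B D 1
  refine IsUnit.of_mul_eq_one (WithConv.toConv h) (WithConv.ext (LinearMap.ext fun d => ?_))
  have h1 : h' (leftTwist f.ofConv d) = algebraMap R B (Coalgebra.counit d) := by
    have : leftTwist f.ofConv d = e (1 ⊗ₜ d) := by simp [e]
    rw [this]
    simp [h', ε]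
  have h2 : LinearMap.mul' R B ∘ₗ TensorProduct.map f.ofConv h =
      h'.restrictScalars R ∘ₗ f.ofConv.rTensor D := by
    refine TensorProduct.ext' fun a b => ?_
    have : f a ⊗ₜ[R] b = f a • ((1 : B) ⊗ₜ[R] b) := by
      rw [TensorProduct.smul_tmul', smul_eq_mul, mul_one]
    simp only [LinearMap.comp_apply, TensorProduct.map_tmul, LinearMap.mul'_apply,
      LinearMap.rTensor_tmul, LinearMap.restrictScalars_apply, this, map_smul]
    rfl
  exact (LinearMap.congr_fun h2 (Coalgebra.comul d)).trans h1

end UnitCriterion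

/-! ### Ordered products of divided powers and the functionals dual to them -/

section DividedPowers

open Finset.HasAntidiagonal

variable {R D : Type*} [Field R] [Ring D] [HopfAlgebra R D]

/-- By induction only the terms `i = 0` and `i = n` survive in the counit law for `d n`, which then
reads `d n + ε(d n) = d n`. -/
theorem IsDividedPowerSequence.counit {d : ℕ → D} (hd : IsDividedPowerSequence R d) (n : ℕ) :
    Coalgebra.counit (R := R) (d n) = if n = 0 then 1 else 0 := by
  induction n using Nat.strong_induction_on with
  | _ n ih =>
    rcases Nat.eq_zero_or_pos n with rfl | hn
    · simp [hd.zero]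
    have h := Coalgebra.rTensor_counit_comul (R := R) (d n)
    rw [hd.comul n, map_sum] at h
    have h' := congrArg (TensorProduct.lid R D) h
    simp only [map_sum, LinearMap.rTensor_tmul, TensorProduct.lid_tmul, one_smul] at h'
    rw [Finset.sum_range_succ, Finset.sum_eq_single 0] at h'
    · rw [hd.zero, Bialgebra.counit_one, one_smul, Nat.sub_zero, add_eq_left, Nat.sub_self, hd.zero] at h'
      have := congrArg (Coalgebra.counit (R := R)) h'
      rw [map_smul, Bialgebra.counit_one, map_zero, smul_eq_mul, mul_one] at this
      rw [this, if_neg hn.ne']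
    · intro i hi h0
      rw [ih i (Finset.mem_range.1 hi), if_neg h0, zero_smul]
    · intro h
      exact absurd (Finset.mem_range.2 hn) h

/-- Separates the exponent of a new variable, so that comultiplications of products can be computed
one variable at a time. -/
theorem sum_antidiagonal_single_add {ι M : Type*} [DecidableEq ι] [AddCommMonoid M] (i : ι) (b : ℕ)
    (f : ι →₀ ℕ) (hi : f i = 0) (φ : (ι →₀ ℕ) × (ι →₀ ℕ) → M) :
    ∑ p ∈ antidiagonal (Finsupp.single i b + f), φ p =
      ∑ q ∈ Finset.range (b + 1), ∑ p ∈ antidiagonal f,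
        φ (Finsupp.single i q + p.1, Finsupp.single i (b - q) + p.2) := by
  rw [← Finset.sum_product']
  refine Finset.sum_nbij' (fun p => (p.1 i, (p.1.erase i, p.2.erase i)))
    (fun q => (Finsupp.single i q.1 + q.2.1, Finsupp.single i (b - q.1) + q.2.2)) ?_ ?_ ?_ ?_ ?_
  · rintro ⟨p, q⟩ hp
    rw [mem_antidiagonal] at hp
    simp only [Finset.mem_product, Finset.mem_range, mem_antidiagonal]
    refine ⟨?_, ?_⟩
    · have := DFunLike.congr_fun hp i
      simp [hi] at this
      omega
    · ext j
      have := DFunLike.congr_fun hp j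
      by_cases hj : j = i
      · subst hj; simp [hi]
      · simpa [Finsupp.erase_ne hj, Finsupp.single_eq_of_ne hj] using this
  · rintro ⟨k, p, q⟩ h
    simp only [Finset.mem_product, Finset.mem_range, mem_antidiagonal] at h ⊢
    rw [← h.2, add_add_add_comm, ← Finsupp.single_add]
    congr 2
    omega
  · rintro ⟨p, q⟩ hp
    rw [mem_antidiagonal] at hp
    have hb : b - p i = q i := by
      have := DFunLike.congr_fun hp i
      simp [hi] at this
      omega
    simp only [hb, Finsupp.single_add_erase]
  · rintro ⟨k, p, q⟩ h
    simp only [Finset.mem_product, Finset.mem_range, mem_antidiagonal] at h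
    have h' := DFunLike.congr_fun h.2 i
    simp only [Finsupp.add_apply, hi, Nat.add_eq_zero_iff] at h'
    have e : ∀ (n : ℕ) (p : ι →₀ ℕ), p i = 0 → (Finsupp.single i n + p).erase i = p := by
      intro n p hp
      ext j
      by_cases hj : j = i
      · subst hj; simp [hp]
      · simp [Finsupp.erase_ne hj]
    refine Prod.ext ?_ (Prod.ext (e _ _ h'.1) (e _ _ h'.2))
    simp [h'.1]
  · rintro ⟨p, q⟩ hp
    rw [mem_antidiagonal] at hp
    have hb : b - p i = q i := by
      have := DFunLike.congr_fun hp i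
      simp [hi] at this
      omega
    simp only [hb, Finsupp.single_add_erase]

variable {ι : Type*} [LinearOrder ι]

/-- Ordered products of members of divided power sequences. -/
def dpProd (d : ι → ℕ → D) (a : ι →₀ ℕ) : D :=
  ((a.support.sort (· ≤ ·)).map fun i => d i (a i)).prod

theorem dpProd_zero (d : ι → ℕ → D) : dpProd d 0 = 1 := by simp [dpProd]

variable {d : ι → ℕ → D} (hd : ∀ i, IsDividedPowerSequence R (d i))
include hd

theorem dpProd_single_add (i : ι) (b : ℕ) (f : ι →₀ ℕ) (hf : ∀ c ∈ f.support, i < c) :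
    dpProd d (Finsupp.single i b + f) = d i b * dpProd d f := by
  have hi : i ∉ f.support := fun h => lt_irrefl _ (hf i h)
  rcases eq_or_ne b 0 with rfl | hb
  · simp [(hd i).zero]
  have hs : (Finsupp.single i b + f).support = insert i f.support := by
    rw [Finsupp.support_add_eq, Finsupp.support_single i hb]
    · rfl
    · rw [Finsupp.support_single i hb]
      simpa using hi
  rw [dpProd, hs, Finset.sort_insert _ (fun c hc => (hf c hc).le) hi, List.map_cons,
    List.prod_cons, dpProd]
  congr 1
  · rw [Finsupp.notMem_support_iff] at hi
    simp [hi]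
  · congr 1
    refine List.map_congr_left fun c hc => ?_
    have : c ≠ i := fun h => hi (h ▸ (Finset.mem_sort _).1 hc)
    simp [Finsupp.single_eq_of_ne this]

/-- Comultiplication is multiplicative, and splitting off the smallest index keeps both tensor
factors in order although `D` need not be commutative. As a result functionals on these products
multiply like power series. -/
theorem comul_dpProd (a : ι →₀ ℕ) : Coalgebra.comul (R := R) (dpProd d a) =
    ∑ p ∈ antidiagonal a, dpProd d p.1 ⊗ₜ[R] dpProd d p.2 := by
  induction a using Finsupp.induction_on_min with
  | zero => simp [dpProd_zero, Algebra.TensorProduct.one_def]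
  | single_add i b f hf hb ih =>
    have hi : f i = 0 := by
      rw [← Finsupp.notMem_support_iff]
      exact fun h => lt_irrefl _ (hf i h)
    rw [dpProd_single_add hd i b f hf, Bialgebra.comul_mul, (hd i).comul, ih,
      sum_antidiagonal_single_add i b f hi, Finset.sum_mul]
    refine Finset.sum_congr rfl fun q _ => ?_
    rw [Finset.mul_sum]
    refine Finset.sum_congr rfl fun p hp => ?_
    rw [mem_antidiagonal] at hp
    have h₁ : ∀ c ∈ p.1.support, i < c := fun c hc => hf c (by
      rw [Finsupp.mem_support_iff] at hc ⊢
      have := DFunLike.congr_fun hp c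
      simp at this; omega)
    have h₂ : ∀ c ∈ p.2.support, i < c := fun c hc => hf c (by
      rw [Finsupp.mem_support_iff] at hc ⊢
      have := DFunLike.congr_fun hp c
      simp at this; omega)
    rw [dpProd_single_add hd _ _ _ h₁, dpProd_single_add hd _ _ _ h₂,
      Algebra.TensorProduct.tmul_mul_tmul]

theorem counit_dpProd (a : ι →₀ ℕ) :
    Coalgebra.counit (R := R) (dpProd d a) = if a = 0 then 1 else 0 := by
  induction a using Finsupp.induction_on_min with
  | zero => simp [dpProd_zero]
  | single_add i b f hf hb ih =>
    rw [dpProd_single_add hd i b f hf, Bialgebra.counit_mul, (hd i).counit, if_neg hb, zero_mul,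
      if_neg]
    intro h
    have := DFunLike.congr_fun h i
    simp at this
    exact hb this.1

theorem dpProd_single_one (i : ι) : dpProd d (Finsupp.single i 1) = d i 1 := by
  have := dpProd_single_add hd i 1 0 (by simp)
  simpa [dpProd_zero] using this

theorem contract_dpProd (f : D →ₗ[R] R) (a : ι →₀ ℕ) : contract f (dpProd d a) =
    ∑ p ∈ antidiagonal a, f (dpProd d p.2) • dpProd d p.1 := by
  rw [contract_apply, comul_dpProd hd]
  simp

/-- The restriction of functionals to the ordered products of divided powers is
multiplicative. -/
def dpSeries : WithConv (D →ₗ[R] R) →+* MvPowerSeries ι R where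
  toFun f := (fun a => f (dpProd d a) : (ι →₀ ℕ) → R)
  map_one' := by
    refine MvPowerSeries.ext fun a => ?_
    classical
    rw [MvPowerSeries.coeff_one]
    exact counit_dpProd hd a
  map_mul' f g := by
    refine MvPowerSeries.ext fun a => ?_
    refine Eq.trans ?_ (MvPowerSeries.coeff_mul (R := R) a _ _).symm
    change (f * g) (dpProd d a) = _
    rw [LinearMap.convMul_apply, comul_dpProd hd, map_sum, map_sum]
    convert! rfl
  map_zero' := rfl
  map_add' f g := rfl

theorem coeff_dpSeries (f : WithConv (D →ₗ[R] R)) (a : ι →₀ ℕ) :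
    (dpSeries hd f).coeff a = f (dpProd d a) := rfl

omit hd in
/-- Products of power series `τ i ≡ X i` modulo higher order terms. -/
theorem coeff_prod_of_degree_le (τ : ι → MvPowerSeries ι R) (h₀ : ∀ i, (τ i).coeff 0 = 0)
    (h₁ : ∀ i j, (τ i).coeff (Finsupp.single j 1) = if j = i then 1 else 0)
    (m : Multiset ι) : ∀ b : ι →₀ ℕ, b.degree ≤ m.card →
      ((m.map τ).prod).coeff b = if b = m.toFinsupp then 1 else 0 := by
  induction m using Multiset.induction with
  | empty =>
    intro b hb
    simp only [Multiset.card_zero, Nat.le_zero, Finsupp.degree_eq_zero_iff] at hb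
    simp [hb]
  | cons i m ih =>
    intro b hb
    rw [Multiset.map_cons, Multiset.prod_cons, MvPowerSeries.coeff_mul]
    rw [Multiset.card_cons] at hb
    have hdeg : m.toFinsupp.degree = m.card := Multiset.toFinsupp_sum_eq m
    have key : ∀ p ∈ antidiagonal b, (τ i).coeff p.1 * ((m.map τ).prod).coeff p.2 =
        if p = (Finsupp.single i 1, m.toFinsupp) then 1 else 0 := by
      rintro ⟨p, q⟩ hp
      rw [mem_antidiagonal] at hp
      have hpq : p.degree + q.degree = b.degree := by rw [← hp, map_add]
      rcases eq_or_ne p 0 with rfl | hp0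
      · simp [h₀, Finsupp.single_eq_zero, eq_comm (a := (0 : ι →₀ ℕ))]
      have hp1 : 0 < p.degree := Nat.pos_of_ne_zero fun h => hp0 (Finsupp.degree_eq_zero_iff _ |>.1 h)
      rw [ih q (by omega)]
      by_cases hq : q = m.toFinsupp
      · have : p.degree = 1 := by rw [hq, hdeg] at hpq; omega
        obtain ⟨j, rfl⟩ : ∃ j, p = Finsupp.single j 1 := by
          have hc : Multiset.card (Finsupp.toMultiset p) = 1 := by
            rw [Finsupp.card_toMultiset]; exact this
          obtain ⟨j, hj⟩ := Multiset.card_eq_one.1 hc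
          refine ⟨j, ?_⟩
          rw [← Multiset.toFinsupp_singleton, ← hj, Finsupp.toMultiset_toFinsupp]
        rw [h₁]
        simp [hq, Finsupp.single_left_inj]
      · simp [hq]
    rw [Finset.sum_congr rfl key, Finset.sum_ite_eq']
    simp only [mem_antidiagonal]
    have : Multiset.toFinsupp (i ::ₘ m) = Finsupp.single i 1 + m.toFinsupp := by
      rw [← Multiset.singleton_add, map_add, Multiset.toFinsupp_singleton]
    rw [this]
    simp [eq_comm]

variable (R) in
omit hd in
/-- Products of functionals in the convolution algebra. -/
noncomputable def convProd (T : ι → D →ₗ[R] R) (m : Multiset ι) [Coalgebra.IsCocomm R D] : D →ₗ[R] R :=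
  ((m.map fun i => WithConv.toConv (T i)).prod : WithConv (D →ₗ[R] R)).ofConv

variable [Coalgebra.IsCocomm R D]

/-- Functionals dual to the elements `d i 1` have power series `X i` plus terms of degree at least
two. Their products are triangular with respect to degree, so a product matched to a term of maximal
degree in a relation isolates its coefficient. -/
theorem linearIndependent_dpProd (h1 : LinearIndependent R fun i => d i 1) :
    LinearIndependent R (dpProd d) := by
  classical
  obtain ⟨t, ht⟩ := (Finsupp.linearCombination R fun i => d i 1).exists_leftInverse_of_injective
    (LinearMap.ker_eq_bot.2 h1)
  have ht' : ∀ j, t (d j 1) = Finsupp.single j 1 := fun j => by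
    simpa using LinearMap.congr_fun ht (Finsupp.single j 1)
  -- Subtracting a multiple of the counit makes the value at `1` vanish and leaves the values at the
  -- `d j 1` unchanged.
  let T : ι → D →ₗ[R] R := fun i =>
    (Finsupp.lapply i ∘ₗ t) - (t 1 i) • Coalgebra.counit
  have key : ∀ (m : Multiset ι) (b : ι →₀ ℕ), b.degree ≤ m.card →
      convProd R T m (dpProd d b) = if b = m.toFinsupp then 1 else 0 := by
    intro m b hb
    have := coeff_prod_of_degree_le (fun i => dpSeries hd (WithConv.toConv (T i)))
      (fun i => by
        rw [coeff_dpSeries, dpProd_zero]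
        simp [T])
      (fun i j => by
        rw [coeff_dpSeries, dpProd_single_one hd]
        simp [T, ht', (hd j).counit, Finsupp.single_apply]) m b hb
    rw [← this, convProd, ← coeff_dpSeries hd, map_multiset_prod, Multiset.map_map]
    rfl
  rw [linearIndependent_iff']
  intro s c hc
  by_contra! hne
  obtain ⟨b₀, hb₀, hcb₀⟩ := hne
  obtain ⟨b, hb, hmax⟩ := (s.filter fun b => c b ≠ 0).exists_max_image Finsupp.degree
    ⟨b₀, Finset.mem_filter.2 ⟨hb₀, hcb₀⟩⟩
  rw [Finset.mem_filter] at hb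
  have h := congrArg (convProd R T (Finsupp.toMultiset b)) hc
  rw [map_sum, map_zero, Finset.sum_eq_single b] at h
  · rw [map_smul, key _ _ (by rw [Finsupp.card_toMultiset]; exact le_rfl)] at h
    simp at h
    exact hb.2 h
  · intro b' hb' hne
    by_cases hc' : c b' = 0
    · rw [hc', zero_smul, map_zero]
    · rw [map_smul, key _ _ (by
        rw [Finsupp.card_toMultiset]
        exact hmax b' (Finset.mem_filter.2 ⟨hb', hc'⟩))]
      simp [hne]
  · exact fun h => absurd hb.1 h

/-- Functionals dual to the ordered products of divided powers. -/
theorem convProd_dpProd {T : ι → D →ₗ[R] R}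
    (hT : ∀ i b, T i (dpProd d b) = if b = Finsupp.single i 1 then 1 else 0)
    (m : Multiset ι) (b : ι →₀ ℕ) :
    convProd R T m (dpProd d b) = if b = m.toFinsupp then 1 else 0 := by
  classical
  have h : ∀ i, dpSeries hd (WithConv.toConv (T i)) = MvPowerSeries.X i := by
    intro i
    refine MvPowerSeries.ext fun b => ?_
    rw [coeff_dpSeries, MvPowerSeries.coeff_X]
    exact hT i b
  have key : (m.map fun i => (MvPowerSeries.X i : MvPowerSeries ι R)).prod =
      MvPowerSeries.monomial m.toFinsupp 1 := by
    induction m using Multiset.induction with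
    | empty => simp [MvPowerSeries.monomial_zero_one]
    | cons i m ih =>
      rw [Multiset.map_cons, Multiset.prod_cons, ih, ← Multiset.singleton_add, map_add,
        Multiset.toFinsupp_singleton, MvPowerSeries.X, MvPowerSeries.monomial_mul_monomial, one_mul]
  rw [convProd, ← coeff_dpSeries hd, map_multiset_prod, Multiset.map_map]
  simp only [Function.comp_def, h, key, MvPowerSeries.coeff_monomial]

omit hd in
theorem convProd_zero (T : ι → D →ₗ[R] R) : convProd R T 0 = Coalgebra.counit := by
  simp [convProd, LinearMap.convOne_def]

omit hd in
theorem convProd_contract (T : ι → D →ₗ[R] R) (m : Multiset ι) (f : D →ₗ[R] R) (x : D) :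
    convProd R T m (contract f x) = f (contract (convProd R T m) x) := by
  rw [← counit_contract, contract_comm, counit_contract]

omit hd in
theorem convProd_add (T : ι → D →ₗ[R] R) (m m' : Multiset ι) (x : D) :
    convProd R T (m + m') x = convProd R T m (contract (convProd R T m') x) := by
  rw [← counit_contract (convProd R T m), contract_contract, counit_contract]
  simp [convProd]

theorem contract_dpProd_mem_span (f : D →ₗ[R] R) {y : D}
    (hy : y ∈ Submodule.span R (Set.range (dpProd d))) :
    contract f y ∈ Submodule.span R (Set.range (dpProd d)) := by
  have : Submodule.span R (Set.range (dpProd d)) ≤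
      (Submodule.span R (Set.range (dpProd d))).comap (contract f) := by
    rw [Submodule.span_le]
    rintro _ ⟨a, rfl⟩
    rw [SetLike.mem_coe, Submodule.mem_comap, contract_dpProd hd]
    exact Submodule.sum_mem _ fun p _ => Submodule.smul_mem _ _ (Submodule.subset_span ⟨_, rfl⟩)
  exact this hy

/-- If the primitive members of the sequences `d i` form a basis of the space of primitive
elements, an element that is primitive modulo the span of the ordered products belongs to that
span. -/
theorem mem_span_dpProd_of_contract_sub_mem (h1 : LinearIndependent R fun i => d i 1)
    (hspan : ∀ x : D, IsPrimitive R x → x ∈ Submodule.span R (Set.range fun i => d i 1)) {x : D}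
    (hx : ∀ f : D →ₗ[R] R, contract f x - f 1 • x ∈ Submodule.span R (Set.range (dpProd d))) :
    x ∈ Submodule.span R (Set.range (dpProd d)) := by
  classical
  set B := Submodule.span R (Set.range (dpProd d)) with hB
  have hli := linearIndependent_dpProd hd h1
  obtain ⟨τ, hτ⟩ := (Finsupp.linearCombination R (dpProd d)).exists_leftInverse_of_injective
    (LinearMap.ker_eq_bot.2 hli)
  have hτE : ∀ b, τ (dpProd d b) = Finsupp.single b 1 := fun b => by
    simpa using LinearMap.congr_fun hτ (Finsupp.single b 1)
  -- Once independence is known the functionals can be chosen with power series exactly `X i`; their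
  -- convolution products are then dual to all the ordered products.
  let T : ι → D →ₗ[R] R := fun i => Finsupp.lapply (Finsupp.single i 1) ∘ₗ τ
  have hTE : ∀ i b, T i (dpProd d b) = if b = Finsupp.single i 1 then 1 else 0 := by
    intro i b
    simp [T, hτE, Finsupp.single_apply]
  have hE := convProd_dpProd hd hTE
  have hlin : ∀ y ∈ B, ∃ c : (ι →₀ ℕ) →₀ R, y = Finsupp.linearCombination R (dpProd d) c ∧
      ∀ m, convProd R T m y = c m.toFinsupp := by
    intro y hy
    obtain ⟨c, rfl⟩ := (Finsupp.mem_span_range_iff_exists_finsupp).1 hy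
    refine ⟨c, by rw [Finsupp.linearCombination_apply], fun m => ?_⟩
    rw [map_finsuppSum]
    simp only [map_smul, hE, smul_eq_mul, mul_ite, mul_one, mul_zero]
    simp +contextual [Finsupp.sum, eq_comm]
  have h1E : dpProd d 0 = 1 := dpProd_zero d
  have h1B : (1 : D) ∈ B := Submodule.subset_span ⟨0, h1E⟩
  have hT1 : ∀ i, T i 1 = 0 := fun i => by
    rw [← h1E, hTE, if_neg]
    exact fun h => by simpa using DFunLike.congr_fun h i
  have hsep : ∀ y ∈ B, (∀ m, convProd R T m y = 0) → y = 0 := by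
    intro y hy h
    obtain ⟨c, rfl, hc⟩ := hlin y hy
    have : c = 0 := Finsupp.ext fun b => by
      have := hc (Finsupp.toMultiset b)
      rw [h, Finsupp.toMultiset_toFinsupp] at this
      exact this.symm
    rw [this, map_zero]
  have hTB : ∀ f : D →ₗ[R] R, f 1 = 0 → contract f x ∈ B := fun f hf => by
    simpa [hf] using hx f
  -- Only finitely many `contract (T i) x` are nonzero, since `Δ(x)` involves finitely many right
  -- factors. Each of them lies in `B`, where only finitely many products take a nonzero value.
  have hfin : {m : Multiset ι | convProd R T m x ≠ 0}.Finite := by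
    let 𝓡 := Coalgebra.Repr.arbitrary R x
    choose! c hc hc' using hlin
    let I : Finset ι := 𝓡.index.biUnion fun k =>
      (τ (𝓡.right k)).support.biUnion fun b => b.support
    refine ((Finset.finite_toSet (insert (0 : Multiset ι) (I.biUnion fun i =>
      (c (contract (T i) x)).support.image fun b => i ::ₘ Finsupp.toMultiset b)))).subset ?_
    intro m hm
    rw [Finset.mem_coe, Finset.mem_insert]
    induction m using Multiset.induction with
    | empty => exact Or.inl rfl
    | cons i m _ =>
      right
      have hcT : convProd R T (i ::ₘ m) x = c (contract (T i) x) m.toFinsupp := by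
        rw [← hc' _ (hTB _ (hT1 i)), ← Multiset.singleton_add, add_comm, convProd_add]
        simp [convProd]
      rw [Set.mem_ofPred_eq, hcT] at hm
      refine Finset.mem_biUnion.2 ⟨i, ?_, Finset.mem_image.2 ⟨m.toFinsupp,
        Finsupp.mem_support_iff.2 hm, by simp⟩⟩
      by_contra hi
      have h0 : contract (T i) x = 0 := by
        rw [contract_repr _ 𝓡]
        refine Finset.sum_eq_zero fun k hk => ?_
        have : T i (𝓡.right k) = 0 := by
          by_contra hne
          refine hi (Finset.mem_biUnion.2 ⟨k, hk, Finset.mem_biUnion.2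
            ⟨Finsupp.single i 1, Finsupp.mem_support_iff.2 hne, by simp⟩⟩)
        rw [this, zero_smul]
      have h00 := hc' 0 B.zero_mem m
      rw [map_zero] at h00
      rw [h0, ← h00] at hm
      exact hm rfl
  -- The Taylor expansion of `x`: all products of the `T i` vanish on `x - y`.
  let y : D := ∑ m ∈ hfin.toFinset, convProd R T m x • dpProd d m.toFinsupp
  have hyB : y ∈ B := Submodule.sum_mem _ fun m _ =>
    Submodule.smul_mem _ _ (Submodule.subset_span ⟨_, rfl⟩)
  have hy : ∀ m, convProd R T m (x - y) = 0 := by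
    intro m
    rw [map_sub, map_sum]
    simp only [map_smul, hE, smul_eq_mul, mul_ite, mul_one, mul_zero,
      EmbeddingLike.apply_eq_iff_eq]
    by_cases hm : convProd R T m x = 0
    · simp [hm]
    · simp [hm]
  have hx' : ∀ f : D →ₗ[R] R, contract f (x - y) - f 1 • (x - y) ∈ B := by
    intro f
    have := B.sub_mem (hx f) (B.sub_mem (contract_dpProd_mem_span hd f hyB)
      (B.smul_mem (f 1) hyB))
    convert! this using 1
    rw [map_sub, smul_sub]
    abel
  set z := x - y with hz
  have hTz : ∀ m ≠ 0, contract (convProd R T m) z = 0 := by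
    intro m hm
    refine hsep _ ?_ fun m' => ?_
    · have h0 : convProd R T m 1 = 0 := by
        rw [← h1E, hE, if_neg]
        intro h
        exact hm (Multiset.toFinsupp.injective (by rw [← h, map_zero]))
      simpa [h0] using hx' (convProd R T m)
    · rw [← convProd_add, hy]
  -- The defect of primitivity, contracted by `f`, lies in `B` and is killed by all products of the
  -- `T i`; these separate the points of `B`.
  have hprim : IsPrimitive R z := by
    rw [IsPrimitive, comul_eq_iff]
    intro f
    have h0 : contract f z - f 1 • z - f z • 1 = 0 := by
      refine hsep _ (B.sub_mem (hx' f) (B.smul_mem _ h1B)) fun m => ?_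
      rw [map_sub, map_sub, map_smul, map_smul, hy, smul_zero, sub_zero]
      rcases eq_or_ne m 0 with rfl | hm
      · rw [convProd_zero, counit_contract, Bialgebra.counit_one, smul_eq_mul, mul_one, sub_self]
      · rw [convProd_contract, hTz m hm, map_zero, ← h1E, hE, if_neg, smul_zero, sub_zero]
        intro h
        exact hm (Multiset.toFinsupp.injective (by rw [← h, map_zero]))
    simp only [map_add, LinearMap.lTensor_tmul, TensorProduct.rid_tmul]
    rw [sub_sub, sub_eq_zero] at h0
    exact h0
  have hzB : z ∈ B := by
    refine (Submodule.span_le.2 ?_ : _ ≤ B) (hspan z hprim)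
    rintro _ ⟨i, rfl⟩
    exact Submodule.subset_span ⟨_, dpProd_single_one hd i⟩
  have := B.add_mem hzB hyB
  rwa [hz, sub_add_cancel] at this

end DividedPowers

/-! ### Grouplike elements and divided powers generate the Hopf algebra -/

section Generation

variable {R D : Type*} [Field R] [Ring D] [HopfAlgebra R D] [Coalgebra.IsCocomm R D]

theorem mem_torsionOf_groupLike {g : D} (hg : IsGroupLikeElem R g) {a : ContractAlg R D} :
    a ∈ Ideal.torsionOf (ContractAlg R D) D g ↔ ∃ f, f g = 0 ∧ a = contractOp R f := by
  rw [Ideal.mem_torsionOf_iff]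
  constructor
  · intro h
    obtain ⟨f, rfl⟩ := exists_contractOp a
    rw [contractOp_smul, contract_groupLike hg, smul_eq_zero] at h
    exact ⟨f, h.resolve_right hg.ne_zero, rfl⟩
  · rintro ⟨f, hf, rfl⟩
    rw [contractOp_smul, contract_groupLike hg, hf, zero_smul]

variable (R D) in
/-- The irreducible component of `1`. -/
def unitComponent : Submodule (ContractAlg R D) D where
  carrier := {x | ∃ N, ∀ a ∈ Ideal.torsionOf (ContractAlg R D) D 1 ^ N, a • x = 0}
  zero_mem' := ⟨0, fun _ _ => smul_zero _⟩
  add_mem' := by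
    rintro x y ⟨N, hN⟩ ⟨M, hM⟩
    refine ⟨N + M, fun a ha => ?_⟩
    rw [smul_add, hN a (Ideal.pow_le_pow_right (Nat.le_add_right N M) ha),
      hM a (Ideal.pow_le_pow_right (Nat.le_add_left M N) ha), add_zero]
  smul_mem' := by
    rintro c x ⟨N, hN⟩
    exact ⟨N, fun a ha => by rw [smul_smul, mul_comm, ← smul_smul, hN a ha, smul_zero]⟩

/-- The functional `f - f(1) ε` vanishes at `1`, and its contraction acts on `g` by the scalar `f(g)
- f(1)`. Membership makes this scalar nilpotent for every `f`. -/
theorem eq_one_of_mem_unitComponent {g : D} (hg : IsGroupLikeElem R g)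
    (h : g ∈ unitComponent R D) : g = 1 := by
  obtain ⟨N, hN⟩ := h
  rw [← sub_eq_zero, ← Module.forall_dual_apply_eq_zero_iff R]
  intro f
  let f' : D →ₗ[R] R := f - f 1 • Coalgebra.counit
  have h1 : contractOp R f' ∈ Ideal.torsionOf (ContractAlg R D) D 1 :=
    (mem_torsionOf_groupLike IsGroupLikeElem.one).2 ⟨f', by simp [f'], rfl⟩
  have h2 : ∀ n, (contractOp R f') ^ n • g = (f g - f 1) ^ n • g := by
    intro n
    induction n with
    | zero => simp
    | succ n ih =>
      rw [pow_succ', ← smul_smul, ih, contractOp_smul, map_smul, contract_groupLike hg, smul_smul,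
        pow_succ]
      simp [f', hg.counit_eq_one]
  have h3 := h2 N
  rw [hN _ (Ideal.pow_mem_pow h1 N), eq_comm, smul_eq_zero] at h3
  rw [map_sub]
  exact eq_zero_of_pow_eq_zero (h3.resolve_right hg.ne_zero)

theorem contract_groupLike_mul {g : D} (hg : IsGroupLikeElem R g) (f : D →ₗ[R] R) (x : D) :
    contract f (g * x) = g * contract (f ∘ₗ LinearMap.mulLeft R g) x := by
  let 𝓡 := Coalgebra.Repr.arbitrary R x
  rw [contract_repr _ 𝓡, contract_apply, Bialgebra.comul_mul, hg.comul_eq_tmul_self, ← 𝓡.eq,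
    Finset.mul_sum, map_sum, map_sum, Finset.mul_sum]
  simp

/-- Translation by the inverse of `g` moves the component of `g` to that of `1`: if `f` vanishes at
`1`, contracting `g' * x` by `f` amounts to contracting `x` by `f(g' ·)`, which vanishes at `g`. -/
theorem groupLike_mul_mem_unitComponent {g g' : D} (hg : IsGroupLikeElem R g)
    (hg' : IsGroupLikeElem R g') (h : g' * g = 1) (N : ℕ) : ∀ {x : D},
    (∀ a ∈ Ideal.torsionOf (ContractAlg R D) D g ^ N, a • x = 0) →
    ∀ a ∈ Ideal.torsionOf (ContractAlg R D) D 1 ^ N, a • (g' * x) = 0 := by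
  induction N with
  | zero =>
    intro x hx a _
    have := hx 1 (by simp)
    rw [one_smul] at this
    rw [this, mul_zero, smul_zero]
  | succ N ih =>
    intro x hx a ha
    rw [pow_succ] at ha
    refine Submodule.mul_induction_on ha (fun u hu v hv => ?_) fun u v hu hv => ?_
    · obtain ⟨f, hf, rfl⟩ := (mem_torsionOf_groupLike IsGroupLikeElem.one).1 hv
      rw [← smul_smul, contractOp_smul, contract_groupLike_mul hg']
      refine ih (fun b hb => ?_) u hu
      have hmem : contractOp R (f ∘ₗ LinearMap.mulLeft R g') ∈
          Ideal.torsionOf (ContractAlg R D) D g :=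
        (mem_torsionOf_groupLike hg).2 ⟨_, by simp [h, hf], rfl⟩
      rw [← contractOp_smul, smul_smul]
      exact hx _ (by rw [pow_succ]; exact Ideal.mul_mem_mul hb hmem)
    · rw [add_smul, hu, hv, add_zero]

/-- A pointed cocommutative Hopf algebra whose unit component is of Birkhoff-Witt type is generated
by its grouplike elements and the members of divided power sequences. -/
theorem adjoin_groupLike_dividedPower (hD : IsPointed R D) (hBW : IsBirkhoffWitt R D) :
    Algebra.adjoin R ({g : D | IsGroupLikeElem R g} ∪
      {y | ∃ d, IsDividedPowerSequence R d ∧ ∃ n, d n = y}) = ⊤ := by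
  classical
  set H := Algebra.adjoin R ({g : D | IsGroupLikeElem R g} ∪
      {y | ∃ d, IsDividedPowerSequence R d ∧ ∃ n, d n = y}) with hH
  have hgH : ∀ g, IsGroupLikeElem R g → g ∈ H := fun g hg => Algebra.subset_adjoin (Or.inl hg)
  have hdH : ∀ d, IsDividedPowerSequence R d → ∀ n, d n ∈ H := fun d hd n =>
    Algebra.subset_adjoin (Or.inr ⟨d, hd, n, rfl⟩)
  let P : Submodule R D :=
    { carrier := {x | IsPrimitive R x}
      zero_mem' := by simp [IsPrimitive]
      add_mem' := by
        intro a b ha hb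
        change Coalgebra.comul (a + b) = _
        rw [map_add, show Coalgebra.comul a = _ from ha, show Coalgebra.comul b = _ from hb,
          TensorProduct.add_tmul, TensorProduct.tmul_add]
        abel
      smul_mem' := by
        intro r a ha
        change Coalgebra.comul (r • a) = _
        rw [map_smul, show Coalgebra.comul a = _ from ha, smul_add, TensorProduct.smul_tmul',
          TensorProduct.tmul_smul] }
  let b := Module.Basis.ofVectorSpace R P
  -- Any linear order will do; it only fixes the order of the factors in `dpProd`.
  let : LinearOrder (Module.Basis.ofVectorSpaceIndex R P) := linearOrderOfSTO WellOrderingRel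
  choose d hd hd1 using fun i => hBW (b i : D) (b i).2
  have h1 : LinearIndependent R fun i => d i 1 := by
    simp only [hd1]
    exact b.linearIndependent.map' P.subtype (Submodule.ker_subtype _)
  have hspan : ∀ x : D, IsPrimitive R x → x ∈ Submodule.span R (Set.range fun i => d i 1) := by
    intro x hx
    simp only [hd1]
    have := Submodule.mem_map_of_mem (f := P.subtype) (b.mem_span ⟨x, hx⟩)
    rwa [Submodule.map_span, ← Set.range_comp] at this
  have hBH : Submodule.span R (Set.range (dpProd d)) ≤ Subalgebra.toSubmodule H := by
    rw [Submodule.span_le]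
    rintro _ ⟨a, rfl⟩
    refine Subalgebra.list_prod_mem H fun y hy => ?_
    obtain ⟨i, -, rfl⟩ := List.mem_map.1 hy
    exact hdH _ (hd i) _
  have hcomp : ∀ x ∈ unitComponent R D, x ∈ H := by
    let N : Submodule (ContractAlg R D) D :=
      ofContractStable (R := R) (Submodule.span R (Set.range (dpProd d)))
        fun f y hy => contract_dpProd_mem_span hd f hy
    -- Otherwise there is an eigenvector outside `N` modulo `N`. Its grouplike lies in the unit
    -- component, hence is `1`, so the eigenvector is primitive modulo `N`.
    have hle : unitComponent R D ≤ N := by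
      by_contra hle
      obtain ⟨x, -, hxN, g, hgU, hg, hx, -⟩ := exists_contract_sub_mem hD hle
      rw [eq_one_of_mem_unitComponent hg hgU] at hx
      exact hxN (mem_span_dpProd_of_contract_sub_mem hd h1 hspan hx)
    exact fun x hx => hBH (hle hx)
  have hcomul : ∀ x ∈ H, Coalgebra.comul (R := R) x ∈ LinearMap.range (TensorProduct.map
      (Subalgebra.toSubmodule H).subtype (Subalgebra.toSubmodule H).subtype) := by
    have : H ≤ (Algebra.TensorProduct.map H.val H.val).range.comap
        (Bialgebra.comulAlgHom R D) := by
      rw [hH]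
      refine Algebra.adjoin_le ?_
      rintro y (hg | ⟨d, hd, n, rfl⟩)
      · refine ⟨⟨y, hgH y hg⟩ ⊗ₜ ⟨y, hgH y hg⟩, ?_⟩
        exact (IsGroupLikeElem.comul_eq_tmul_self hg).symm
      · refine ⟨∑ i ∈ Finset.range (n + 1), ⟨d i, hdH d hd i⟩ ⊗ₜ ⟨d (n - i), hdH d hd _⟩, ?_⟩
        rw [map_sum]
        exact (hd.comul n).symm
    exact fun x hx => this hx
  let N : Submodule (ContractAlg R D) D := ofContractStable (R := R) (Subalgebra.toSubmodule H)
    fun f y hy => contract_mem_of_comul_mem (hcomul y hy) f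
  by_contra hne
  have hle : ¬ (⊤ : Submodule (ContractAlg R D) D) ≤ N := fun hle =>
    hne (eq_top_iff.2 fun x _ => hle (show x ∈ ⊤ from trivial))
  -- An element outside the generated algebra, supported at `g`; its translate by the antipode of
  -- `g` lies in the unit component, which is already covered.
  obtain ⟨x, -, hxN, g, -, hg, -, n, hn⟩ := exists_contract_sub_mem hD hle
  have hx' : HopfAlgebra.antipode R g * x ∈ H := hcomp _ ⟨n, fun a ha =>
    groupLike_mul_mem_unitComponent hg hg.antipode hg.antipode_mul_cancel n hn a ha⟩
  refine hxN ?_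
  have := H.mul_mem (hgH g hg) hx'
  rwa [← mul_assoc, hg.mul_antipode_cancel, one_mul] at this

end Generation

/-! ### Reducedness of `D`-simple algebras and transitivity on maximal ideals -/

section Actions

variable {R D : Type*} [Field R] [Ring D] [HopfAlgebra R D]

section Smash

variable {K V : Type*} [CommRing K] [Algebra R K] [Module D K] [IsScalarTower R D K]
    [AddCommGroup V] [Module R V] [Module K V] [Module D V]
    [IsScalarTower R K V] [IsScalarTower R D V] [IsSmashModule R D K V]

theorem groupLike_smul_smul {g : D} (hg : IsGroupLikeElem R g) (a : K) (v : V) :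
    g • (a • v) = (g • a) • (g • v) := by
  rw [IsSmashModule.smul_smul (R := R), sweedler, LinearMap.comp_apply, hg.comul_eq_tmul_self]
  simp

/-- The additive automorphism given by a grouplike element. -/
@[simps]
def groupLikeAddEquiv {g : D} (hg : IsGroupLikeElem R g) (V : Type*) [AddCommGroup V]
    [Module D V] : V ≃+ V where
  toFun v := g • v
  invFun v := HopfAlgebra.antipode R g • v
  left_inv v := by beta_reduce; rw [smul_smul, hg.antipode_mul_cancel, one_smul]
  right_inv v := by beta_reduce; rw [smul_smul, hg.mul_antipode_cancel, one_smul]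
  map_add' := smul_add g

/-- The form in which the generation theorem is used: grouplikes act by automorphisms and divided
powers by Leibniz rules, so both can be handled directly. -/
theorem stable_of_generators [Coalgebra.IsCocomm R D] (hD : IsPointed R D)
    (hBW : IsBirkhoffWitt R D) {M : Type*} [AddCommGroup M] [Module R M] [Module D M]
    [IsScalarTower R D M] (N : Submodule R M)
    (hg : ∀ g : D, IsGroupLikeElem R g → ∀ m ∈ N, g • m ∈ N)
    (hd : ∀ d : ℕ → D, IsDividedPowerSequence R d → ∀ n, ∀ m ∈ N, d n • m ∈ N)
    (c : D) {m : M} (hm : m ∈ N) : c • m ∈ N := by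
  have hc : c ∈ Algebra.adjoin R ({g : D | IsGroupLikeElem R g} ∪
      {y | ∃ d, IsDividedPowerSequence R d ∧ ∃ n, d n = y}) := by
    rw [adjoin_groupLike_dividedPower hD hBW]; trivial
  induction hc using Algebra.adjoin_induction generalizing m with
  | mem y hy =>
    rcases hy with hy | ⟨d, hd', n, rfl⟩
    · exact hg y hy m hm
    · exact hd d hd' n m hm
  | algebraMap r =>
    rw [Algebra.algebraMap_eq_smul_one, smul_assoc, one_smul]
    exact N.smul_mem r hm
  | add a b _ _ ha hb => rw [add_smul]; exact N.add_mem (ha hm) (hb hm)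
  | mul a b _ _ ha hb => rw [← smul_smul]; exact ha (hb hm)

end Smash

variable {A : Type*} [CommRing A] [Algebra R A] [Module D A] [IsScalarTower R D A]
  [IsModuleAlgebra R D A]

theorem groupLike_smul_mul {g : D} (hg : IsGroupLikeElem R g) (a b : A) :
    g • (a * b) = (g • a) * (g • b) := by
  rw [IsModuleAlgebra.smul_mul (R := R), sweedler, LinearMap.comp_apply, hg.comul_eq_tmul_self]
  simp

theorem groupLike_smul_one {g : D} (hg : IsGroupLikeElem R g) : g • (1 : A) = 1 := by
  rw [IsModuleAlgebra.smul_one (R := R), hg.counit_eq_one, map_one]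

variable (A) in
/-- The ring automorphism given by a grouplike element. -/
def groupLikeRingEquiv {g : D} (hg : IsGroupLikeElem R g) : A ≃+* A :=
  { groupLikeAddEquiv hg A with
    map_mul' := groupLike_smul_mul hg }

@[simp] theorem groupLikeRingEquiv_apply {g : D} (hg : IsGroupLikeElem R g) (a : A) :
    groupLikeRingEquiv A hg a = g • a := rfl

theorem dividedPower_smul_mul {d : ℕ → D} (hd : IsDividedPowerSequence R d) (n : ℕ) (a b : A) :
    d n • (a * b) = ∑ i ∈ Finset.range (n + 1), (d i • a) * (d (n - i) • b) := by
  rw [IsModuleAlgebra.smul_mul (R := R), sweedler, LinearMap.comp_apply, hd.comul]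
  simp

/-- The ring homomorphism `a ↦ ∑ (dₙ a) tⁿ` modulo an ideal. -/
def dividedPowerHom {d : ℕ → D} (hd : IsDividedPowerSequence R d) (p : Ideal A) :
    A →+* PowerSeries (A ⧸ p) where
  toFun a := PowerSeries.mk fun n => Ideal.Quotient.mk p (d n • a)
  map_zero' := by ext; simp
  map_add' a b := by ext; simp
  map_one' := by
    ext n
    rw [PowerSeries.coeff_mk, IsModuleAlgebra.smul_one (R := R), hd.counit, PowerSeries.coeff_one]
    split_ifs <;> simp
  map_mul' a b := by
    ext n
    rw [PowerSeries.coeff_mul, PowerSeries.coeff_mk, dividedPower_smul_mul hd,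
      Finset.Nat.sum_antidiagonal_eq_sum_range_succ_mk]
    simp

/-- Modulo a prime, `∑ (dₙ a) tⁿ` is a nilpotent power series over a domain, hence zero. -/
theorem dividedPower_smul_mem_nilradical {d : ℕ → D} (hd : IsDividedPowerSequence R d) (n : ℕ)
    {a : A} (ha : a ∈ nilradical A) : d n • a ∈ nilradical A := by
  rw [nilradical_eq_sInf, Ideal.mem_sInf]
  intro p hp
  have : p.IsPrime := hp
  have h : IsNilpotent (dividedPowerHom hd p a) := IsNilpotent.map ha _
  have h0 := congrArg (PowerSeries.coeff n) h.eq_zero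
  rw [map_zero, dividedPowerHom, RingHom.coe_mk, MonoidHom.coe_mk, OneHom.coe_mk,
    PowerSeries.coeff_mk] at h0
  exact Ideal.Quotient.eq_zero_iff_mem.1 h0

variable (D A) in
/-- A module algebra is `D`-simple if it is nonzero and has no nontrivial stable ideals. -/
structure IsDSimple : Prop where
  nontrivial : Nontrivial A
  eq_bot_or_eq_top : ∀ I : Ideal A, (∀ (d : D), ∀ a ∈ I, d • a ∈ I) → I = ⊥ ∨ I = ⊤

theorem IsAS.isDSimple [IsAS D A] : IsDSimple D A :=
  ⟨IsAS.nontrivial D, IsAS.eq_bot_or_eq_top⟩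

theorem IsDSimple.isReduced [Coalgebra.IsCocomm R D] (hD : IsPointed R D)
    (hBW : IsBirkhoffWitt R D) (h : IsDSimple D A) : IsReduced A := by
  have := h.nontrivial
  have hst : ∀ (d : D), ∀ a ∈ nilradical A, d • a ∈ nilradical A := fun d a ha =>
    stable_of_generators hD hBW ((nilradical A).restrictScalars R)
      (fun g hg m hm => IsNilpotent.map (f := groupLikeRingEquiv A hg) hm)
      (fun d hd n m hm => dividedPower_smul_mem_nilradical hd n hm) d ha
  rcases h.eq_bot_or_eq_top _ hst with h0 | h1
  · exact nilradical_eq_bot_iff.1 h0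
  · have h1' : (1 : A) ∈ nilradical A := h1 ▸ trivial
    exact absurd h1' not_isNilpotent_one

/-- For `n > 0`, applying `d n` to `e = e²` gives `(1 - 2e) (d n e) = 0` by induction, and `1 - 2e`
is its own inverse. No assumption on the characteristic is needed. -/
theorem dividedPower_smul_idempotent {d : ℕ → D} (hd : IsDividedPowerSequence R d) {e : A}
    (he : IsIdempotentElem e) (n : ℕ) : d n • e = if n = 0 then e else 0 := by
  induction n using Nat.strong_induction_on with
  | _ n ih =>
    rcases Nat.eq_zero_or_pos n with rfl | hn
    · simp [hd.zero]
    have h := dividedPower_smul_mul hd n e e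
    obtain ⟨k, rfl⟩ := Nat.exists_eq_succ_of_ne_zero hn.ne'
    rw [he.eq, Finset.sum_range_succ, Finset.sum_range_succ', Finset.sum_eq_zero] at h
    · rw [Nat.sub_zero, Nat.succ_eq_add_one, Nat.sub_self, hd.zero, one_smul, zero_add] at h
      set y := d (k + 1) • e
      have h2 : (1 - 2 * e) * y = 0 := by linear_combination h
      have h3 : (1 - 2 * e) * (1 - 2 * e) = 1 := by linear_combination 4 * he.eq
      rw [if_neg (Nat.succ_ne_zero k)]
      calc y = (1 - 2 * e) * (1 - 2 * e) * y := by rw [h3, one_mul]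
        _ = 0 := by rw [mul_assoc, h2, mul_zero]
    · intro i hi
      have hi := Finset.mem_range.1 hi
      rw [ih (i + 1) (by omega), if_neg (Nat.succ_ne_zero i), zero_mul]

/-- Ideals of reduced artinian module algebras are stable under divided powers. -/
theorem dividedPower_smul_mem [IsArtinianRing A] [IsReduced A] {d : ℕ → D}
    (hd : IsDividedPowerSequence R d) (n : ℕ) (I : Ideal A) {a : A} (ha : a ∈ I) :
    d n • a ∈ I := by
  have := IsArtinianRing.isSemisimpleRing_of_isReduced A
  obtain ⟨e, he, rfl⟩ := IsSemisimpleRing.ideal_eq_span_idempotent I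
  obtain ⟨b, rfl⟩ := Ideal.mem_span_singleton'.1 ha
  rw [dividedPower_smul_mul hd]
  refine Ideal.sum_mem _ fun i _ => Ideal.mul_mem_left _ _ ?_
  rw [dividedPower_smul_idempotent hd he]
  split_ifs
  · exact Ideal.mem_span_singleton_self e
  · exact Ideal.zero_mem _

/-- The grouplike elements act transitively on the maximal ideals of an AS algebra. -/
theorem exists_groupLike_comap_eq [Coalgebra.IsCocomm R D] (hD : IsPointed R D)
    (hBW : IsBirkhoffWitt R D) [IsAS D A] (P Q : Ideal A) [hP : P.IsMaximal] [hQ : Q.IsMaximal] :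
    ∃ (g : D) (hg : IsGroupLikeElem R g), Q = P.comap (groupLikeRingEquiv A hg) := by
  classical
  have : IsArtinianRing A := IsAS.artinian D
  have : IsReduced A := IsDSimple.isReduced (R := R) (D := D) hD hBW IsAS.isDSimple
  -- The intersection of all translates of `P` is stable and proper, hence zero. There are only
  -- finitely many distinct translates, so the prime `Q` contains one of them.
  let J : Ideal A := ⨅ (g : D) (hg : IsGroupLikeElem R g), P.comap (groupLikeRingEquiv A hg)
  have hJ : ∀ a, a ∈ J ↔ ∀ g : D, IsGroupLikeElem R g → g • a ∈ P := fun a => by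
    simp [J, Submodule.mem_iInf]
  have hst : ∀ (d : D), ∀ a ∈ J, d • a ∈ J := fun d a ha =>
    stable_of_generators hD hBW (J.restrictScalars R)
      (fun g hg m hm => (hJ _).2 fun g' hg' => by
        rw [smul_smul]; exact (hJ m).1 hm _ (hg'.mul hg))
      (fun d hd n m hm => dividedPower_smul_mem hd n J hm) d ha
  have hJbot : J = ⊥ := by
    refine (IsAS.eq_bot_or_eq_top J hst).resolve_right fun h => hP.ne_top ?_
    have h1 : (1 : A) ∈ J := h ▸ trivial
    rw [Ideal.eq_top_iff_one, ← groupLike_smul_one (A := A) (IsGroupLikeElem.one (R := R) (A := D))]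
    exact (hJ 1).1 h1 1 IsGroupLikeElem.one
  have : Fintype (MaximalSpectrum A) := Fintype.ofFinite _
  let s : Finset (MaximalSpectrum A) := Finset.univ.filter fun M =>
    ∃ (g : D) (hg : IsGroupLikeElem R g), M.asIdeal = P.comap (groupLikeRingEquiv A hg)
  have hs : s.inf MaximalSpectrum.asIdeal ≤ Q := by
    refine le_trans (fun a ha => (hJ a).2 fun g hg => ?_) (hJbot ▸ bot_le : J ≤ Q)
    have hmax : (P.comap (groupLikeRingEquiv A hg)).IsMaximal :=
      Ideal.comap_isMaximal_of_equiv _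
    exact (Finset.inf_le (f := MaximalSpectrum.asIdeal) (s := s) (b := ⟨_, hmax⟩)
      (Finset.mem_filter.2 ⟨Finset.mem_univ _, g, hg, rfl⟩)) ha
  obtain ⟨M, hM, hMQ⟩ := (Ideal.IsPrime.inf_le' hQ.isPrime).1 hs
  obtain ⟨g, hg, hMg⟩ := (Finset.mem_filter.1 hM).2
  exact ⟨g, hg, (M.isMaximal.eq_of_le hQ.ne_top hMQ).symm.trans hMg⟩

end Actions

/-! ### Freeness over an AS algebra -/

section Freeness

variable {R D : Type*} [Field R] [Ring D] [HopfAlgebra R D] [Coalgebra.IsCocomm R D]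
variable {K V : Type*} [CommRing K] [Algebra R K] [Module D K] [IsScalarTower R D K]
    [IsModuleAlgebra R D K] [IsAS D K]
    [AddCommGroup V] [Module R V] [Module K V] [Module D V]
    [IsScalarTower R K V] [IsScalarTower R D V] [IsSmashModule R D K V]

/-- The action of `g` maps `V / Q V` onto `V / P V`, semilinearly along the isomorphism `K / Q ≃ K /
P` that it induces. -/
theorem rank_quotient_eq (P Q : Ideal K) {g : D} (hg : IsGroupLikeElem R g)
    (hQ : Q = P.comap (groupLikeRingEquiv K hg)) :
    Module.rank (K ⧸ Q) ((K ⧸ Q) ⊗[K] V) = Module.rank (K ⧸ P) ((K ⧸ P) ⊗[K] V) := by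
  have hsub : ∀ v ∈ (Q • ⊤ : Submodule K V), g • v ∈ (P • ⊤ : Submodule K V) := by
    intro v hv
    refine Submodule.smul_induction_on hv (fun a ha v _ => ?_) fun v w hv hw => ?_
    · rw [groupLike_smul_smul hg]
      rw [hQ] at ha
      exact Submodule.smul_mem_smul ha trivial
    · rw [smul_add]; exact add_mem hv hw
  have hsub' : ∀ v ∈ (P • ⊤ : Submodule K V),
      HopfAlgebra.antipode R g • v ∈ (Q • ⊤ : Submodule K V) := by
    intro v hv
    refine Submodule.smul_induction_on hv (fun a ha v _ => ?_) fun v w hv hw => ?_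
    · rw [groupLike_smul_smul hg.antipode]
      refine Submodule.smul_mem_smul ?_ trivial
      rw [hQ, Ideal.mem_comap, groupLikeRingEquiv_apply, smul_smul, hg.mul_antipode_cancel,
        one_smul]
      exact ha
    · rw [smul_add]; exact add_mem hv hw
  let j₁ : V ⧸ (Q • ⊤ : Submodule K V) ≃+ V ⧸ (P • ⊤ : Submodule K V) :=
    QuotientAddGroup.congr (Q • ⊤ : Submodule K V).toAddSubgroup
      (P • ⊤ : Submodule K V).toAddSubgroup (groupLikeAddEquiv hg V) (by
        ext v
        constructor
        · rintro ⟨w, hw, rfl⟩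
          exact hsub w hw
        · intro hv
          exact ⟨_, hsub' v hv, (groupLikeAddEquiv hg V).apply_symm_apply v⟩)
  let j : (K ⧸ Q) ⊗[K] V ≃+ (K ⧸ P) ⊗[K] V :=
    ((TensorProduct.quotTensorEquivQuotSMul V Q).toAddEquiv.trans j₁).trans
      (TensorProduct.quotTensorEquivQuotSMul V P).symm.toAddEquiv
  let i : K ⧸ Q ≃+* K ⧸ P := Ideal.quotientEquiv Q P (groupLikeRingEquiv K hg) (by
    rw [hQ]; exact (Ideal.map_comap_of_surjective _ (groupLikeRingEquiv K hg).surjective P).symm)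
  refine rank_eq_of_equiv_equiv i j i.bijective fun r m => ?_
  obtain ⟨a, rfl⟩ := Ideal.Quotient.mk_surjective r
  have h₁ : ∀ (a : K) (m : V ⧸ (Q • ⊤ : Submodule K V)), j₁ (a • m) = (g • a) • j₁ m := by
    intro a m
    obtain ⟨v, rfl⟩ := Submodule.Quotient.mk_surjective _ m
    exact congrArg (Submodule.Quotient.mk (p := (P • ⊤ : Submodule K V)))
      (groupLike_smul_smul hg a v)
  have h₂ : Ideal.Quotient.mk Q a • m = a • m := algebraMap_smul (K ⧸ Q) a m
  have h₃ : i (Ideal.Quotient.mk Q a) • j m = (g • a) • j m := algebraMap_smul (K ⧸ P) (g • a) (j m)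
  rw [h₂, h₃]
  change (TensorProduct.quotTensorEquivQuotSMul V P).symm
    (j₁ (TensorProduct.quotTensorEquivQuotSMul V Q (a • m))) = _
  exact (congrArg _ ((congrArg j₁ ((TensorProduct.quotTensorEquivQuotSMul V Q).map_smul a m)).trans
    (h₁ a _))).trans ((TensorProduct.quotTensorEquivQuotSMul V P).symm.map_smul (g • a) _)

variable (R D K V) in
/-- Finitely generated modules over `K # D` are free over the AS algebra `K`. -/
theorem exists_basis (hD : IsPointed R D) (hBW : IsBirkhoffWitt R D) [Module.Finite K V] :
    ∃ n, Nonempty (Module.Basis (Fin n) K V) := by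
  have : IsArtinianRing K := IsAS.artinian D
  have : Nontrivial K := IsAS.nontrivial D
  have : IsReduced K := IsDSimple.isReduced (R := R) (D := D) hD hBW IsAS.isDSimple
  have := IsArtinianRing.isSemisimpleRing_of_isReduced K
  have : Module.Projective K V := Module.projective_of_isSemisimpleRing K V
  -- A projective module of constant rank over a semisimple ring is free; the rank is constant
  -- because grouplikes are transitive on the maximal ideals.
  obtain ⟨P⟩ : Nonempty (MaximalSpectrum K) := inferInstance
  refine ⟨Module.finrank (K ⧸ P.1) ((K ⧸ P.1) ⊗[K] V),
    Module.nonempty_basis_of_flat_of_finrank_eq K V _ fun Q => ?_⟩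
  obtain ⟨g, hg, h⟩ := exists_groupLike_comap_eq hD hBW P.1 Q.1
  exact congrArg Cardinal.toNat (rank_quotient_eq P.1 Q.1 hg h)

end Freeness

/-! ### Orbit maps as ring homomorphisms into the convolution algebra -/

section OrbitHom

variable {R D : Type*} [Field R] [Ring D] [HopfAlgebra R D] [Coalgebra.IsCocomm R D]
variable {A B : Type*} [CommRing A] [Algebra R A] [Module D A] [IsScalarTower R D A]
  [IsModuleAlgebra R D A] [CommRing B] [Algebra R B]

/-- The ring homomorphism `a ↦ (d ↦ φ(d a))` into the convolution algebra. -/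
def orbitHom (φ : A →ₐ[R] B) : A →+* WithConv (D →ₗ[R] B) where
  toFun a := WithConv.toConv (φ.toLinearMap ∘ₗ act a)
  map_zero' := by ext; simp
  map_add' a b := by ext; simp
  map_one' := by
    ext d
    simp [IsModuleAlgebra.smul_one (R := R)]
  map_mul' a b := by
    ext d
    change φ (d • (a * b)) = _
    rw [IsModuleAlgebra.smul_mul (R := R),
      sweedler_eq_sum _ _ _ d (Coalgebra.Repr.arbitrary R d),
      (Coalgebra.Repr.arbitrary R d).convMul_apply]
    simp

@[simp] theorem orbitHom_apply (φ : A →ₐ[R] B) (a : A) (d : D) :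
    (orbitHom φ a).ofConv d = φ (d • a) := rfl

/-- A convolution inverse with values in a subalgebra. -/
theorem smul_mem_of_mul_eq_one (hD : IsPointed R D) {k : Type*} [CommRing k] [Algebra R k]
    [Algebra k A] [IsScalarTower R k A] (S : Subalgebra k A) {u w : A} (huw : u * w = 1)
    (hu : ∀ d : D, d • u ∈ S)
    (hg : ∀ g : D, IsGroupLikeElem R g → ∃ y ∈ S, (g • u) * y = 1) (d : D) : d • w ∈ S := by
  -- The orbit map of `u` with values in `S`. It is invertible in `Hom_R(D, S)` by the criterion at
  -- grouplikes; uniqueness of inverses in `Hom_R(D, A)` identifies its inverse with the orbit map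
  -- of `w`.
  let f : WithConv (D →ₗ[R] S) := WithConv.toConv
    { toFun := fun d => ⟨d • u, hu d⟩
      map_add' := fun c d => Subtype.ext (add_smul c d u)
      map_smul' := fun r d => Subtype.ext (smul_assoc r d u) }
  have hf : IsUnit f := isUnit_conv hD f fun g hg' => by
    obtain ⟨y, hy, h⟩ := hg g hg'
    exact IsUnit.of_mul_eq_one ⟨y, hy⟩ (Subtype.ext h)
  obtain ⟨h, hfh⟩ := hf.exists_right_inv
  let ι : S →ₐ[R] A := S.val.restrictScalars R
  let hA : WithConv (D →ₗ[R] A) := WithConv.toConv (ι.toLinearMap ∘ₗ h.ofConv)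
  have h₁ : orbitHom (AlgHom.id R A) u * hA = 1 := by
    ext c
    have e := congrArg (fun F : WithConv (D →ₗ[R] S) => (F.ofConv c : A)) hfh
    have e₁ := (Coalgebra.Repr.arbitrary R c).convMul_apply f h
    have e₂ := (Coalgebra.Repr.arbitrary R c).convMul_apply (orbitHom (AlgHom.id R A) u) hA
    rw [e₂]
    beta_reduce at e
    rw [e₁] at e
    simpa [f, hA, ι] using e
  have h₂ : orbitHom (D := D) (AlgHom.id R A) u * orbitHom (AlgHom.id R A) w = 1 := by
    rw [← map_mul, huw, map_one]
  have h₃ : orbitHom (AlgHom.id R A) w = hA := by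
    rw [← mul_one (orbitHom (AlgHom.id R A) w), ← h₁, ← mul_assoc,
      mul_comm _ (orbitHom (AlgHom.id R A) u), h₂, one_mul]
  have h₄ : d • w = (h.ofConv d : A) :=
    congrArg (fun F : WithConv (D →ₗ[R] A) => F.ofConv d) h₃
  rw [h₄]
  exact (h.ofConv d).2

end OrbitHom

/-! ### The coinduced module algebra -/

section Coinduced

variable (R D F : Type*) [Field R] [Ring D] [HopfAlgebra R D] [Coalgebra.IsCocomm R D]
  [CommRing F] [Algebra R F]

/-- The module algebra of `R`-linear maps `D → F` with convolution as product. -/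
def Coind : Type _ := WithConv (D →ₗ[R] F)

noncomputable instance : CommRing (Coind R D F) :=
  inferInstanceAs (CommRing (WithConv (D →ₗ[R] F)))

noncomputable instance : Algebra R (Coind R D F) :=
  inferInstanceAs (Algebra R (WithConv (D →ₗ[R] F)))

variable {R D F}

/-- Evaluation of an element of the coinduced algebra. -/
def Coind.eval (f : Coind R D F) : D →ₗ[R] F := WithConv.ofConv f

/-- The element of the coinduced algebra given by a linear map. -/
def Coind.mk (f : D →ₗ[R] F) : Coind R D F := WithConv.toConv f

@[ext] theorem Coind.ext {f g : Coind R D F} (h : ∀ d, f.eval d = g.eval d) : f = g :=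
  WithConv.ext (LinearMap.ext h)

instance : Module D (Coind R D F) where
  smul d f := WithConv.toConv (f.eval ∘ₗ LinearMap.mulRight R d)
  one_smul f := Coind.ext fun c => congrArg f.eval (mul_one c)
  mul_smul d e f := Coind.ext fun c => congrArg f.eval (mul_assoc c d e).symm
  smul_zero _ := Coind.ext fun _ => rfl
  smul_add _ _ _ := Coind.ext fun _ => rfl
  add_smul d e f := Coind.ext fun c =>
    (congrArg f.eval (mul_add c d e)).trans (map_add f.eval _ _)
  zero_smul f := Coind.ext fun c => (congrArg f.eval (mul_zero c)).trans (map_zero f.eval)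

@[simp] theorem Coind.eval_smul (d : D) (f : Coind R D F) (c : D) :
    (d • f).eval c = f.eval (c * d) := rfl

@[simp] theorem Coind.eval_zero (c : D) : (0 : Coind R D F).eval c = 0 := rfl

@[simp] theorem Coind.eval_smul_base (r : R) (f : Coind R D F) (c : D) :
    (r • f).eval c = r • f.eval c := rfl

theorem Coind.eval_one (c : D) :
    (1 : Coind R D F).eval c = algebraMap R F (Coalgebra.counit c) := rfl

theorem Coind.eval_mul (f g : Coind R D F) (c : D) :
    (f * g).eval c = LinearMap.mul' R F (TensorProduct.map f.eval g.eval (Coalgebra.comul c)) := rfl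

instance : IsScalarTower R D (Coind R D F) where
  smul_assoc r d f := Coind.ext fun c => by simp

instance : IsModuleAlgebra R D (Coind R D F) where
  smul_one d := Coind.ext fun c => by
    rw [Algebra.algebraMap_eq_smul_one, Coind.eval_smul, Coind.eval_one, Coind.eval_smul_base, Coind.eval_one,
      Bialgebra.counit_mul, map_mul, mul_comm, ← Algebra.smul_def]
  smul_mul d f g := Coind.ext fun c => by
    rw [sweedler_eq_sum _ _ _ d (Coalgebra.Repr.arbitrary R d)]
    have hs : ∀ (s : Finset (D × D)) (F' : D × D → Coind R D F),
        (∑ i ∈ s, F' i).eval c = ∑ i ∈ s, (F' i).eval c := fun s F' =>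
      map_sum (⟨⟨fun f : Coind R D F => f.eval c, rfl⟩, fun _ _ => rfl⟩ : Coind R D F →+ F) _ _
    rw [Coind.eval_smul, Coind.eval_mul, Bialgebra.comul_mul, hs]
    rw [← (Coalgebra.Repr.arbitrary R d).eq, ← (Coalgebra.Repr.arbitrary R c).eq]
    rw [Finset.mul_sum, map_sum, map_sum]
    refine Finset.sum_congr rfl fun i _ => ?_
    rw [LinearMap.mul_apply', Coind.eval_mul, ← (Coalgebra.Repr.arbitrary R c).eq,
      Finset.sum_mul]
    simp

/-- Evaluation at a grouplike element is a ring homomorphism. -/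
def Coind.evalHom {g : D} (hg : IsGroupLikeElem R g) : Coind R D F →+* F where
  toFun f := f.eval g
  map_zero' := rfl
  map_add' _ _ := rfl
  map_one' := by rw [Coind.eval_one, hg.counit_eq_one, map_one]
  map_mul' f h := by
    rw [Coind.eval_mul, hg.comul_eq_tmul_self]
    simp

@[simp] theorem Coind.evalHom_apply {g : D} (hg : IsGroupLikeElem R g) (f : Coind R D F) :
    Coind.evalHom hg f = f.eval g := rfl

theorem Coind.isUnit (hD : IsPointed R D) (f : Coind R D F)
    (hf : ∀ g, IsGroupLikeElem R g → IsUnit (f.eval g)) : IsUnit f :=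
  isUnit_conv hD f hf

/-- The homomorphism `a ↦ (d ↦ φ(d a))` of module algebras. -/
noncomputable def toCoind {A : Type*} [CommRing A] [Algebra R A] [Module D A]
    [IsScalarTower R D A] [IsModuleAlgebra R D A] (φ : A →ₐ[R] F) : A →ₐ[R] Coind R D F :=
  { (orbitHom φ : A →+* WithConv (D →ₗ[R] F)) with
    commutes' := fun r => Coind.ext fun d => by
      rw [Algebra.algebraMap_eq_smul_one (A := Coind R D F)]
      change φ (d • algebraMap R A r) = r • algebraMap R F (Coalgebra.counit d)
      rw [Algebra.algebraMap_eq_smul_one (A := A), smul_algebra_smul_comm, map_smul,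
        IsModuleAlgebra.smul_one (R := R), AlgHom.commutes] }

@[simp] theorem toCoind_eval {A : Type*} [CommRing A] [Algebra R A] [Module D A]
    [IsScalarTower R D A] [IsModuleAlgebra R D A] (φ : A →ₐ[R] F) (a : A) (d : D) :
    (toCoind φ a).eval d = φ (d • a) := rfl

theorem toCoind_smul {A : Type*} [CommRing A] [Algebra R A] [Module D A]
    [IsScalarTower R D A] [IsModuleAlgebra R D A] (φ : A →ₐ[R] F) (d : D) (a : A) :
    toCoind (D := D) φ (d • a) = d • toCoind (D := D) φ a :=
  Coind.ext fun c => by simp [smul_smul]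

end Coinduced

/-! ### `D`-simple images of noetherian module algebras -/

section SimpleImage

variable {R : Type u} {D : Type v} [Field R] [Ring D] [HopfAlgebra R D] [Coalgebra.IsCocomm R D]
variable {K : Type w} [CommRing K] [Algebra R K]

/-- The range of a `D`-linear homomorphism is stable. -/
theorem isStable_range {T M : Type*} [CommRing T] [Module D T]
    [CommRing M] [Module D M] [Algebra K T]
    [Algebra K M] (π : T →ₐ[K] M) (hπ : ∀ (d : D) (t : T), π (d • t) = d • π t) :
    IsStable D π.range where
  smul_mem := by
    rintro d _ ⟨t, rfl⟩
    exact ⟨d • t, hπ d t⟩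

/-- A nonzero noetherian module algebra has a `D`-simple image in a module algebra in which the
nonzerodivisors of the image are invertible. -/
theorem exists_isDSimple_range (hD : IsPointed R D) (T : Type x) [CommRing T] [Algebra R T]
    [Module D T] [IsScalarTower R D T] [IsModuleAlgebra R D T] [Algebra K T] [IsScalarTower R K T]
    [IsNoetherianRing T] [Nontrivial T] :
    ∃ (M : Type (max v x)) (_ : CommRing M) (_ : Algebra R M) (_ : Module D M)
      (_ : IsScalarTower R D M) (_ : IsModuleAlgebra R D M) (_ : Algebra K M)
      (_ : IsScalarTower R K M) (π : T →ₐ[K] M) (_ : IsStable D π.range),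
      (∀ (d : D) (t : T), π (d • t) = d • π t) ∧ IsDSimple D π.range ∧
      ∀ s ∈ π.range, (∀ a ∈ π.range, s * a = 0 → a = 0) → IsUnit s := by
  obtain ⟨I, ⟨hIst, hItop⟩, hImax⟩ := set_has_maximal_iff_noetherian.2 (inferInstance :
    IsNoetherian T T) {I : Ideal T | (∀ (d : D), ∀ a ∈ I, d • a ∈ I) ∧ I ≠ ⊤}
    ⟨⊥, by
      refine ⟨fun d a ha => ?_, bot_ne_top⟩
      rw [Ideal.mem_bot] at ha ⊢
      rw [ha, smul_zero]⟩
  -- The prime `p` need not be stable. Its largest stable subideal contains the maximal stable ideal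
  -- `I`, hence equals it; that subideal is the kernel of the map to `Hom_R(D, F)` built from `T →
  -- F`.
  obtain ⟨p, hp⟩ := Ideal.nonempty_minimalPrimes hItop
  have hpp : p.IsPrime := hp.1.1
  let F := FractionRing (T ⧸ p)
  let φ : T →ₐ[R] F := (IsScalarTower.toAlgHom R (T ⧸ p) F).comp (Ideal.Quotient.mkₐ R p)
  have hφ : ∀ t, φ t = 0 ↔ t ∈ p := fun t => by
    rw [← Ideal.Quotient.eq_zero_iff_mem]
    exact map_eq_zero_iff (algebraMap (T ⧸ p) F) (IsFractionRing.injective _ _)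
  let ψ : T →ₐ[R] Coind R D F := toCoind φ
  have hψ : ∀ t, ψ t = 0 ↔ ∀ d : D, d • t ∈ p := fun t => by
    refine ⟨fun h d => (hφ _).1 (congrArg (fun f : Coind R D F => f.eval d) h), fun h =>
      Coind.ext fun d => (hφ _).2 (h d)⟩
  have hstab : ∀ J : Ideal T, (∀ (d : D), ∀ a ∈ J, d • a ∈ J) → I ≤ J → J = I ∨ J = ⊤ :=
    fun J hJ hIJ => by
      by_contra! h
      exact hImax J ⟨hJ, h.2⟩ (lt_of_le_of_ne hIJ h.1.symm)
  have hker : ∀ t, ψ t = 0 ↔ t ∈ I := by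
    have hIker : I ≤ RingHom.ker ψ := fun t ht => (hψ t).2 fun d => hp.1.2 (hIst d t ht)
    have hk := hstab (RingHom.ker ψ) (fun d a ha => (hψ _).2 fun c => by
      rw [smul_smul]; exact (hψ a).1 ha _) hIker
    have : RingHom.ker ψ = I := hk.resolve_right fun h => by
      have h1 : ψ 1 = 0 := (h ▸ trivial : (1 : T) ∈ RingHom.ker ψ)
      have := (hψ 1).1 h1 1
      rw [one_smul] at this
      exact hpp.ne_top ((Ideal.eq_top_iff_one p).2 this)
    intro t
    rw [← this]
    rfl
  -- Elements of `K` act through their orbit maps, not by multiplying values; only this structure is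
  -- compatible with the action of `D`.
  let _ : Algebra K (Coind R D F) := ((ψ : T →+* Coind R D F).comp (algebraMap K T)).toAlgebra
  have hRK : IsScalarTower R K (Coind R D F) := IsScalarTower.of_algebraMap_eq fun r => by
    change _ = ψ (algebraMap K T (algebraMap R K r))
    rw [← IsScalarTower.algebraMap_apply, AlgHom.commutes]
  let π : T →ₐ[K] Coind R D F := { (ψ : T →+* Coind R D F) with commutes' := fun _ => rfl }
  have hπ : ∀ (d : D) (t : T), π (d • t) = d • π t := toCoind_smul φ
  have hst : IsStable D π.range := isStable_range π hπ
  have hπ0 : ∀ t, π t = 0 ↔ t ∈ I := hker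
  refine ⟨Coind R D F, inferInstance, inferInstance, inferInstance, inferInstance, inferInstance,
    inferInstance, hRK, π, hst, hπ, ⟨⟨0, 1, fun h => ?_⟩, fun J hJ => ?_⟩, ?_⟩
  · refine hItop ((Ideal.eq_top_iff_one I).2 ((hπ0 1).1 ?_))
    rw [map_one]
    exact congrArg Subtype.val h.symm
  · have hJ' := hstab (J.comap π.rangeRestrict)
      (fun d a ha => by
        have : π.rangeRestrict (d • a) = d • π.rangeRestrict a := Subtype.ext (hπ d a)
        rw [Ideal.mem_comap, this]
        exact hJ d _ ha)
      (fun t ht => by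
        have : π.rangeRestrict t = 0 := Subtype.ext ((hπ0 t).2 ht)
        rw [Ideal.mem_comap, this]
        exact J.zero_mem)
    rcases hJ' with h | h
    · left
      rw [eq_bot_iff]
      rintro ⟨_, t, rfl⟩ ht
      have : t ∈ J.comap π.rangeRestrict := ht
      rw [h] at this
      exact Subtype.ext ((hπ0 t).2 this)
    · right
      have : (1 : T) ∈ J.comap π.rangeRestrict := h ▸ trivial
      rw [Ideal.mem_comap, map_one] at this
      exact (Ideal.eq_top_iff_one J).2 this
  · rintro _ ⟨t, rfl⟩ hs
    refine Coind.isUnit hD _ fun g hg => ?_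
    change IsUnit (φ (g • t))
    rw [isUnit_iff_ne_zero, Ne, hφ]
    intro hgt
    -- An element of a minimal prime over `I` is a zero divisor modulo `I`. Translating back by the
    -- antipode of `g` makes `t` a zero divisor modulo `I`, contrary to assumption.
    obtain ⟨y, hy, hyI⟩ := Ideal.exists_mul_mem_of_mem_minimalPrimes hp hgt
    have h₁ := hIst (HopfAlgebra.antipode R g) _ hyI
    rw [groupLike_smul_mul hg.antipode, smul_smul, hg.antipode_mul_cancel, one_smul,
      ← hπ0, map_mul] at h₁
    have h₂ := (hπ0 _).1 (hs _ ⟨_, rfl⟩ h₁)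
    have h₃ := hIst g _ h₂
    rw [smul_smul, hg.mul_antipode_cancel, one_smul] at h₃
    exact hy h₃

end SimpleImage

/-! ### Linear independence of constants -/

section ConstantVectors

variable {R D : Type*} [Field R] [Ring D] [HopfAlgebra R D]
variable {K W : Type*} [CommRing K] [Algebra R K] [Module D K] [IsScalarTower R D K]
    [AddCommGroup W] [Module R W] [Module K W] [Module D W]
    [IsScalarTower R K W] [IsScalarTower R D W] [IsSmashModule R D K W]

theorem smul_smul_of_constant {w : W} (hw : ∀ d : D, d • w = Coalgebra.counit (R := R) d • w)
    (d : D) (a : K) : d • (a • w) = (d • a) • w := by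
  rw [IsSmashModule.smul_smul (R := R), sweedler_eq_sum _ _ _ d (Coalgebra.Repr.arbitrary R d)]
  have h := congrArg (TensorProduct.rid R D)
    (Coalgebra.sum_tmul_counit_eq (Coalgebra.Repr.arbitrary R d))
  rw [map_sum] at h
  simp only [TensorProduct.rid_tmul, one_smul] at h
  conv_rhs => rw [← h, Finset.sum_smul, Finset.sum_smul]
  refine Finset.sum_congr rfl fun i _ => ?_
  simp [hw]

variable (R) in
/-- Constants that are linearly independent over the constants of an AS algebra are
linearly independent. -/
theorem constants_independent [IsModuleAlgebra R D K] [IsAS D K] {ι : Type*} {w : ι → W}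
    (hw : ∀ i (d : D), d • w i = Coalgebra.counit (R := R) d • w i)
    (hind : ∀ (s : Finset ι) (a : ι → K), (∀ i, a i ∈ constants R D K) →
      ∑ i ∈ s, a i • w i = 0 → ∀ i ∈ s, a i = 0)
    (s : Finset ι) (a : ι → K) (ha : ∑ i ∈ s, a i • w i = 0) : ∀ i ∈ s, a i = 0 := by
  classical
  induction s using Finset.induction_on generalizing a with
  | empty => simp
  | insert j s hj ih =>
    have hd : ∀ (t : Finset ι) (a : ι → K) (d : D), d • ∑ i ∈ t, a i • w i =
        ∑ i ∈ t, (d • a i) • w i := fun t a d => by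
      rw [Finset.smul_sum]
      exact Finset.sum_congr rfl fun i _ => smul_smul_of_constant (hw i) d (a i)
    -- The possible coefficients at `j` in relations form a stable ideal. If it is zero, the
    -- relation gets shorter. Otherwise some relation has coefficient `1` at `j`; applying `d` and
    -- subtracting `ε(d)` times it removes that term, so by induction its coefficients are all
    -- constant.
    let J : Ideal K :=
      { carrier := {b | ∃ a : ι → K, a j = b ∧ ∑ i ∈ insert j s, a i • w i = 0}
        zero_mem' := ⟨0, rfl, by simp⟩
        add_mem' := by
          rintro _ _ ⟨a, rfl, ha⟩ ⟨b, rfl, hb⟩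
          refine ⟨a + b, rfl, ?_⟩
          simp only [Pi.add_apply, add_smul, Finset.sum_add_distrib, ha, hb, add_zero]
        smul_mem' := by
          rintro c _ ⟨a, rfl, ha⟩
          refine ⟨c • a, rfl, ?_⟩
          simp only [Pi.smul_apply, smul_eq_mul, mul_smul, ← Finset.smul_sum, ha, smul_zero] }
    have hJ := IsAS.eq_bot_or_eq_top (D := D) J (by
      rintro d _ ⟨a, rfl, ha⟩
      refine ⟨fun i => d • a i, rfl, ?_⟩
      rw [← hd, ha, smul_zero])
    rcases hJ with hJ | hJ
    · have haj : a j = 0 := by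
        have : a j ∈ J := ⟨a, rfl, ha⟩
        rwa [hJ, Ideal.mem_bot] at this
      rw [Finset.sum_insert hj, haj, zero_smul, zero_add] at ha
      intro i hi
      rcases Finset.mem_insert.1 hi with rfl | hi
      · exact haj
      · exact ih a ha i hi
    · obtain ⟨b, hbj, hb⟩ : (1 : K) ∈ J := hJ ▸ trivial
      have hconst : ∀ i ∈ insert j s, b i ∈ constants R D K := by
        intro i hi d
        have h₁ := hd (insert j s) b d
        rw [hb, smul_zero, Finset.sum_insert hj] at h₁
        have h₂ := congrArg (fun x => Coalgebra.counit (R := R) d • x) hb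
        simp only [smul_zero, Finset.smul_sum, ← smul_assoc] at h₂
        rw [Finset.sum_insert hj] at h₂
        have h₃ : ∑ i ∈ s, (d • b i - Coalgebra.counit (R := R) d • b i) • w i = 0 := by
          simp only [sub_smul, Finset.sum_sub_distrib]
          rw [hbj, IsModuleAlgebra.smul_one (R := R), Algebra.algebraMap_eq_smul_one] at h₁
          rw [hbj] at h₂
          rw [sub_eq_zero]
          exact add_left_cancel (h₁.symm.trans h₂.symm)
        rcases Finset.mem_insert.1 hi with rfl | hi
        · rw [hbj, IsModuleAlgebra.smul_one (R := R), Algebra.algebraMap_eq_smul_one]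
        · exact sub_eq_zero.1 (ih _ h₃ i hi)
      have h₀ := hind (insert j s) (fun i => if i ∈ insert j s then b i else 0)
        (fun i => by
          split_ifs with h
          · exact hconst i h
          · exact zero_mem _)
        (by
          rw [← hb]
          exact Finset.sum_congr rfl fun i hi => by rw [if_pos hi]) j (Finset.mem_insert_self j s)
      rw [if_pos (Finset.mem_insert_self j s), hbj] at h₀
      have := IsAS.nontrivial D (A := K)
      exact absurd h₀ one_ne_zero

end ConstantVectors

/-! ### A transcendental element has non-invertible translates -/

section Spectrum

open Polynomial

theorem isUnit_eval₂_of_forall_isUnit_sub {k B : Type*} [Field k] [IsAlgClosed k] [CommRing B]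
    (ι : k →+* B) {c : B} (hc : ∀ l, IsUnit (c - ι l)) {p : k[X]} (hp : p ≠ 0) :
    IsUnit (p.eval₂ ι c) := by
  rw [(IsAlgClosed.splits p).eq_prod_roots, eval₂_mul, eval₂_C, eval₂_multiset_prod,
    Multiset.map_map]
  refine ((leadingCoeff_ne_zero.2 hp).isUnit.map ι).mul ?_
  generalize p.roots = s
  induction s using Multiset.induction_on with
  | empty => simp
  | cons a s ih =>
    rw [Multiset.map_cons, Multiset.prod_cons]
    refine IsUnit.mul ?_ ih
    simpa using hc a

/-- If `c` is transcendental in a finitely generated algebra over an artinian ring, then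
not all elements `c - l` are invertible. -/
theorem exists_not_isUnit_sub {K B : Type*} [CommRing K] [IsArtinianRing K] [CommRing B]
    [Algebra K B] [Algebra.FiniteType K B] {c : B} (hc : Function.Injective (aeval (R := K) c))
    (P : Ideal K) [P.IsPrime] {S : Set K} (hS : (Ideal.Quotient.mk P '' S).Infinite) :
    ∃ l ∈ S, ¬IsUnit (c - algebraMap K B l) := by
  classical
  have hP : (P.map (C : K →+* K[X])).IsPrime := Ideal.isPrime_map_C_of_isPrime
  have hmem : ∀ q : K[X], q ∈ P.map (C : K →+* K[X]) ↔ q.map (Ideal.Quotient.mk P) = 0 := fun q => by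
    rw [Ideal.mem_map_C_iff, Polynomial.ext_iff]
    simp [Ideal.Quotient.eq_zero_iff_mem]
  have hmin : P.map (C : K →+* K[X]) ∈ minimalPrimes K[X] := by
    refine ⟨⟨hP, bot_le⟩, fun q hq hle => Ideal.map_le_iff_le_comap.2 ?_⟩
    have hqp : q.IsPrime := hq.1
    have h₁ : q.comap (C : K →+* K[X]) ≤ P := fun a ha => by
      have := hle ha
      rw [hmem, map_C, C_eq_zero, Ideal.Quotient.eq_zero_iff_mem] at this
      exact this
    have h₂ : (q.comap (C : K →+* K[X])).IsMaximal :=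
      Ideal.IsPrime.isMaximal' inferInstance
    exact (h₂.eq_of_le (Ideal.IsPrime.ne_top inferInstance) h₁).ge
  -- Minimal primes lift along injective ring maps, so the generic point of the line over `K / P`
  -- lies in the image of the spectrum of `B`. By Chevalley's theorem the image is constructible,
  -- and so contains all but finitely many rational points of that line.
  obtain ⟨Q, hQ, hQP⟩ := Ideal.exists_comap_eq_of_mem_minimalPrimes_of_injective
    (f := (aeval c : K[X] →ₐ[K] B).toRingHom) hc _ hmin
  have hfp : (aeval c : K[X] →ₐ[K] B).toRingHom.FinitePresentation := by
    rw [← RingHom.FinitePresentation.of_finiteType]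
    refine RingHom.FiniteType.of_comp_finiteType (f := (C : K →+* K[X])) ?_
    have : (aeval c : K[X] →ₐ[K] B).toRingHom.comp C = algebraMap K B := by
      ext a; simp
    rw [this]
    exact RingHom.finiteType_algebraMap.2 inferInstance
  obtain ⟨Z, hZ⟩ := PrimeSpectrum.exists_constructibleSetData_iff.2
    (PrimeSpectrum.isConstructible_range_comap hfp)
  have h₁ : (⟨_, hP⟩ : PrimeSpectrum K[X]) ∈ Z.toSet := by
    rw [hZ]
    exact ⟨⟨Q, hQ⟩, PrimeSpectrum.ext hQP⟩
  simp only [PrimeSpectrum.ConstructibleSetData.toSet, Set.mem_iUnion] at h₁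
  obtain ⟨T, hT, hT₁, hT₂⟩ := h₁
  rw [PrimeSpectrum.mem_zeroLocus] at hT₁ hT₂
  have hf : (T.f.map (Ideal.Quotient.mk P)) ≠ 0 := fun h =>
    hT₂ (Set.singleton_subset_iff.2 ((hmem _).2 h))
  -- Choosing `l` off the roots of `T.f` puts the evaluation point at `l` in the same locally closed
  -- piece as the generic point. A prime of `B` above it contains `c - l`.
  obtain ⟨m, ⟨l, hl, rfl⟩, hroot⟩ := hS.exists_notMem_finset
    (T.f.map (Ideal.Quotient.mk P)).roots.toFinset
  refine ⟨l, hl, fun hu => ?_⟩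
  have hpl : (P.comap (evalRingHom l)).IsPrime := Ideal.comap_isPrime _ _
  have h₂ : (⟨_, hpl⟩ : PrimeSpectrum K[X]) ∈ Z.toSet := by
    simp only [PrimeSpectrum.ConstructibleSetData.toSet, Set.mem_iUnion]
    refine ⟨T, hT, ?_, ?_⟩
    · rw [PrimeSpectrum.mem_zeroLocus]
      refine hT₁.trans fun q hq => ?_
      have hq' := (hmem q).1 hq
      change q.eval l ∈ P
      rw [← Ideal.Quotient.eq_zero_iff_mem, ← eval_map_apply, hq', eval_zero]
    · rw [PrimeSpectrum.mem_zeroLocus, Set.singleton_subset_iff]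
      intro h
      refine hroot (Multiset.mem_toFinset.2 ((mem_roots hf).2 ?_))
      rw [IsRoot, eval_map_apply, Ideal.Quotient.eq_zero_iff_mem]
      exact h
  rw [hZ] at h₂
  obtain ⟨⟨q, hq⟩, hqP⟩ := h₂
  have hqP := congrArg PrimeSpectrum.asIdeal hqP
  have h₃ : (X - C l : K[X]) ∈ P.comap (evalRingHom l) := by
    rw [Ideal.mem_comap]; simp
  replace h₃ := hqP.ge h₃
  have h₄ : c - algebraMap K B l ∈ q := by
    have : (aeval c : K[X] →ₐ[K] B) (X - C l) ∈ q := h₃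
    simpa using this
  exact hq.ne_top (Ideal.eq_top_of_isUnit_mem _ h₄ hu)

end Spectrum

/-! ### No new constants in finitely generated `D`-simple extensions -/

section ConstantsOfSimple

open Polynomial

variable {R D : Type*} [Field R] [Ring D] [HopfAlgebra R D]
variable {A : Type*} [CommRing A] [Algebra R A] [Module D A] [IsScalarTower R D A]
  [IsModuleAlgebra R D A]

theorem IsDSimple.isUnit_of_mem_constants (h : IsDSimple D A) {c : A} (hc : c ∈ constants R D A)
    (hc0 : c ≠ 0) : IsUnit c := by
  rcases h.eq_bot_or_eq_top (Ideal.span {c}) (fun d a ha => by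
    obtain ⟨b, rfl⟩ := Ideal.mem_span_singleton'.1 ha
    rw [mul_comm, IsModuleAlgebra.smul_mul (R := R), sweedler_of_invariant _ _ _ _ hc]
    exact Ideal.mem_span_singleton.2 ⟨_, rfl⟩) with h | h
  · exact absurd (Ideal.span_singleton_eq_bot.1 h) hc0
  · exact Ideal.span_singleton_eq_top.1 h

variable {K : Type*} [CommRing K] [Algebra R K] [Module D K] [IsScalarTower R D K]
  [IsModuleAlgebra R D K]

theorem algebraMap_mem_constants [Algebra K A] [IsScalarTower R K A] [IsExtension D K A] {a : K}
    (ha : a ∈ constants R D K) : algebraMap K A a ∈ constants R D A := fun d => by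
  rw [← IsExtension.map_smul, ha d, Algebra.algebraMap_eq_smul_one, Algebra.algebraMap_eq_smul_one,
    smul_assoc]

/-- The constants of a `D`-simple finitely generated extension of an AS algebra with algebraically
closed field of constants. -/
theorem IsDSimple.exists_algebraMap_eq [IsAS D K] [IsAlgClosed (constants R D K)]
    [Algebra K A] [IsScalarTower R K A] [IsExtension D K A] [Algebra.FiniteType K A]
    (h : IsDSimple D A) {c : A} (hc : c ∈ constants R D A) :
    ∃ a ∈ constants R D K, algebraMap K A a = c := by
  by_contra! hne
  have := h.nontrivial
  have hu : ∀ l : constants R D K, IsUnit (c - algebraMap K A (l : K)) := fun l =>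
    h.isUnit_of_mem_constants (sub_mem hc (algebraMap_mem_constants l.2))
      (sub_ne_zero.2 (hne l l.2).symm)
  have hcp : ∀ n : ℕ, c ^ n ∈ constants R D A := fun n => pow_mem hc n
  let ι : constants R D K →+* A := (algebraMap K A).comp (constants R D K).val.toRingHom
  -- The powers of `c` are independent over `K^D`: a nonzero polynomial over this algebraically
  -- closed field splits, so its value at `c` is a product of units. Independence then passes to
  -- `K`.
  have hind := constants_independent R (K := K) (W := A) (w := fun n : ℕ => c ^ n) hcp
    (fun s a ha hs i hi => by
      let p : (constants R D K)[X] := ∑ i ∈ s, monomial i ⟨a i, ha i⟩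
      have hp : p.eval₂ ι c = 0 := by
        rw [eval₂_finsetSum, ← hs]
        exact Finset.sum_congr rfl fun i _ => by
          rw [eval₂_monomial, Algebra.smul_def]
          rfl
      by_contra h0
      refine not_isUnit_zero (M₀ := A) ?_
      rw [← hp]
      refine isUnit_eval₂_of_forall_isUnit_sub ι hu fun hp0 => h0 ?_
      have := congrArg (fun q => ((q.coeff i : constants R D K) : K)) hp0
      simpa [p, finsetSum_coeff, coeff_monomial, hi] using this)
  have hinj : Function.Injective (aeval (R := K) c) := by
    rw [injective_iff_map_eq_zero]
    intro p hp
    rw [aeval_eq_sum_range] at hp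
    ext n
    by_cases hn : n ∈ Finset.range (p.natDegree + 1)
    · exact hind _ _ hp n hn
    · rw [coeff_eq_zero_of_natDegree_lt (by simpa using hn), coeff_zero]
  have : IsArtinianRing K := IsAS.artinian D
  have : Nontrivial K := IsAS.nontrivial D
  obtain ⟨P, hP⟩ := Ideal.exists_maximal K
  have hPp : P.IsPrime := hP.isPrime
  have hS : (Ideal.Quotient.mk P '' (constants R D K : Set K)).Infinite := by
    have hinj' : Function.Injective
        ((Ideal.Quotient.mk P).comp (constants R D K).val.toRingHom) := RingHom.injective _
    have : Infinite (constants R D K) := IsAlgClosed.instInfinite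
    refine (Set.infinite_range_of_injective hinj').mono ?_
    rintro _ ⟨x, rfl⟩
    exact ⟨x, x.2, rfl⟩
  obtain ⟨l, hl, hlu⟩ := exists_not_isUnit_sub hinj P hS
  exact hlu (hu ⟨l, hl⟩)

end ConstantsOfSimple

/-! ### The tensor product as a module algebra -/

section DiagTensor

variable (R : Type*) {D : Type*} (K A B : Type*) [Field R] [Ring D] [HopfAlgebra R D]
  [CommRing K] [Algebra R K] [Module D K] [IsScalarTower R D K]
  [CommRing A] [Algebra R A] [Algebra K A] [Module D A] [IsScalarTower R K A]
  [IsScalarTower R D A]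
  [CommRing B] [Algebra R B] [Algebra K B] [Module D B] [IsScalarTower R K B]
  [IsScalarTower R D B]

/-- The tensor product of `K`-algebras, to be equipped with the diagonal action of a Hopf algebra
over `R`. -/
def DiagTensor (_R K A B : Type*) [CommRing K] [CommRing A] [Algebra K A] [CommRing B]
    [Algebra K B] : Type _ := A ⊗[K] B

noncomputable instance : CommRing (DiagTensor R K A B) := inferInstanceAs (CommRing (A ⊗[K] B))

noncomputable instance : Algebra K (DiagTensor R K A B) := inferInstanceAs (Algebra K (A ⊗[K] B))

noncomputable instance : Algebra R (DiagTensor R K A B) := inferInstanceAs (Algebra R (A ⊗[K] B))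

instance : IsScalarTower R K (DiagTensor R K A B) :=
  inferInstanceAs (IsScalarTower R K (A ⊗[K] B))

noncomputable instance (priority := low) : Algebra A (DiagTensor R K A B) :=
  inferInstanceAs (Algebra A (A ⊗[K] B))

instance (priority := low) : IsScalarTower R A (DiagTensor R K A B) :=
  inferInstanceAs (IsScalarTower R A (A ⊗[K] B))

/-- The left inclusion of the tensor product. -/
noncomputable def DiagTensor.inl : A →ₐ[K] DiagTensor R K A B :=
  Algebra.TensorProduct.includeLeft

/-- The right inclusion of the tensor product. -/
noncomputable def DiagTensor.inr : B →ₐ[K] DiagTensor R K A B :=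
  Algebra.TensorProduct.includeRight

theorem DiagTensor.inl_mul_inr (a : A) (b : B) :
    inl R K A B a * inr R K A B b = (a ⊗ₜ[K] b : A ⊗[K] B) := by
  change (a ⊗ₜ[K] (1 : B)) * ((1 : A) ⊗ₜ[K] b) = a ⊗ₜ[K] b
  rw [Algebra.TensorProduct.tmul_mul_tmul, mul_one, one_mul]

/-- Induction on elements of the tensor product. -/
theorem DiagTensor.induction_on {P : DiagTensor R K A B → Prop} (t : DiagTensor R K A B)
    (hmul : ∀ a b, P (inl R K A B a * inr R K A B b)) (hadd : ∀ s t, P s → P t → P (s + t)) :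
    P t := by
  refine TensorProduct.induction_on (motive := P) t ?_ (fun a b => ?_) hadd
  · have := hmul 0 0
    rwa [map_zero, zero_mul] at this
  · exact DiagTensor.inl_mul_inr R K A B a b ▸ hmul a b

variable [Coalgebra.IsCocomm R D] [IsSmashModule R D K A] [IsSmashModule R D K B]

theorem tensorAct_eq_sum (d : D) (a : A) (b : B) {ι : Type*} (𝓡 : Coalgebra.Repr R d ι) :
    tensorAct R K d (a ⊗ₜ[K] b) = ∑ i ∈ 𝓡.index, (𝓡.left i • a) ⊗ₜ[K] (𝓡.right i • b) := by
  rw [tensorAct_tmul, sweedler_eq_sum _ _ _ d 𝓡]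
  rfl

theorem tensorAct_one (t : A ⊗[K] B) : tensorAct R K (1 : D) t = t := by
  induction t with
  | zero => exact map_zero _
  | add s t hs ht => rw [map_add, hs, ht]
  | tmul a b =>
    rw [tensorAct_tmul, sweedler, LinearMap.comp_apply, Bialgebra.comul_one,
      Algebra.TensorProduct.one_def]
    simp

theorem tensorAct_mul (d e : D) (t : A ⊗[K] B) :
    tensorAct R K (d * e) t = tensorAct R K d (tensorAct R K e t) := by
  induction t with
  | zero => simp only [map_zero]
  | add s t hs ht => rw [map_add, hs, ht, map_add, map_add]
  | tmul a b =>
    rw [tensorAct_eq_sum _ _ _ _ e a b (Coalgebra.Repr.arbitrary R e), map_sum, tensorAct_tmul,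
      sweedler, LinearMap.comp_apply, Bialgebra.comul_mul, ← (Coalgebra.Repr.arbitrary R e).eq,
      Finset.mul_sum, map_sum]
    refine Finset.sum_congr rfl fun i _ => ?_
    rw [tensorAct_eq_sum _ _ _ _ d _ _ (Coalgebra.Repr.arbitrary R d),
      ← (Coalgebra.Repr.arbitrary R d).eq, Finset.sum_mul, map_sum]
    simp [smul_smul]

theorem tensorAct_add (d e : D) (t : A ⊗[K] B) :
    tensorAct R K (d + e) t = tensorAct R K d t + tensorAct R K e t := by
  induction t with
  | zero => simp only [map_zero, add_zero]
  | add s t hs ht => rw [map_add, hs, ht, map_add, map_add]; abel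
  | tmul a b => simp only [tensorAct_tmul, map_add]

theorem tensorAct_smul (r : R) (d : D) (t : A ⊗[K] B) :
    tensorAct R K (r • d) t = r • tensorAct R K d t := by
  induction t with
  | zero => simp only [map_zero, smul_zero]
  | add s t hs ht => rw [map_add, hs, ht, map_add, smul_add]
  | tmul a b => simp only [tensorAct_tmul, map_smul]

noncomputable instance : Module D (DiagTensor R K A B) where
  smul d t := tensorAct R K (M := A) (N := B) d t
  one_smul t := tensorAct_one R K A B t
  mul_smul d e t := tensorAct_mul R K A B d e t
  smul_zero d := map_zero (tensorAct R K (M := A) (N := B) d)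
  smul_add d s t := map_add (tensorAct R K (M := A) (N := B) d) s t
  add_smul d e t := tensorAct_add R K A B d e t
  zero_smul t := by
    have := tensorAct_smul R K A B 0 (0 : D) t
    rwa [zero_smul, zero_smul] at this

instance : IsScalarTower R D (DiagTensor R K A B) where
  smul_assoc r d t := tensorAct_smul R K A B r d t

variable [IsModuleAlgebra R D A] [IsModuleAlgebra R D B]

theorem DiagTensor.smul_inl (d : D) (a : A) :
    d • inl R K A B a = inl R K A B (d • a) := by
  change tensorAct R K d (a ⊗ₜ[K] (1 : B)) = (d • a) ⊗ₜ[K] (1 : B)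
  rw [tensorAct_eq_sum _ _ _ _ d a 1 (Coalgebra.Repr.arbitrary R d)]
  have h := congrArg (TensorProduct.rid R D)
    (Coalgebra.sum_tmul_counit_eq (Coalgebra.Repr.arbitrary R d))
  rw [map_sum] at h
  simp only [TensorProduct.rid_tmul, one_smul] at h
  conv_rhs => rw [← h, Finset.sum_smul, TensorProduct.sum_tmul]
  refine Finset.sum_congr rfl fun i _ => ?_
  rw [IsModuleAlgebra.smul_one (R := R), Algebra.algebraMap_eq_smul_one, smul_assoc,
    TensorProduct.tmul_smul, TensorProduct.smul_tmul']

theorem DiagTensor.smul_inr (d : D) (b : B) :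
    d • inr R K A B b = inr R K A B (d • b) := by
  change tensorAct R K d ((1 : A) ⊗ₜ[K] b) = (1 : A) ⊗ₜ[K] (d • b)
  rw [tensorAct_tmul, sweedler_of_invariant]
  · rfl
  · intro c
    rw [IsModuleAlgebra.smul_one (R := R), Algebra.algebraMap_eq_smul_one]

theorem DiagTensor.smul_inl_mul_inr (d : D) (a : A) (b : B) :
    d • (inl R K A B a * inr R K A B b) =
      sweedler (LinearMap.mul R (DiagTensor R K A B)) (inl R K A B a) (inr R K A B b) d := by
  rw [inl_mul_inr]
  refine (tensorAct_eq_sum R K A B d a b (Coalgebra.Repr.arbitrary R d)).trans ?_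
  rw [sweedler_eq_sum _ _ _ d (Coalgebra.Repr.arbitrary R d)]
  refine Finset.sum_congr rfl fun i _ => ?_
  rw [smul_inl, smul_inr, LinearMap.mul_apply', inl_mul_inr]


/-- The orbit homomorphisms of the two factors agree on `K` and induce one ring homomorphism on the
tensor product. It sends `t` to its orbit map, which is the product rule. -/
instance [IsModuleAlgebra R D K] [IsExtension D K A] [IsExtension D K B] :
    IsModuleAlgebra R D (DiagTensor R K A B) := by
  let T := DiagTensor R K A B
  let α : A →+* WithConv (D →ₗ[R] T) := orbitHom ((DiagTensor.inl R K A B).restrictScalars R)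
  let β : B →+* WithConv (D →ₗ[R] T) := orbitHom ((DiagTensor.inr R K A B).restrictScalars R)
  have hK : ∀ x : K, α (algebraMap K A x) = β (algebraMap K B x) := fun x => by
    ext d
    change DiagTensor.inl R K A B (d • algebraMap K A x) =
      DiagTensor.inr R K A B (d • algebraMap K B x)
    rw [← IsExtension.map_smul, ← IsExtension.map_smul, AlgHom.commutes, AlgHom.commutes]
  let _ : Algebra K (WithConv (D →ₗ[R] T)) := (α.comp (algebraMap K A)).toAlgebra
  let α' : A →ₐ[K] WithConv (D →ₗ[R] T) := { α with commutes' := fun _ => rfl }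
  let β' : B →ₐ[K] WithConv (D →ₗ[R] T) := { β with commutes' := fun x => (hK x).symm }
  let γ : T →ₐ[K] WithConv (D →ₗ[R] T) := Algebra.TensorProduct.productMap α' β'
  have hγ : ∀ (t : T) (d : D), (γ t).ofConv d = d • t := fun t d => by
    refine DiagTensor.induction_on R K A B (P := fun t => (γ t).ofConv d = d • t) t (fun a b => ?_) fun s t hs ht => ?_
    · rw [map_mul, DiagTensor.smul_inl_mul_inr,
        sweedler_eq_sum _ _ _ d (Coalgebra.Repr.arbitrary R d)]
      have h₁ : γ (DiagTensor.inl R K A B a) = α a :=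
        Algebra.TensorProduct.productMap_left_apply α' β' a
      have h₂ : γ (DiagTensor.inr R K A B b) = β b :=
        Algebra.TensorProduct.productMap_right_apply α' β' b
      rw [h₁, h₂]
      refine ((Coalgebra.Repr.arbitrary R d).convMul_apply _ _).trans ?_
      refine Finset.sum_congr rfl fun i _ => ?_
      rw [DiagTensor.smul_inl, DiagTensor.smul_inr]
      rfl
    · rw [map_add, smul_add, ← hs, ← ht]
      rfl
  refine ⟨fun d => ?_, fun d s t => ?_⟩
  · rw [← hγ, map_one]
    rfl
  · rw [← hγ, map_mul, sweedler_eq_sum _ _ _ d (Coalgebra.Repr.arbitrary R d)]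
    refine ((Coalgebra.Repr.arbitrary R d).convMul_apply _ _).trans ?_
    refine Finset.sum_congr rfl fun i _ => ?_
    rw [LinearMap.mul_apply', ← hγ, ← hγ]

end DiagTensor

/-! ### Fundamental matrices -/

section Fundamental

variable {R D : Type*} [Field R] [Ring D] [HopfAlgebra R D]
variable {K V : Type*} [CommRing K] [Algebra R K] [Module D K] [IsScalarTower R D K]
  [IsModuleAlgebra R D K]
  [AddCommGroup V] [Module R V] [Module K V] [Module D V]
  [IsScalarTower R K V] [IsScalarTower R D V] [IsSmashModule R D K V]
  {ι : Type*} [Fintype ι] [DecidableEq ι] (b : Module.Basis ι K V)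
variable {T : Type*} [CommRing T] [Algebra R T] [Module D T] [IsScalarTower R D T]
  [IsModuleAlgebra R D T] [Algebra K T] [IsScalarTower R K T]

/-- The matrix of the action of an element of `D` with respect to a basis. -/
noncomputable def coordMatrix (d : D) : Matrix ι ι K := Matrix.of fun i j => b.repr (d • b i) j

theorem smul_basis (d : D) (i : ι) : d • b i = ∑ j, coordMatrix b d i j • b j :=
  (b.sum_repr (d • b i)).symm

/-- The matrix of values of a family of linear maps on a basis. -/
noncomputable def valueMatrix {κ : Type*} (f : κ → V →ₗ[K] T) : Matrix ι κ T := Matrix.of fun i j => f j (b i)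

@[simp] theorem valueMatrix_apply {κ : Type*} (f : κ → V →ₗ[K] T) (i : ι) (j : κ) :
    valueMatrix b f i j = f j (b i) := rfl

theorem smul_hom_basis {f : V →ₗ[K] T} (hf : ∀ (d : D) (v : V), f (d • v) = d • f v) (d : D)
    (i : ι) : d • f (b i) = ∑ j, algebraMap K T (coordMatrix b d i j) * f (b j) := by
  rw [← hf, smul_basis b, map_sum]
  exact Finset.sum_congr rfl fun j _ => by rw [map_smul, Algebra.smul_def]

/-- Expanding `g⁻¹ (g bᵢ) = bᵢ` in coordinates exhibits an inverse, up to the automorphism of `K`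
given by `g⁻¹`. -/
theorem isUnit_det_coordMatrix {g : D} (hg : IsGroupLikeElem R g) :
    IsUnit (coordMatrix b g).det := by
  have key : (groupLikeRingEquiv K hg.antipode).mapMatrix (coordMatrix b g) *
      coordMatrix b (HopfAlgebra.antipode R g) = 1 := by
    ext i j
    have h : ∑ k, (HopfAlgebra.antipode R g • coordMatrix b g i k) •
        (HopfAlgebra.antipode R g • b k) = b i := by
      simp only [← groupLike_smul_smul hg.antipode]
      rw [← Finset.smul_sum, ← smul_basis, smul_smul, hg.antipode_mul_cancel, one_smul]
    have h' := congrArg (fun v => b.repr v j) h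
    simp only [map_sum, map_smul, Finsupp.coe_finsetSum, Finset.sum_apply, Finsupp.smul_apply,
      smul_eq_mul, Module.Basis.repr_self, Finsupp.single_apply] at h'
    rw [Matrix.one_apply, ← h', Matrix.mul_apply]
    rfl
  have h := congrArg Matrix.det key
  rw [Matrix.det_mul, Matrix.det_one, ← RingEquiv.map_det] at h
  exact (isUnit_map_iff (groupLikeRingEquiv K hg.antipode) _).1 (IsUnit.of_mul_eq_one _ h)

/-- Let `ρ` send an element to its orbit map and `κ` embed `T` as scalars, both into `Hom_R(D, T)`.
With `X` the value matrix and `h = X c`, the same matrix `M` gives `ρ(X) = M κ(X)` and `ρ(h) = M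
κ(h)`. Hence `ρ(X) ρ(c) = ρ(X) κ(c)`. Cancelling the invertible `ρ(X)` leaves `ρ(c) = κ(c)`, which
says that `c` is constant. -/
theorem mem_constants_of_valueMatrix_mulVec [Coalgebra.IsCocomm R D]
    {f : ι → V →ₗ[K] T} (hf : ∀ j (d : D) (v : V), f j (d • v) = d • f j v)
    (hu : IsUnit (valueMatrix b f).det) {h : V →ₗ[K] T}
    (hh : ∀ (d : D) (v : V), h (d • v) = d • h v) {c : ι → T}
    (hc : ∀ i, h (b i) = ∑ j, f j (b i) * c j) (j : ι) : c j ∈ constants R D T := by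
  let ρ : T →+* WithConv (D →ₗ[R] T) := orbitHom (AlgHom.id R T)
  let κ : T →+* WithConv (D →ₗ[R] T) := algebraMap T (WithConv (D →ₗ[R] T))
  let M : Matrix ι ι (WithConv (D →ₗ[R] T)) := Matrix.of fun i k => WithConv.toConv
    { toFun := fun d => algebraMap K T (coordMatrix b d i k)
      map_add' := fun d e => by
        simp [coordMatrix, add_smul]
      map_smul' := fun r d => by
        simp only [coordMatrix, Matrix.of_apply, smul_assoc, RingHom.id_apply]
        rw [← algebraMap_smul K r (d • b i), map_smul, Finsupp.smul_apply, smul_eq_mul, map_mul,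
          ← IsScalarTower.algebraMap_apply, ← Algebra.smul_def] }
  have hM : ∀ (i k : ι) (d : D), (M i k).ofConv d = algebraMap K T (coordMatrix b d i k) :=
    fun _ _ _ => rfl
  have hρ : ∀ {f : V →ₗ[K] T} (_ : ∀ (d : D) (v : V), f (d • v) = d • f v) (i : ι),
      ρ (f (b i)) = ∑ k, M i k * κ (f (b k)) := fun {f} hf i => by
    ext d
    change d • f (b i) = _
    rw [smul_hom_basis b hf, WithConv.ofConv_sum, LinearMap.sum_apply]
    refine Finset.sum_congr rfl fun k _ => ?_
    have e : M i k * κ (f (b k)) = f (b k) • M i k := by rw [mul_comm, Algebra.smul_def]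
    rw [e]
    exact mul_comm _ _
  have h₁ : ρ.mapMatrix (valueMatrix b f) = M * κ.mapMatrix (valueMatrix b f) := by
    ext1 i j
    exact hρ (hf j) i
  have h₂ : (ρ.mapMatrix (valueMatrix b f)).mulVec (fun j => ρ (c j)) =
      (ρ.mapMatrix (valueMatrix b f)).mulVec (fun j => κ (c j)) := by
    have e₁ : (ρ.mapMatrix (valueMatrix b f)).mulVec (fun j => ρ (c j)) =
        fun i => ρ (h (b i)) := by
      ext1 i
      rw [hc, map_sum]
      exact Finset.sum_congr rfl fun k _ => (map_mul ρ _ _).symm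
    have e₂ : (κ.mapMatrix (valueMatrix b f)).mulVec (fun j => κ (c j)) =
        fun i => κ (h (b i)) := by
      ext1 i
      rw [hc, map_sum]
      exact Finset.sum_congr rfl fun k _ => (map_mul κ _ _).symm
    rw [e₁]
    conv_rhs => rw [h₁, ← Matrix.mulVec_mulVec, e₂]
    ext1 i
    exact hρ hh i
  have hu' : IsUnit (ρ.mapMatrix (valueMatrix b f)) := by
    rw [Matrix.isUnit_iff_isUnit_det, ← RingHom.map_det]
    exact hu.map ρ
  have h₃ := congrFun (Matrix.mulVec_injective_of_isUnit hu' h₂) j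
  intro d
  have h₄ := congrArg (fun F : WithConv (D →ₗ[R] T) => F.ofConv d) h₃
  refine (show d • c j = _ from h₄).trans ?_
  rw [show κ (c j) = c j • (1 : WithConv (D →ₗ[R] T)) from Algebra.algebraMap_eq_smul_one _]
  change c j • algebraMap R T (Coalgebra.counit d) = _
  rw [Algebra.smul_def, Algebra.smul_def, mul_comm]
  rfl

end Fundamental

/-! ### Stable subalgebras and their fractions -/

section StableSubalgebras

section Generators

variable {D : Type*} [Ring D] {K : Type*} [CommRing K] [Module D K]
variable {T : Type*} [CommRing T] [Module D T] [Algebra K T]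

theorem smul_mul_mem
    (R : Type*) [Field R] [HopfAlgebra R D] [Algebra R T] [IsScalarTower R D T]
    [IsModuleAlgebra R D T]
    (S : Subalgebra K T) {a c : T} (ha : ∀ d : D, d • a ∈ S)
    (hc : ∀ d : D, d • c ∈ S) (d : D) : d • (a * c) ∈ S := by
  rw [IsModuleAlgebra.smul_mul (R := R), sweedler_eq_sum _ _ _ d (Coalgebra.Repr.arbitrary R d)]
  exact sum_mem fun i _ => mul_mem (ha _) (hc _)

theorem smul_adjoin_mem
    (R : Type*) [Field R] [HopfAlgebra R D] [Algebra R T] [IsScalarTower R D T]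
    [IsModuleAlgebra R D T]
    (hK : ∀ (d : D) (a : K), algebraMap K T (d • a) = d • algebraMap K T a)
    {S : Set T} {B : Subalgebra K T} (hS : ∀ s ∈ S, ∀ d : D, d • s ∈ B) (d : D) {a : T}
    (ha : a ∈ Algebra.adjoin K S) : d • a ∈ B := by
  induction ha using Algebra.adjoin_induction generalizing d with
  | mem s hs => exact hS s hs d
  | algebraMap r => rw [← hK]; exact B.algebraMap_mem _
  | add a c _ _ ha hc => rw [smul_add]; exact add_mem (ha d) (hc d)
  | mul a c _ _ ha hc => exact smul_mul_mem R B ha hc d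

end Generators

variable {R D : Type*} [Field R] [Ring D] [HopfAlgebra R D]
variable {K : Type*} [CommRing K] [Algebra R K] [Module D K] [IsScalarTower R D K]
  [IsModuleAlgebra R D K]
variable {T : Type*} [CommRing T] [Algebra R T] [Module D T] [IsScalarTower R D T]
  [IsModuleAlgebra R D T] [Algebra K T] [IsScalarTower R K T]

/-- The subalgebra of fractions with numerator in `A` and denominator in `A` and invertible. -/
def fractions (A : Subalgebra K T) : Subalgebra K T where
  carrier := {x | ∃ s ∈ A, IsUnit s ∧ x * s ∈ A}
  mul_mem' := by
    rintro x y ⟨s, hs, hsu, hx⟩ ⟨t, ht, htu, hy⟩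
    exact ⟨s * t, mul_mem hs ht, hsu.mul htu, by
      rw [mul_mul_mul_comm]; exact mul_mem hx hy⟩
  add_mem' := by
    rintro x y ⟨s, hs, hsu, hx⟩ ⟨t, ht, htu, hy⟩
    refine ⟨s * t, mul_mem hs ht, hsu.mul htu, ?_⟩
    rw [show (x + y) * (s * t) = (x * s) * t + (y * t) * s by ring]
    exact add_mem (mul_mem hx ht) (mul_mem hy hs)
  algebraMap_mem' r := ⟨1, one_mem _, isUnit_one, by rw [mul_one]; exact A.algebraMap_mem r⟩

theorem le_fractions (A : Subalgebra K T) : A ≤ fractions A :=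
  fun a ha => ⟨1, one_mem _, isUnit_one, by rwa [mul_one]⟩

theorem mem_fractions_of_mul_eq_one {A : Subalgebra K T} {x y : T} (hx : x ∈ fractions A)
    (h : x * y = 1) : y ∈ fractions A := by
  obtain ⟨s, hs, hsu, hxs⟩ := hx
  refine ⟨x * s, hxs, (IsUnit.of_mul_eq_one y h).mul hsu, ?_⟩
  rw [← mul_assoc, mul_comm y x, h, one_mul]
  exact hs

/-- A fraction is an element of `A` times the inverse of a denominator, and `D` keeps such inverses
in the fractions because grouplike translates of the denominator are invertible there. -/
theorem isStable_fractions [Coalgebra.IsCocomm R D] (hD : IsPointed R D) (A : Subalgebra K T)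
    [IsStable D A] : IsStable D (fractions A) where
  smul_mem d x hx := by
    obtain ⟨s, hs, hsu, hx⟩ := hx
    obtain ⟨y, hy⟩ := hsu.exists_right_inv
    have hxy : x = (x * s) * y := by rw [mul_assoc, hy, mul_one]
    rw [hxy]
    refine smul_mul_mem R _ (fun d => le_fractions A (IsStable.smul_mem d _ hx))
      (smul_mem_of_mul_eq_one hD _ hy (fun d => le_fractions A (IsStable.smul_mem d _ hs))
        fun g hg => ?_) d
    have h : g • s * g • y = 1 := by
      rw [← groupLike_smul_mul hg, hy, groupLike_smul_one hg]
    exact ⟨g • y, mem_fractions_of_mul_eq_one (le_fractions A (IsStable.smul_mem g s hs)) h, h⟩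

/-- The invertible elements of a subalgebra, as a multiplicative set. -/
def unitsIn (A : Subalgebra K T) : Submonoid A := (IsUnit.submonoid T).comap A.val

noncomputable instance (A : Subalgebra K T) : Algebra A (fractions A) :=
  (Subalgebra.inclusion (le_fractions A)).toAlgebra

theorem isUnit_fractions {A : Subalgebra K T} {x : fractions A} (hx : IsUnit (x : T)) :
    IsUnit x := by
  obtain ⟨y, hy⟩ := hx.exists_right_inv
  exact IsUnit.of_mul_eq_one ⟨y, mem_fractions_of_mul_eq_one x.2 hy⟩ (Subtype.ext hy)

instance (A : Subalgebra K T) : IsLocalization (unitsIn A) (fractions A) where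
  map_units s := isUnit_fractions s.2
  surj := by
    rintro ⟨x, s, hs, hsu, hx⟩
    exact ⟨(⟨_, hx⟩, ⟨⟨s, hs⟩, hsu⟩), Subtype.ext rfl⟩
  exists_of_eq {a c} h := ⟨1, by
    have : (a : T) = c := congrArg (fun x : fractions A => (x : T)) h
    rw [Subtype.ext this]⟩

instance (A : Subalgebra K T) [IsNoetherianRing A] : IsNoetherianRing (fractions A) :=
  IsLocalization.isNoetherianRing (unitsIn A) _ inferInstance

/-- Clearing denominators shows that a nonzerodivisor of `A` stays one in `T`, hence is a unit there
since `T` is artinian. -/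
theorem isFractionRing_of_fractions_eq_top [IsArtinianRing T] {A : Subalgebra K T}
    (hA : fractions A = ⊤) : IsFractionRing A T := by
  have hsurj : ∀ x : T, ∃ s ∈ A, IsUnit s ∧ x * s ∈ A := fun x =>
    (hA ▸ trivial : x ∈ fractions A)
  have hunit : ∀ s : nonZeroDivisors A, IsUnit (algebraMap A T s) := by
    rintro ⟨s, hs⟩
    refine IsArtinianRing.isUnit_of_mem_nonZeroDivisors (mem_nonZeroDivisors_iff_right.2 ?_)
    intro x hx
    obtain ⟨t, ht, htu, hxt⟩ := hsurj x
    have h : (⟨x * t, hxt⟩ : A) = 0 := by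
      refine (mem_nonZeroDivisors_iff_right.1 hs) _ (Subtype.ext ?_)
      change x * t * (s : T) = 0
      have hx' : x * (s : T) = 0 := hx
      rw [mul_right_comm, hx', zero_mul]
    exact (htu.mul_left_eq_zero).1 (congrArg Subtype.val h)
  exact
    { map_units := hunit
      surj := fun x => by
        obtain ⟨s, hs, hsu, hx⟩ := hsurj x
        refine ⟨(⟨_, hx⟩, ⟨⟨s, hs⟩, mem_nonZeroDivisors_iff_right.2 fun a ha => Subtype.ext ?_⟩), rfl⟩
        exact (hsu.mul_left_eq_zero).1 (congrArg Subtype.val ha)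
      exists_of_eq := fun {a c} h => ⟨1, by rw [Subtype.ext h]⟩ }

end StableSubalgebras

/-! ### Two criteria for artinian reduced rings -/

section Artinian

/-- A reduced noetherian ring in which all nonzerodivisors are invertible is artinian. -/
theorem isArtinianRing_of_isFractionRing_self (Q : Type*) [CommRing Q] [IsNoetherianRing Q]
    [IsReduced Q] [IsFractionRing Q Q] : IsArtinianRing Q := by
  have : Ring.KrullDimLE 0 Q := Ring.KrullDimLE.mk₀ fun q hq => by
    obtain ⟨P, hP, hqP⟩ := q.exists_le_maximal hq.ne_top
    obtain ⟨hPp, x, hx⟩ := isAssociatedPrime_iff.1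
      -- The maximal ideal is the annihilator of some `x`. If `x ∈ q ≤ P`, then `x² = 0` and `x = 0`
      -- by reducedness; so `x ∉ q`, and `P x = 0` forces `P ≤ q`.
      (Ideal.IsMaximal.mem_associatedPrimes_of_isFractionRing Q P)
    have hmem : ∀ y, y ∈ P ↔ y * x = 0 := fun y => by
      rw [hx, Submodule.mem_colon_singleton, Submodule.mem_bot, smul_eq_mul]
    by_cases hxq : x ∈ q
    · have hx0 : x = 0 := by
        have := (hmem x).1 (hqP hxq)
        exact IsNilpotent.eq_zero ⟨2, by rw [sq, this]⟩
      exact absurd ((Ideal.eq_top_iff_one P).2 ((hmem 1).2 (by rw [hx0, mul_zero]))) hP.ne_top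
    · have hPq : P ≤ q := fun y hy => by
        have h0 : y * x ∈ q := by rw [(hmem y).1 hy]; exact q.zero_mem
        exact (hq.mem_or_mem h0).resolve_right hxq
      rwa [le_antisymm hqP hPq]
  exact IsNoetherianRing.isArtinianRing_of_krullDimLE_zero

theorem eq_zero_of_forall_mem_maximal (A : Type*) [CommRing A] [IsArtinianRing A]
    [IsReduced A] {x : A} (hx : ∀ P : Ideal A, P.IsMaximal → x ∈ P) : x = 0 := by
  have h : x ∈ nilradical A := by
    rw [nilradical_eq_sInf, Ideal.mem_sInf]
    intro P hP
    have : P.IsPrime := hP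
    exact hx P inferInstance
  exact IsNilpotent.eq_zero h

end Artinian

/-! ### Rings of fractions are AS -/

section Fractions

variable {R D : Type*} [Field R] [Ring D] [HopfAlgebra R D] [Coalgebra.IsCocomm R D]
variable {K : Type*} [CommRing K] [Algebra R K]
variable {T : Type*} [CommRing T] [Algebra R T] [Module D T] [IsScalarTower R D T]
  [IsModuleAlgebra R D T] [Algebra K T] [IsScalarTower R K T]

/-- The fractions of a `D`-simple noetherian subalgebra form an AS algebra. -/
theorem isAS_fractions_of_isDSimple (hD : IsPointed R D) (hBW : IsBirkhoffWitt R D)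
    (A : Subalgebra K T) [IsStable D A] [IsStable D (fractions A)] [IsNoetherianRing A]
    (hA : IsDSimple D A)
    (hu : ∀ s ∈ A, (∀ a ∈ A, s * a = 0 → a = 0) → IsUnit s) : IsAS D (fractions A) := by
  have hnt : Nontrivial (fractions A) := by
    have := hA.nontrivial
    exact (Subalgebra.inclusion_injective (le_fractions A)).nontrivial
  have hS : IsDSimple D (fractions A) := by
    refine ⟨hnt, fun J hJ => ?_⟩
    let ι := Subalgebra.inclusion (le_fractions A)
    rcases hA.eq_bot_or_eq_top (J.comap ι) (fun d a ha => hJ d _ ha) with h | h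
    · left
      rw [eq_bot_iff]
      rintro ⟨x, s, hs, hsu, hx⟩ hxJ
      have h₁ : (⟨x * s, hx⟩ : A) ∈ J.comap ι := J.mul_mem_right ⟨s, le_fractions A hs⟩ hxJ
      rw [h] at h₁
      exact Subtype.ext ((hsu.mul_left_eq_zero).1 (congrArg Subtype.val h₁))
    · right
      have : (1 : A) ∈ J.comap ι := h ▸ trivial
      exact (Ideal.eq_top_iff_one J).2 this
  have : IsReduced (fractions A) := hS.isReduced (R := R) hD hBW
  have : IsFractionRing (fractions A) (fractions A) := by
    refine IsFractionRing.self_iff_nonZeroDivisors_le_isUnit.2 ?_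
    rintro ⟨x, s, hs, hsu, hx⟩ hxd
    refine isUnit_fractions (isUnit_of_mul_isUnit_left (y := s) (hu _ hx fun a ha h0 => ?_))
    have h₁ := mem_nonZeroDivisors_iff_right.1 hxd ⟨s * a, mul_mem (le_fractions A hs)
      (le_fractions A ha)⟩ (Subtype.ext (by
        change s * a * x = 0
        rw [← h0]; ring))
    exact (hsu.mul_right_eq_zero).1 (congrArg Subtype.val h₁)
  exact ⟨isArtinianRing_of_isFractionRing_self _, hnt, hS.eq_bot_or_eq_top⟩

/-- The fractions of a noetherian subalgebra of an AS algebra form an AS algebra. -/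
theorem isAS_fractions (hD : IsPointed R D) (hBW : IsBirkhoffWitt R D) [IsAS D T]
    (A : Subalgebra K T) [IsStable D A] [IsStable D (fractions A)] [IsNoetherianRing A] :
    IsAS D (fractions A) := by
  have : IsArtinianRing T := IsAS.artinian D
  have : Nontrivial T := IsAS.nontrivial D
  have : IsReduced T := IsDSimple.isReduced (R := R) (D := D) hD hBW IsAS.isDSimple
  have : Fintype (MaximalSpectrum T) := Fintype.ofFinite _
  obtain ⟨P₀⟩ : Nonempty (MaximalSpectrum T) := inferInstance
  let Q := fractions A
  -- Units of `T` lying in `Q` are units of `Q`, so a proper ideal consists of nonunits of `T`;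
  -- prime avoidance over the finitely many maximal ideals applies.
  have hle : ∀ J : Ideal Q, J ≠ ⊤ → ∃ P : Ideal T, P.IsMaximal ∧ J ≤ P.comap Q.val := by
    intro J hJ
    have h₁ : (J : Set Q) ⊆ ⋃ P ∈ (Finset.univ : Finset (MaximalSpectrum T)),
        ((P.asIdeal.comap Q.val : Ideal Q) : Set Q) := by
      intro x hx
      have hxu : (x : T) ∈ nonunits T := fun h =>
        hJ (Ideal.eq_top_of_isUnit_mem _ hx (isUnit_fractions h))
      obtain ⟨P, hP, hxP⟩ := exists_max_ideal_of_mem_nonunits hxu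
      exact Set.mem_biUnion (x := (⟨P, hP⟩ : MaximalSpectrum T)) (Finset.mem_univ _) hxP
    obtain ⟨P, -, hP⟩ := (Ideal.subset_union_prime (s := Finset.univ)
      (f := fun P : MaximalSpectrum T => P.asIdeal.comap Q.val) P₀ P₀
      (fun P _ _ _ => Ideal.comap_isPrime _ _)).1 h₁
    exact ⟨P.asIdeal, P.isMaximal, hP⟩
  obtain ⟨m, hm⟩ := Ideal.exists_maximal Q
  obtain ⟨P₁, hP₁, hmP₁⟩ := hle m hm.ne_top
  -- One contraction is maximal, and grouplikes carry it to all the others.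
  have hmax : ∀ P : Ideal T, P.IsMaximal → (P.comap Q.val).IsMaximal := by
    intro P hP
    obtain ⟨g, hg, rfl⟩ := exists_groupLike_comap_eq hD hBW P₁ P
    have h₁ : (P₁.comap Q.val).IsMaximal := by
      rwa [← hm.eq_of_le (Ideal.comap_ne_top _ hP₁.ne_top) hmP₁]
    exact Ideal.comap_isMaximal_of_equiv (groupLikeRingEquiv Q hg) (p := P₁.comap Q.val)
  have : Ring.KrullDimLE 0 Q := Ring.KrullDimLE.mk₀ fun q hq => by
    have h₁ : (Finset.univ : Finset (MaximalSpectrum T)).inf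
        (fun P => P.asIdeal.comap Q.val) ≤ q := by
      intro x hx
      have : (x : T) = 0 := eq_zero_of_forall_mem_maximal T fun P hP =>
        (Finset.inf_le (s := Finset.univ)
          (f := fun P : MaximalSpectrum T => P.asIdeal.comap Q.val)
          (Finset.mem_univ (⟨P, hP⟩ : MaximalSpectrum T)) : _ ≤ P.comap Q.val) hx
      rw [show x = 0 from Subtype.ext this]
      exact q.zero_mem
    obtain ⟨P, -, hP⟩ := (Ideal.IsPrime.inf_le' hq).1 h₁
    rw [← (hmax _ P.isMaximal).eq_of_le hq.ne_top hP]
    exact hmax _ P.isMaximal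
  -- A proper stable ideal lies in one maximal ideal of `T`, hence in all its grouplike translates.
  -- These are all the maximal ideals, and their intersection is zero.
  refine ⟨IsNoetherianRing.isArtinianRing_of_krullDimLE_zero, inferInstance, fun J hJ => ?_⟩
  by_contra! hne
  obtain ⟨P, hP, hJP⟩ := hle J hne.2
  refine hne.1 (eq_bot_iff.2 fun x hx => ?_)
  refine Subtype.ext (eq_zero_of_forall_mem_maximal T fun P' hP' => ?_)
  obtain ⟨g, hg, rfl⟩ := exists_groupLike_comap_eq hD hBW P P'
  exact hJP (hJ g x hx)

end Fractions

/-! ### The algebra generated by a fundamental matrix and its inverse determinant -/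

section Principal

variable {R D : Type*} [Field R] [Ring D] [HopfAlgebra R D]
variable {K V : Type*} [CommRing K] [Algebra R K] [Module D K] [IsScalarTower R D K]
  [IsModuleAlgebra R D K]
  [AddCommGroup V] [Module R V] [Module K V] [Module D V]
  [IsScalarTower R K V] [IsScalarTower R D V] [IsSmashModule R D K V]
  {ι : Type*} [Fintype ι] [DecidableEq ι] (b : Module.Basis ι K V)
variable {T : Type*} [CommRing T] [Algebra R T] [Module D T] [IsScalarTower R D T]
  [IsModuleAlgebra R D T] [Algebra K T] [IsScalarTower R K T]

/-- The algebra generated by the values of linear maps on a basis and one more element (in practice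
the inverse of the determinant). -/
noncomputable def principalAlgebra (f : ι → V →ₗ[K] T) (w : T) : Subalgebra K T :=
  Algebra.adjoin K ({x | ∃ i j, f j (b i) = x} ∪ {w})

theorem hom_basis_mem_principalAlgebra (f : ι → V →ₗ[K] T) (w : T) (i j : ι) :
    f j (b i) ∈ principalAlgebra b f w :=
  Algebra.subset_adjoin (Or.inl ⟨i, j, rfl⟩)

theorem hom_mem_principalAlgebra (f : ι → V →ₗ[K] T) (w : T) (j : ι) (v : V) :
    f j v ∈ principalAlgebra b f w := by
  rw [← b.sum_repr v, map_sum]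
  refine sum_mem fun i _ => ?_
  rw [map_smul]
  exact Subalgebra.smul_mem _ (hom_basis_mem_principalAlgebra b f w i j) _

theorem mem_principalAlgebra_self (f : ι → V →ₗ[K] T) (w : T) : w ∈ principalAlgebra b f w :=
  Algebra.subset_adjoin (Or.inr rfl)

theorem principalAlgebra_le {f : ι → V →ₗ[K] T} {w : T} {B : Subalgebra K T}
    (h : ∀ i j, f j (b i) ∈ B) (hw : w ∈ B) : principalAlgebra b f w ≤ B := by
  refine Algebra.adjoin_le ?_
  rintro x (⟨i, j, rfl⟩ | rfl)
  · exact h i j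
  · exact hw

instance finiteType_principalAlgebra (f : ι → V →ₗ[K] T) (w : T) :
    Algebra.FiniteType K (principalAlgebra b f w) := by
  refine (Subalgebra.fg_iff_finiteType _).1 (Subalgebra.fg_def.2 ⟨_, ?_, rfl⟩)
  refine Set.Finite.union ?_ (Set.finite_singleton w)
  refine (Set.finite_range fun p : ι × ι => f p.2 (b p.1)).subset ?_
  rintro x ⟨i, j, rfl⟩
  exact ⟨(i, j), rfl⟩

theorem det_mem {n : Type*} [Fintype n] [DecidableEq n] {B : Subalgebra K T} {X : Matrix n n T}
    (h : ∀ i j, X i j ∈ B) : X.det ∈ B := by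
  rw [Matrix.det_apply]
  refine sum_mem fun σ _ => ?_
  rw [Units.smul_def]
  exact zsmul_mem (prod_mem fun i _ => h _ _) _

theorem smul_det_valueMatrix {f : ι → V →ₗ[K] T}
    (hf : ∀ j (d : D) (v : V), f j (d • v) = d • f j v) {g : D} (hg : IsGroupLikeElem R g) :
    g • (valueMatrix b f).det =
      algebraMap K T (coordMatrix b g).det * (valueMatrix b f).det := by
  rw [← groupLikeRingEquiv_apply hg, RingEquiv.map_det, RingHom.map_det, ← Matrix.det_mul]
  congr 1
  ext i j
  exact smul_hom_basis b (hf j) g i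

/-- Only the inverse determinant is delicate. Grouplikes multiply the determinant by units of `K`,
so the convolution inverse of its orbit map has values in the algebra. -/
theorem isStable_principalAlgebra [Coalgebra.IsCocomm R D] (hD : IsPointed R D)
    (hK : ∀ (d : D) (a : K), algebraMap K T (d • a) = d • algebraMap K T a)
    {f : ι → V →ₗ[K] T} (hf : ∀ j (d : D) (v : V), f j (d • v) = d • f j v) {w : T}
    (hw : (valueMatrix b f).det * w = 1) : IsStable D (principalAlgebra b f w) := by
  have h₁ : ∀ s ∈ {x | ∃ i j, f j (b i) = x}, ∀ d : D, d • s ∈ principalAlgebra b f w := by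
    rintro _ ⟨i, j, rfl⟩ d
    rw [← hf]
    exact hom_mem_principalAlgebra b f w j _
  refine ⟨fun d _ ha => smul_adjoin_mem R hK ?_ d ha⟩
  rintro s (hs | rfl) d
  · exact h₁ s hs d
  · have hdet : (valueMatrix b f).det ∈ Algebra.adjoin K {x | ∃ i j, f j (b i) = x} :=
      det_mem fun i j => Algebra.subset_adjoin ⟨i, j, rfl⟩
    refine smul_mem_of_mul_eq_one hD _ hw (fun d => smul_adjoin_mem R hK h₁ d hdet)
      (fun g hg => ?_) d
    obtain ⟨y, hy⟩ := (isUnit_det_coordMatrix b hg).exists_right_inv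
    refine ⟨s * algebraMap K T y, mul_mem (mem_principalAlgebra_self b f s)
      (Subalgebra.algebraMap_mem _ _), ?_⟩
    rw [smul_det_valueMatrix b hf hg]
    calc _ = ((valueMatrix b f).det * s) *
          (algebraMap K T ((coordMatrix b g).det * y)) := by rw [map_mul]; ring
      _ = 1 := by rw [hw, hy, map_one, one_mul]

theorem exists_constant_coefficients [Coalgebra.IsCocomm R D]
    {f : ι → V →ₗ[K] T} (hf : ∀ j (d : D) (v : V), f j (d • v) = d • f j v)
    (hu : IsUnit (valueMatrix b f).det) {h : V →ₗ[K] T}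
    (hh : ∀ (d : D) (v : V), h (d • v) = d • h v) :
    ∃ c : ι → T, (∀ j, c j ∈ constants R D T) ∧ ∀ i, h (b i) = ∑ j, f j (b i) * c j := by
  have hX := (Matrix.isUnit_iff_isUnit_det _).2 hu
  obtain ⟨Y, hY⟩ := hX.exists_right_inv
  have hc : ∀ i, h (b i) = ∑ j, f j (b i) * (Y.mulVec fun i => h (b i)) j := fun i => by
    have : (valueMatrix b f).mulVec (Y.mulVec fun i => h (b i)) = fun i => h (b i) := by
      rw [Matrix.mulVec_mulVec, hY, Matrix.one_mulVec]
    exact (congrFun this i).symm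
  exact ⟨_, mem_constants_of_valueMatrix_mulVec b hf hu hh hc, hc⟩

end Principal

/-! ### Minimal splitting algebras are finitely generated Picard–Vessiot extensions -/

section Splitting

variable {R D : Type*} [Field R] [Ring D] [HopfAlgebra R D] [Coalgebra.IsCocomm R D]
variable {K : Type*} {L : Type v} {V : Type w} [CommRing K] [Algebra R K] [Module D K]
  [IsScalarTower R D K] [IsModuleAlgebra R D K]
  [AddCommGroup V] [Module R V] [Module K V] [Module D V]
  [IsScalarTower R K V] [IsScalarTower R D V] [IsSmashModule R D K V]
variable [CommRing L] [Algebra R L] [Module D L] [IsScalarTower R D L]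
  [IsModuleAlgebra R D L] [Algebra K L] [IsScalarTower R K L] [IsExtension D K L]

/-- Coordinates are added one at a time. If the chosen ones have a common kernel, some further
coordinate is nonzero on it. Its values there form a nonzero stable ideal of `L`, hence include `1`,
so surjectivity persists with this coordinate added. The rank of `V` bounds the process. -/
theorem exists_surjective_injective [IsAS D L] {n : ℕ} (b : Module.Basis (Fin n) K V)
    {Λ : Type*} {φ : L ⊗[K] V →ₗ[L] (Λ → L)}
    (hφ : ∀ (d : D) (t : L ⊗[K] V), φ (tensorAct R K d t) = d • φ t)
    (hinj : Function.Injective φ) :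
    ∃ (m : ℕ) (l : Fin m → Λ), Function.Surjective (LinearMap.funLeft L L l ∘ₗ φ) ∧
      Function.Injective (LinearMap.funLeft L L l ∘ₗ φ) := by
  by_contra! hne
  have := IsAS.nontrivial D (A := L)
  have hall : ∀ m, ∃ l : Fin m → Λ, Function.Surjective (LinearMap.funLeft L L l ∘ₗ φ) := by
    intro m
    induction m with
    | zero => exact ⟨Fin.elim0, fun y => ⟨0, Subsingleton.elim _ _⟩⟩
    | succ m ih =>
      obtain ⟨l, hl⟩ := ih
      have hni := hne m l hl
      rw [← LinearMap.ker_eq_bot, Submodule.eq_bot_iff] at hni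
      push Not at hni
      obtain ⟨t, ht, ht0⟩ := hni
      have hφt : φ t ≠ 0 := fun h => ht0 (hinj (by rw [h, map_zero]))
      obtain ⟨l', hl'⟩ := Function.ne_iff.1 hφt
      let N := LinearMap.ker (LinearMap.funLeft L L l ∘ₗ φ)
      have hN : ∀ s, s ∈ N ↔ ∀ j, φ s (l j) = 0 := fun s => by
        rw [LinearMap.mem_ker, funext_iff]; rfl
      let J : Ideal L := N.map (LinearMap.proj l' ∘ₗ φ)
      have hJ := IsAS.eq_bot_or_eq_top (D := D) J (by
        rintro d _ ⟨s, hs, rfl⟩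
        refine ⟨tensorAct R K d s, (hN _).2 fun j => ?_, ?_⟩
        · rw [hφ, Pi.smul_apply, (hN s).1 hs, smul_zero]
        · change φ (tensorAct R K d s) l' = d • φ s l'
          rw [hφ, Pi.smul_apply])
      have hJ1 : (1 : L) ∈ J := by
        rw [hJ.resolve_left fun h => hl' ?_]
        · trivial
        · have : φ t l' ∈ J := ⟨t, ht, rfl⟩
          rwa [h, Submodule.mem_bot] at this
      obtain ⟨s, hs, hs1⟩ := hJ1
      have hs1 : φ s l' = 1 := hs1
      refine ⟨Fin.cons l' l, fun y => ?_⟩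
      obtain ⟨t₀, ht₀⟩ := hl (fun j => y j.succ)
      refine ⟨t₀ + (y 0 - φ t₀ l') • s, ?_⟩
      ext1 j
      change φ (t₀ + (y 0 - φ t₀ l') • s) ((Fin.cons l' l : Fin (m + 1) → Λ) j) = y j
      rw [map_add, map_smul, Pi.add_apply, Pi.smul_apply, smul_eq_mul]
      refine Fin.cases ?_ (fun i => ?_) j
      · rw [Fin.cons_zero, hs1]; ring
      · rw [Fin.cons_succ, (hN s).1 hs, mul_zero, add_zero]
        exact congrFun ht₀ i
  obtain ⟨l, hl⟩ := hall (n + 1)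
  have hle := le_of_fin_surjective L
    ((LinearMap.funLeft L L l ∘ₗ φ) ∘ₗ
      (Algebra.TensorProduct.basis L b).equivFun.symm.toLinearMap)
    (hl.comp (Algebra.TensorProduct.basis L b).equivFun.symm.surjective)
  omega

theorem tensorAct_one_tmul (d : D) (v : V) :
    tensorAct R K d ((1 : L) ⊗ₜ[K] v) = (1 : L) ⊗ₜ[K] (d • v) := by
  rw [tensorAct_tmul, sweedler_of_invariant]
  · rfl
  · intro c
    rw [IsModuleAlgebra.smul_one (R := R), Algebra.algebraMap_eq_smul_one]

/-- A module that splits in an AS algebra has a fundamental matrix. -/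
theorem Splits.exists_isUnit_det [IsAS D L] {n : ℕ} (b : Module.Basis (Fin n) K V)
    (h : Splits R D K L V) :
    ∃ f : Fin n → V →ₗ[K] L, (∀ j (d : D) (v : V), f j (d • v) = d • f j v) ∧
      IsUnit (valueMatrix b f).det := by
  obtain ⟨Λ, φ, hφ, hinj⟩ := h
  have := IsAS.nontrivial D (A := L)
  obtain ⟨m, l, hsurj, hinj'⟩ := exists_surjective_injective b hφ hinj
  obtain rfl : m = n := by
    have h₁ := (LinearEquiv.ofBijective _ ⟨hinj', hsurj⟩).finrank_eq
    rw [Module.finrank_eq_card_basis (Algebra.TensorProduct.basis L b)] at h₁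
    simpa using h₁.symm
  let f : Fin m → V →ₗ[K] L := fun j =>
    ((LinearMap.proj (l j) ∘ₗ φ).restrictScalars K) ∘ₗ TensorProduct.mk K L V 1
  have hf : ∀ j v, f j v = φ (1 ⊗ₜ v) (l j) := fun _ _ => rfl
  refine ⟨f, fun j d v => ?_, ?_⟩
  · rw [hf, hf, ← tensorAct_one_tmul (R := R), hφ, Pi.smul_apply]
  -- The coordinates of preimages of the unit vectors form a left inverse of the value matrix.
  · choose t ht using fun k : Fin m => hsurj (Pi.single k 1)
    let Y : Matrix (Fin m) (Fin m) L :=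
      Matrix.of fun k i => (Algebra.TensorProduct.basis L b).repr (t k) i
    have hY : Y * valueMatrix b f = 1 := by
      ext k j
      have h₁ : φ (t k) (l j) = (1 : Matrix (Fin m) (Fin m) L) k j := by
        refine (congrFun (ht k) j).trans ?_
        rw [Pi.single_apply, Matrix.one_apply]
        simp only [eq_comm]
      have h₂ := congrArg (fun s => φ s (l j)) ((Algebra.TensorProduct.basis L b).sum_repr (t k))
      simp only [map_sum, Finset.sum_apply] at h₂
      rw [← h₁, ← h₂, Matrix.mul_apply]
      refine Finset.sum_congr rfl fun i _ => ?_
      rw [map_smul, Pi.smul_apply, smul_eq_mul, Algebra.TensorProduct.basis_apply]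
      rfl
    have h₁ := congrArg Matrix.det hY
    rw [Matrix.det_mul, Matrix.det_one] at h₁
    exact IsUnit.of_mul_eq_one_right _ h₁

theorem mem_constants_of_mul_eq_one {c y : L} (hc : c ∈ constants R D L) (h : c * y = 1) :
    y ∈ constants R D L := fun d => by
  have h₁ : c * (d • y) = Coalgebra.counit (R := R) d • (1 : L) := by
    have h₂ := IsModuleAlgebra.smul_mul (R := R) d c y
    rw [sweedler_of_invariant _ _ _ _ hc, h, IsModuleAlgebra.smul_one (R := R),
      Algebra.algebraMap_eq_smul_one] at h₂
    exact h₂.symm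
  calc d • y = (c * y) * (d • y) := by rw [h, one_mul]
    _ = y * (c * (d • y)) := by ring
    _ = Coalgebra.counit (R := R) d • y := by rw [h₁, mul_smul_comm, mul_one]

theorem SameConstants.exists_algebraMap_eq (h : SameConstants R D K L) {c : L}
    (hc : c ∈ constants R D L) : ∃ a ∈ constants R D K, algebraMap K L a = c := by
  rw [← h] at hc
  exact hc

variable {n : ℕ} (b : Module.Basis (Fin n) K V)

theorem det_valueMatrix_comp {T T' : Type*} [CommRing T] [Algebra K T] [CommRing T']
    [Algebra K T'] (φ : T →ₐ[K] T') (f : Fin n → V →ₗ[K] T) :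
    (valueMatrix b fun j => φ.toLinearMap ∘ₗ f j).det = φ (valueMatrix b f).det :=
  (AlgHom.map_det φ (valueMatrix b f)).symm

/-- Every `D`-linear map is a combination of the given ones with constant coefficients. These come
from `K`, so an AS subalgebra with the entries of one fundamental matrix has the values of all such
maps. -/
theorem eq_top_of_hom_basis_mem (hsc : SameConstants R D K L)
    (hmin : IsMinimalSplittingAlgebra R D K L V) {f : Fin n → V →ₗ[K] L}
    (hf : ∀ j (d : D) (v : V), f j (d • v) = d • f j v) (hu : IsUnit (valueMatrix b f).det)
    (B : Subalgebra K L) [hB : IsStable D B] (hAS : IsAS D B) (hfB : ∀ i j, f j (b i) ∈ B) :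
    B = ⊤ := by
  rw [eq_top_iff, ← hmin.adjoin_eq_top]
  refine sInf_le ⟨hB, hAS, ?_⟩
  rintro _ ⟨h, hh, v, rfl⟩
  obtain ⟨c, hc, hhc⟩ := exists_constant_coefficients (R := R) b hf hu hh
  rw [← b.sum_repr v, map_sum]
  refine sum_mem fun i _ => ?_
  rw [map_smul, hhc]
  refine B.smul_mem (sum_mem fun j _ => mul_mem (hfB i j) ?_) _
  obtain ⟨a, -, ha⟩ := hsc.exists_algebraMap_eq (hc j)
  rw [← ha]
  exact B.algebraMap_mem a

theorem isFinitelyGenerated_of_isMinimalSplittingAlgebra (hsc : SameConstants R D K L)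
    (hmin : IsMinimalSplittingAlgebra R D K L V) {f : Fin n → V →ₗ[K] L}
    (hf : ∀ j (d : D) (v : V), f j (d • v) = d • f j v)
    (hu : IsUnit (valueMatrix b f).det) : IsFinitelyGenerated D K L := by
  refine ⟨(Set.finite_range fun p : Fin n × Fin n => f p.2 (b p.1)).toFinset, ?_⟩
  refine sInf_eq_top.2 ?_
  rintro B ⟨hB, hAS, hS⟩
  exact eq_top_of_hom_basis_mem b hsc hmin hf hu B hAS fun i j =>
    hS (by rw [Set.Finite.coe_toFinset]; exact ⟨(i, j), rfl⟩)

theorem fractions_principalAlgebra_eq_top [IsAS D K] [IsAS D L] (hD : IsPointed R D)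
    (hBW : IsBirkhoffWitt R D) (hsc : SameConstants R D K L)
    (hmin : IsMinimalSplittingAlgebra R D K L V) {f : Fin n → V →ₗ[K] L}
    (hf : ∀ j (d : D) (v : V), f j (d • v) = d • f j v) {w : L}
    (hw : (valueMatrix b f).det * w = 1) : fractions (principalAlgebra b f w) = ⊤ := by
  have := isStable_principalAlgebra b hD IsExtension.map_smul hf hw
  have := isStable_fractions hD (principalAlgebra b f w)
  have : IsArtinianRing K := IsAS.artinian D
  have : IsNoetherianRing (principalAlgebra b f w) := Algebra.FiniteType.isNoetherianRing K _
  exact eq_top_of_hom_basis_mem b hsc hmin hf (IsUnit.of_mul_eq_one w hw) _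
    (isAS_fractions hD hBW _) fun i j =>
      le_fractions _ (hom_basis_mem_principalAlgebra b f w i j)

/-- The linear maps that generate the principal algebra, with values in it. -/
noncomputable def principalHom (f : Fin n → V →ₗ[K] L) (w : L) (j : Fin n) :
    V →ₗ[K] principalAlgebra b f w where
  toFun v := ⟨f j v, hom_mem_principalAlgebra b f w j v⟩
  map_add' v v' := Subtype.ext (map_add (f j) v v')
  map_smul' a v := Subtype.ext (map_smul (f j) a v)

theorem det_principalHom_mul {f : Fin n → V →ₗ[K] L} {w : L}
    (hw : (valueMatrix b f).det * w = 1) :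
    (valueMatrix b (principalHom b f w)).det * ⟨w, mem_principalAlgebra_self b f w⟩ = 1 := by
  refine Subtype.ext (Eq.trans ?_ hw)
  have := det_valueMatrix_comp b (principalAlgebra b f w).val (principalHom b f w)
  exact congrArg (· * w) this.symm

/-- The right copy of the fundamental matrix is the left copy times an invertible constant matrix
`Z`. So the right copy of `A`, and with it the whole tensor product, lies in the left `A`-span of
the constants, which is closed under multiplication. -/
theorem span_tensorConstants_principalAlgebra {f : Fin n → V →ₗ[K] L}
    (hf : ∀ j (d : D) (v : V), f j (d • v) = d • f j v) {w : L}
    (hw : (valueMatrix b f).det * w = 1) [IsStable D (principalAlgebra b f w)] :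
    Submodule.span (principalAlgebra b f w)
      (tensorConstants R D (principalAlgebra b f w)) = ⊤ := by
  let A := principalAlgebra b f w
  let T := DiagTensor R K A A
  let S : Submodule A T := Submodule.span A (constants R D T : Set T)
  have hC : ∀ t : T, t ∈ constants R D T → t ∈ S := fun t ht => Submodule.subset_span ht
  have hsmul : ∀ (a : A) (t : T), t ∈ S → DiagTensor.inl R K A A a * t ∈ S := fun a t ht =>
    (Algebra.smul_def a t : a • t = DiagTensor.inl R K A A a * t) ▸ S.smul_mem a ht
  have hmul : ∀ s t : T, s ∈ S → t ∈ S → s * t ∈ S := by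
    intro s t hs ht
    have h := Submodule.mul_mem_mul hs ht
    rw [Submodule.span_mul_span] at h
    refine Submodule.span_mono ?_ h
    rintro _ ⟨x, hx, y, hy, rfl⟩
    exact mul_mem hx hy
  let F := principalHom b f w
  let w' : A := ⟨w, mem_principalAlgebra_self b f w⟩
  have hF : ∀ j (d : D) (v : V), F j (d • v) = d • F j v := fun j d v => Subtype.ext (hf j d v)
  have hw' : (valueMatrix b F).det * w' = 1 := det_principalHom_mul b hw
  let F₁ : Fin n → V →ₗ[K] T := fun j => (DiagTensor.inl R K A A).toLinearMap ∘ₗ F j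
  let F₂ : Fin n → V →ₗ[K] T := fun j => (DiagTensor.inr R K A A).toLinearMap ∘ₗ F j
  have hF₁ : ∀ j (d : D) (v : V), F₁ j (d • v) = d • F₁ j v := fun j d v => by
    change DiagTensor.inl R K A A (F j (d • v)) = d • DiagTensor.inl R K A A (F j v)
    rw [hF, DiagTensor.smul_inl]
  have hF₂ : ∀ j (d : D) (v : V), F₂ j (d • v) = d • F₂ j v := fun j d v => by
    change DiagTensor.inr R K A A (F j (d • v)) = d • DiagTensor.inr R K A A (F j v)
    rw [hF, DiagTensor.smul_inr]
  have hd₁ : (valueMatrix b F₁).det * DiagTensor.inl R K A A w' = 1 := by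
    rw [det_valueMatrix_comp b (DiagTensor.inl R K A A) F, ← map_mul, hw', map_one]
  have hd₂ : (valueMatrix b F₂).det * DiagTensor.inr R K A A w' = 1 := by
    rw [det_valueMatrix_comp b (DiagTensor.inr R K A A) F, ← map_mul, hw', map_one]
  choose c hc hcF using fun j => exists_constant_coefficients (R := R) b hF₁ (IsUnit.of_mul_eq_one _ hd₁)
    (hF₂ j)
  let Z : Matrix (Fin n) (Fin n) T := Matrix.of fun k j => c j k
  have hZ : valueMatrix b F₂ = valueMatrix b F₁ * Z := by
    ext i j
    exact hcF j i
  have hdetZ : Z.det ∈ constants R D T :=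
    det_mem (B := constants R D T) fun i j => hc j i
  have hZw : Z.det * ((valueMatrix b F₁).det * DiagTensor.inr R K A A w') = 1 := by
    rw [← mul_assoc, mul_comm Z.det, ← Matrix.det_mul, ← hZ, hd₂]
  have hgen : ∀ (x : L) (hx : x ∈ A), (DiagTensor.inr R K A A ⟨x, hx⟩ : T) ∈ S := by
    intro x hx
    refine Algebra.adjoin_induction
      (p := fun x hx => DiagTensor.inr R K A A ⟨x, hx⟩ ∈ S) ?_ ?_ ?_ ?_ hx
    · rintro x (⟨i, j, rfl⟩ | rfl)
      · have h₁ := hcF j i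
        change (F₂ j (b i) : T) ∈ S
        rw [h₁]
        exact S.sum_mem fun k _ => hsmul _ _ (hC _ (hc j k))
      · change (DiagTensor.inr R K A A w' : T) ∈ S
        -- The bracket is the inverse of `det Z`, hence a constant.
        have h₁ : (DiagTensor.inr R K A A w' : T) = DiagTensor.inl R K A A w' *
            ((valueMatrix b F₁).det * DiagTensor.inr R K A A w') := by
          rw [← mul_assoc, mul_comm (DiagTensor.inl R K A A w'), hd₁, one_mul]
        rw [h₁]
        exact hsmul _ _ (hC _ (mem_constants_of_mul_eq_one hdetZ hZw))
    · intro r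
      have h₁ : (DiagTensor.inr R K A A ⟨algebraMap K L r, A.algebraMap_mem r⟩ : T) =
          DiagTensor.inl R K A A (algebraMap K A r) * 1 := by
        rw [mul_one, AlgHom.commutes]
        exact AlgHom.commutes (DiagTensor.inr R K A A) r
      rw [h₁]
      exact hsmul _ _ (hC _ (one_mem _))
    · intro x y hx hy h₁ h₂
      have h := S.add_mem h₁ h₂
      rwa [← map_add] at h
    · intro x y hx hy h₁ h₂
      have h := hmul _ _ h₁ h₂
      rwa [← map_mul] at h
  suffices hS : S = ⊤ from hS
  refine eq_top_iff.2 fun t _ => ?_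
  refine DiagTensor.induction_on R K A A (P := fun t => t ∈ S) t (fun a a' => ?_)
    fun s t hs ht => S.add_mem hs ht
  exact hsmul a _ (hgen a' a'.2)

theorem isPVExtension_of_isMinimalSplittingAlgebra [IsAS D K] [IsAS D L] (hD : IsPointed R D)
    (hBW : IsBirkhoffWitt R D) (hsc : SameConstants R D K L)
    (hmin : IsMinimalSplittingAlgebra R D K L V) {f : Fin n → V →ₗ[K] L}
    (hf : ∀ j (d : D) (v : V), f j (d • v) = d • f j v)
    (hu : IsUnit (valueMatrix b f).det) : IsPVExtension R D K L := by
  obtain ⟨w, hw⟩ := hu.exists_right_inv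
  have hst := isStable_principalAlgebra b hD IsExtension.map_smul hf hw
  have : IsArtinianRing L := IsAS.artinian D
  exact ⟨hsc, principalAlgebra b f w, hst,
    isFractionRing_of_fractions_eq_top (fractions_principalAlgebra_eq_top b hD hBW hsc hmin hf hw),
    span_tensorConstants_principalAlgebra b hf hw⟩

end Splitting

/-! ### Transport of structure and change of universe -/

section Transport

variable {R : Type u} {D : Type v} [Field R] [Ring D] [HopfAlgebra R D]
variable {K : Type w} [CommRing K] [Algebra R K] [Module D K]

/-- The coinduced algebra lives in a universe depending on that of `D`; this brings the splitting
algebra back to the universe of `K`. -/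
theorem exists_small_copy (L' : Type x) [CommRing L'] [Algebra R L'] [Module D L']
    [IsScalarTower R D L'] [IsModuleAlgebra R D L'] [Algebra K L'] [IsScalarTower R K L']
    [Small.{w} L'] :
    ∃ (L : Type w) (_ : CommRing L) (_ : Algebra R L) (_ : Module D L) (_ : IsScalarTower R D L)
      (_ : IsModuleAlgebra R D L) (_ : Algebra K L) (_ : IsScalarTower R K L) (e : L ≃ₐ[K] L'),
      ∀ (d : D) (y : L), e (d • y) = d • e y := by
  let e : Shrink.{w} L' ≃ₐ[K] L' := Shrink.algEquiv K L'
  have hR : ∀ (r : R) (y : Shrink.{w} L'), e (r • y) = r • e y :=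
    fun r y => (Shrink.algEquiv R L').toLinearEquiv.map_smul r y
  have hd : ∀ (d : D) (y : Shrink.{w} L'), e (d • y) = d • e y :=
    fun d y => (Shrink.linearEquiv D L').map_smul d y
  have hRK : IsScalarTower R K (Shrink.{w} L') :=
    ⟨fun r a y => e.injective (by rw [hR, map_smul, map_smul, smul_assoc])⟩
  have hRD : IsScalarTower R D (Shrink.{w} L') :=
    ⟨fun r d y => e.injective (by rw [hR, hd, hd, smul_assoc])⟩
  refine ⟨Shrink.{w} L', inferInstance, inferInstance, inferInstance, hRD, ⟨fun d => ?_,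
    fun d y z => ?_⟩, inferInstance, hRK, e, hd⟩
  · refine e.injective ?_
    rw [hd, map_one, IsModuleAlgebra.smul_one (R := R), Algebra.algebraMap_eq_smul_one,
      Algebra.algebraMap_eq_smul_one, hR, map_one]
  · refine e.injective ?_
    rw [hd, map_mul, IsModuleAlgebra.smul_mul (R := R),
      sweedler_eq_sum _ _ _ d (Coalgebra.Repr.arbitrary R d),
      sweedler_eq_sum _ _ _ d (Coalgebra.Repr.arbitrary R d), map_sum]
    refine Finset.sum_congr rfl fun i _ => ?_
    rw [LinearMap.mul_apply', LinearMap.mul_apply', map_mul, hd, hd]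

theorem isAS_of_ringEquiv {L L' : Type*} [CommRing L] [Module D L] [CommRing L'] [Module D L']
    [IsAS D L'] (e : L ≃+* L') (he : ∀ (d : D) (y : L), e (d • y) = d • e y) : IsAS D L where
  artinian := by
    have : IsArtinianRing L' := IsAS.artinian D
    exact e.symm.surjective.isArtinianRing
  nontrivial := by
    have : Nontrivial L' := IsAS.nontrivial D
    exact e.surjective.nontrivial
  eq_bot_or_eq_top I hI := by
    have he' : ∀ (d : D) (y : L'), e.symm (d • y) = d • e.symm y := fun d y =>
      e.injective (by rw [he, e.apply_symm_apply, e.apply_symm_apply])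
    rcases IsAS.eq_bot_or_eq_top (D := D) (I.comap e.symm) (fun d a ha => by
      rw [Ideal.mem_comap, he']
      exact hI d _ ha) with h | h
    · left
      rw [eq_bot_iff]
      intro y hy
      have : e y ∈ I.comap e.symm := by
        rw [Ideal.mem_comap, e.symm_apply_apply]; exact hy
      rw [h, Ideal.mem_bot] at this
      exact (map_eq_zero_iff e e.injective).1 this
    · right
      have : (1 : L') ∈ I.comap e.symm := h ▸ trivial
      rw [Ideal.mem_comap, map_one] at this
      exact (Ideal.eq_top_iff_one I).2 this

/-- A compatible algebra over an AS algebra is an extension. -/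
theorem isExtension_of_map_smul [IsAS D K] {T : Type*} [CommRing T] [Module D T] [Algebra K T]
    [Nontrivial T] (h : ∀ (d : D) (a : K), algebraMap K T (d • a) = d • algebraMap K T a) :
    IsExtension D K T where
  map_smul := h
  injective := by
    rw [injective_iff_map_eq_zero]
    rcases IsAS.eq_bot_or_eq_top (D := D) (RingHom.ker (algebraMap K T)) (fun d a ha => by
      rw [RingHom.mem_ker] at ha ⊢
      rw [h, ha, smul_zero]) with hk | hk
    · intro a ha
      have : a ∈ RingHom.ker (algebraMap K T) := ha
      rwa [hk] at this
    · have : (1 : K) ∈ RingHom.ker (algebraMap K T) := hk ▸ trivial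
      rw [RingHom.mem_ker, map_one] at this
      exact absurd this one_ne_zero

end Transport

/-! ### A fundamental matrix in the coinduced algebra, and recognition of minimal splitting algebras
-/

section Existence

variable {R : Type u} {D : Type v} [Field R] [Ring D] [HopfAlgebra R D] [Coalgebra.IsCocomm R D]
variable {K : Type w} {V : Type x} [CommRing K] [Algebra R K] [Module D K] [IsScalarTower R D K]
  [IsModuleAlgebra R D K]
  [AddCommGroup V] [Module R V] [Module K V] [Module D V]
  [IsScalarTower R K V] [IsScalarTower R D V] [IsSmashModule R D K V]
  {n : ℕ} (b : Module.Basis (Fin n) K V)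

/-- Every free module over `K # D` has a fundamental matrix in some module algebra. -/
theorem exists_fundamental_matrix (hD : IsPointed R D) [Nontrivial K] :
    ∃ (T : Type (max v w)) (_ : CommRing T) (_ : Algebra R T) (_ : Module D T)
      (_ : IsScalarTower R D T) (_ : IsModuleAlgebra R D T) (_ : Algebra K T)
      (_ : IsScalarTower R K T) (f : Fin n → V →ₗ[K] T), Nontrivial T ∧
      (∀ (d : D) (a : K), algebraMap K T (d • a) = d • algebraMap K T a) ∧
      (∀ j (d : D) (v : V), f j (d • v) = d • f j v) ∧ IsUnit (valueMatrix b f).det := by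
  let τ : K →ₐ[R] Coind R D K := toCoind (AlgHom.id R K)
  let _ : Algebra K (Coind R D K) := (τ : K →+* Coind R D K).toAlgebra
  have hRK : IsScalarTower R K (Coind R D K) :=
    IsScalarTower.of_algebraMap_eq fun r => (τ.commutes r).symm
  have hτ : ∀ (a : K) (y : Coind R D K), a • y = τ a * y := fun a y => Algebra.smul_def a y
  -- The `j`-th solution sends `v` to `d ↦` the `j`-th coordinate of `d v`. At a grouplike `g` the
  -- resulting matrix is the matrix of `g` itself, which is invertible.
  let F : Fin n → V →ₗ[K] Coind R D K := fun j =>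
    { toFun := fun v => Coind.mk (((b.coord j).restrictScalars R) ∘ₗ act v)
      map_add' := fun v v' => Coind.ext fun d => by
        change b.coord j (d • (v + v')) = b.coord j (d • v) + b.coord j (d • v')
        rw [smul_add, map_add]
      map_smul' := fun a v => Coind.ext fun d => by
        rw [RingHom.id_apply, hτ]
        change b.coord j (d • (a • v)) = _
        refine Eq.trans ?_ ((Coalgebra.Repr.arbitrary R d).convMul_apply _ _).symm
        rw [IsSmashModule.smul_smul (R := R),
          sweedler_eq_sum _ _ _ d (Coalgebra.Repr.arbitrary R d), map_sum]
        refine Finset.sum_congr rfl fun i _ => ?_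
        exact (b.coord j).map_smul _ _ }
  have hF : ∀ j v d, (F j v).eval d = b.coord j (d • v) := fun _ _ _ => rfl
  refine ⟨Coind R D K, inferInstance, inferInstance, inferInstance, inferInstance, inferInstance,
    inferInstance, hRK, F, ⟨0, 1, fun h => ?_⟩, fun d a => toCoind_smul _ d a,
    fun j d v => Coind.ext fun c => ?_, Coind.isUnit hD _ fun g hg => ?_⟩
  · have := congrArg (fun f : Coind R D K => f.eval 1) h
    simp [Coind.eval_one] at this
  · rw [Coind.eval_smul, hF, hF, smul_smul]
  · have h : (valueMatrix b F).det.eval g = (coordMatrix b g).det := by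
      rw [← Coind.evalHom_apply hg, RingHom.map_det]
      rfl
    rw [h]
    exact isUnit_det_coordMatrix b hg

variable {L : Type w₁} [CommRing L] [Algebra R L] [Module D L] [IsScalarTower R D L]
  [IsModuleAlgebra R D L] [Algebra K L] [IsScalarTower R K L]

/-- A unit of `L` is a nonzerodivisor of the artinian ring `B`, so its inverse is already there. -/
theorem mem_of_mul_eq_one_of_isAS (B : Subalgebra K L) [IsStable D B] (hB : IsAS D B) {s y : L}
    (hs : s ∈ B) (h : s * y = 1) : y ∈ B := by
  have : IsArtinianRing B := IsAS.artinian D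
  have hu : IsUnit (⟨s, hs⟩ : B) := by
    refine IsArtinianRing.isUnit_of_mem_nonZeroDivisors (mem_nonZeroDivisors_iff_right.2 ?_)
    intro x hx
    refine Subtype.ext ((IsUnit.of_mul_eq_one y h).mul_left_eq_zero.1 ?_)
    exact congrArg Subtype.val hx
  obtain ⟨z, hz⟩ := hu.exists_right_inv
  have hz' : s * (z : L) = 1 := congrArg Subtype.val hz
  have : y = z := by
    calc y = (s * z) * y := by rw [hz', one_mul]
      _ = (s * y) * z := by ring
      _ = z := by rw [h, one_mul]
  rw [this]
  exact z.2

/-- The solutions give the embedding of `L ⊗ V`, injective because their matrix is invertible.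
Minimality holds because AS subalgebras are closed under inverses. -/
theorem isMinimalSplittingAlgebra_of_fractions_eq_top [IsExtension D K L]
    {f : Fin n → V →ₗ[K] L} (hf : ∀ j (d : D) (v : V), f j (d • v) = d • f j v) {w : L}
    (hw : (valueMatrix b f).det * w = 1) (htop : fractions (principalAlgebra b f w) = ⊤) :
    IsMinimalSplittingAlgebra R D K L V where
  splits := by
    let φ : L ⊗[K] V →ₗ[L] (ULift.{max w₁ x} (Fin n) → L) :=
      LinearMap.pi fun j => (f j.down).liftBaseChange L
    have hφ : ∀ (l : L) (v : V) j, φ (l ⊗ₜ v) j = l * f j.down v := fun l v j => rfl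
    refine ⟨_, φ, fun d t => ?_, ?_⟩
    · induction t with
      | zero => simp only [map_zero, smul_zero]
      | add s t hs ht => rw [map_add, map_add, hs, ht, map_add, smul_add]
      | tmul l v =>
        ext1 j
        rw [tensorAct_tmul, sweedler_eq_sum _ _ _ d (Coalgebra.Repr.arbitrary R d), map_sum,
          Pi.smul_apply, hφ, IsModuleAlgebra.smul_mul (R := R),
          sweedler_eq_sum _ _ _ d (Coalgebra.Repr.arbitrary R d), Finset.sum_apply]
        refine Finset.sum_congr rfl fun i _ => ?_
        rw [tmulBilin_apply, hφ, hf, LinearMap.mul_apply']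
    · rw [injective_iff_map_eq_zero]
      intro t ht
      let B := Algebra.TensorProduct.basis L b
      have hX : IsUnit (valueMatrix b f) :=
        (Matrix.isUnit_iff_isUnit_det _).2 (IsUnit.of_mul_eq_one w hw)
      have h₁ : Matrix.vecMul (fun i => B.repr t i) (valueMatrix b f) =
          Matrix.vecMul 0 (valueMatrix b f) := by
        rw [Matrix.zero_vecMul]
        ext1 j
        change ∑ i, B.repr t i * f j (b i) = 0
        have h₂ := congrArg (fun s => φ s ⟨j⟩) (B.sum_repr t)
        simp only [map_sum, Finset.sum_apply] at h₂
        rw [ht] at h₂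
        refine Eq.trans (Finset.sum_congr rfl fun i _ => ?_) h₂
        rw [map_smul, Pi.smul_apply, smul_eq_mul, Algebra.TensorProduct.basis_apply, hφ, one_mul]
      have h₃ := Matrix.vecMul_injective_of_isUnit hX h₁
      refine (map_eq_zero_iff B.repr B.repr.injective).1 (Finsupp.ext fun i => ?_)
      exact congrFun h₃ i
  adjoin_eq_top := by
    refine sInf_eq_top.2 ?_
    rintro B ⟨hB, hAS, hS⟩
    have hfB : ∀ i j, f j (b i) ∈ B := fun i j => hS ⟨f j, hf j, b i, rfl⟩
    have hwB : w ∈ B := mem_of_mul_eq_one_of_isAS B hAS (det_mem hfB) hw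
    rw [eq_top_iff, ← htop]
    rintro x ⟨s, hs, hsu, hx⟩
    have hle := principalAlgebra_le b hfB hwB
    obtain ⟨y, hy⟩ := hsu.exists_right_inv
    have h₁ : x = (x * s) * y := by rw [mul_assoc, hy, mul_one]
    rw [h₁]
    exact mul_mem (hle hx) (mem_of_mul_eq_one_of_isAS B hAS (hle hs) hy)

end Existence

/-! ### Existence of a minimal splitting algebra without new constants -/

section Existence

variable {R : Type u} {D : Type v} [Field R] [Ring D] [HopfAlgebra R D] [Coalgebra.IsCocomm R D]
variable {K : Type w} {V : Type x} [CommRing K] [Algebra R K] [Module D K] [IsScalarTower R D K]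
  [IsModuleAlgebra R D K]
  [AddCommGroup V] [Module R V] [Module K V] [Module D V]
  [IsScalarTower R K V] [IsScalarTower R D V] [IsSmashModule R D K V]
  {n : ℕ} (b : Module.Basis (Fin n) K V)

theorem map_principalAlgebra {T T' : Type*} [CommRing T] [Algebra K T] [CommRing T']
    [Algebra K T'] (φ : T →ₐ[K] T') (f : Fin n → V →ₗ[K] T) (w : T) :
    (principalAlgebra b f w).map φ =
      principalAlgebra b (fun j => φ.toLinearMap ∘ₗ f j) (φ w) := by
  rw [principalAlgebra, principalAlgebra, AlgHom.map_adjoin, Set.image_union, Set.image_singleton]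
  congr 2
  ext x
  constructor
  · rintro ⟨_, ⟨i, j, rfl⟩, rfl⟩
    exact ⟨i, j, rfl⟩
  · rintro ⟨i, j, rfl⟩
    exact ⟨_, ⟨i, j, rfl⟩, rfl⟩

theorem principalAlgebra_principalHom {T : Type*} [CommRing T] [Algebra K T]
    (f : Fin n → V →ₗ[K] T) (w : T) :
    principalAlgebra b (principalHom b f w) ⟨w, mem_principalAlgebra_self b f w⟩ = ⊤ := by
  let A := principalAlgebra b f w
  refine Subalgebra.map_injective (f := A.val) Subtype.val_injective ?_
  rw [map_principalAlgebra, Algebra.map_top, Subalgebra.range_val]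
  rfl

theorem range_eq_principalAlgebra {T T' : Type*} [CommRing T] [Algebra K T] [CommRing T']
    [Algebra K T'] (f : Fin n → V →ₗ[K] T) (w : T) (φ : principalAlgebra b f w →ₐ[K] T') :
    φ.range = principalAlgebra b (fun j => φ.toLinearMap ∘ₗ principalHom b f w j)
      (φ ⟨w, mem_principalAlgebra_self b f w⟩) := by
  rw [← map_principalAlgebra, principalAlgebra_principalHom, Algebra.map_top]

/-- The ideal of denominators of a constant is stable, and it is nonzero for a fraction;
`D`-simplicity makes it contain `1`. -/
theorem mem_of_mem_constants_fractions {T : Type*} [CommRing T] [Algebra R T] [Module D T]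
    [IsScalarTower R D T] [IsModuleAlgebra R D T] [Algebra K T] [IsScalarTower R K T]
    (A : Subalgebra K T) [IsStable D A] (hA : IsDSimple D A) {c : T}
    (hc : c ∈ constants R D T) (hcA : c ∈ fractions A) : c ∈ A := by
  have := hA.nontrivial
  let J : Ideal A :=
    { carrier := {a | (a : T) * c ∈ A}
      zero_mem' := by
        change ((0 : A) : T) * c ∈ A
        rw [ZeroMemClass.coe_zero, zero_mul]; exact A.zero_mem
      add_mem' := fun {a a'} ha ha' => by
        change ((a + a' : A) : T) * c ∈ A
        rw [Subalgebra.coe_add, add_mul]; exact A.add_mem ha ha'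
      smul_mem' := fun r a ha => by
        change ((r * a : A) : T) * c ∈ A
        rw [Subalgebra.coe_mul, mul_assoc]; exact A.mul_mem r.2 ha }
  obtain ⟨s, hs, hsu, hcs⟩ := hcA
  rcases hA.eq_bot_or_eq_top J (fun d a ha => by
    change (d • (a : T)) * c ∈ A
    have h : d • ((a : T) * c) = (d • (a : T)) * c := by
      rw [mul_comm, IsModuleAlgebra.smul_mul (R := R), sweedler_of_invariant _ _ _ _ hc,
        LinearMap.mul_apply', mul_comm]
    rw [← h]
    exact IsStable.smul_mem d _ ha) with h | h
  · have h₁ : (⟨s, hs⟩ : A) ∈ J := by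
      change s * c ∈ A
      rwa [mul_comm]
    rw [h, Ideal.mem_bot] at h₁
    have h₂ : s = 0 := congrArg Subtype.val h₁
    have h₃ : (1 : T) = 0 := by
      obtain ⟨y, hy⟩ := hsu.exists_right_inv
      rw [← hy, h₂, zero_mul]
    exact absurd (Subtype.ext h₃ : (1 : A) = 0) one_ne_zero
  · have h₁ : (1 : A) ∈ J := h ▸ trivial
    have h₂ : (1 : T) * c ∈ A := h₁
    rwa [one_mul] at h₂

/-- A fraction is determined by its numerator and denominator in `A`, and `A` is a quotient of a
polynomial ring over `K`. -/
theorem small_fractions {T : Type*} [CommRing T] [Algebra K T] (A : Subalgebra K T)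
    [Algebra.FiniteType K A] : Small.{w} (fractions A) := by
  obtain ⟨m, φ, hφ⟩ := Algebra.FiniteType.iff_quotient_mvPolynomial''.1
    (inferInstance : Algebra.FiniteType K A)
  have : Small.{w} A := small_of_surjective hφ
  choose s hs hsu hx using fun x : fractions A => x.2
  refine small_of_injective (f := fun x : fractions A =>
    ((⟨_, hx x⟩, ⟨s x, hs x⟩) : A × A)) fun x y hxy => ?_
  have h₁ : (x : T) * s x = y * s y := congrArg (fun p : A × A => (p.1 : T)) hxy
  have h₂ : s x = s y := congrArg (fun p : A × A => (p.2 : T)) hxy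
  rw [h₂] at h₁
  exact Subtype.ext ((hsu y).mul_right_cancel h₁)

theorem exists_isMinimalSplittingAlgebra (hD : IsPointed R D) (hBW : IsBirkhoffWitt R D)
    [IsAS D K] [IsAlgClosed (constants R D K)] [Module.Finite K V] :
    ∃ (L : Type w) (_ : CommRing L) (_ : Algebra R L) (_ : Module D L) (_ : IsScalarTower R D L)
      (_ : IsModuleAlgebra R D L) (_ : IsAS D L)
      (_ : Algebra K L) (_ : IsScalarTower R K L) (_ : IsExtension D K L),
      SameConstants R D K L ∧ IsMinimalSplittingAlgebra R D K L V := by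
  have : Nontrivial K := IsAS.nontrivial D
  have : IsArtinianRing K := IsAS.artinian D
  obtain ⟨n, ⟨b⟩⟩ := exists_basis R D K V hD hBW
  obtain ⟨T, _, _, _, _, _, _, _, f, _, hK, hf, hu⟩ := exists_fundamental_matrix b hD
  obtain ⟨w, hw⟩ := hu.exists_right_inv
  let A₀ := principalAlgebra b f w
  have : IsStable D A₀ := isStable_principalAlgebra b hD hK hf hw
  have : IsNoetherianRing A₀ := Algebra.FiniteType.isNoetherianRing K _
  have : Nontrivial A₀ := ⟨0, 1, fun h => zero_ne_one (congrArg Subtype.val h : (0 : T) = 1)⟩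
  obtain ⟨M, _, _, _, _, _, _, _, π, _, hπ, hAs, hnzd⟩ :=
    exists_isDSimple_range (R := R) (D := D) (K := K) hD A₀
  let A := π.range
  have : Nontrivial A := hAs.nontrivial
  have : Nontrivial M := (Subtype.val_injective : Function.Injective (A.val)).nontrivial
  have hKM : ∀ (d : D) (a : K), algebraMap K M (d • a) = d • algebraMap K M a := fun d a => by
    have h : algebraMap K A₀ (d • a) = d • algebraMap K A₀ a := Subtype.ext (hK d a)
    rw [← π.commutes, h, hπ, π.commutes]
  have : IsExtension D K M := isExtension_of_map_smul hKM
  have : Algebra.FiniteType K A := Algebra.FiniteType.of_surjective π.rangeRestrict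
    π.rangeRestrict_surjective
  have : IsNoetherianRing A := Algebra.FiniteType.isNoetherianRing K _
  have : IsStable D (fractions A) := isStable_fractions hD A
  have : IsAS D (fractions A) := isAS_fractions_of_isDSimple hD hBW A hAs hnzd
  have : Small.{w} (fractions A) := small_fractions A
  obtain ⟨L, _, _, _, _, _, _, _, e, he⟩ :=
    exists_small_copy (R := R) (D := D) (K := K) (fractions A)
  have hAS : IsAS D L := isAS_of_ringEquiv e.toRingEquiv he
  have : Nontrivial L := IsAS.nontrivial D
  have hext : IsExtension D K L := isExtension_of_map_smul fun d a => e.injective (by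
    rw [he, e.commutes, e.commutes, IsExtension.map_smul])
  refine ⟨L, inferInstance, inferInstance, inferInstance, inferInstance, inferInstance, hAS,
    inferInstance, inferInstance, hext, le_antisymm ?_ ?_, ?_⟩
  · rintro _ ⟨a, ha, rfl⟩
    exact algebraMap_mem_constants ha
  · intro c hc
    have hc' : ((e c : fractions A) : M) ∈ constants R D M := fun d => by
      rw [← coe_stable_smul, ← he, hc d, ← algebraMap_smul K, map_smul, algebraMap_smul]
      rfl
    -- The theorem on constants needs finite type over `K`, which `A` has but its ring of fractions
    -- need not.
    have hcA := mem_of_mem_constants_fractions A hAs hc' (e c).2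
    obtain ⟨a, ha, hac⟩ := hAs.exists_algebraMap_eq (R := R) (K := K) (c := ⟨_, hcA⟩)
      (fun d => Subtype.ext (hc' d))
    refine ⟨a, ha, e.injective ?_⟩
    change e (algebraMap K L a) = e c
    rw [e.commutes]
    have h : algebraMap K M a = (e c : M) := congrArg (fun x : A => (x : M)) hac
    exact Subtype.ext h
  · let θ : A₀ →ₐ[K] fractions A := (Subalgebra.inclusion (le_fractions A)).comp π.rangeRestrict
    let Θ : A₀ →ₐ[K] L := (e.symm : fractions A →ₐ[K] L).comp θ
    have heΘ : ∀ t, e (Θ t) = θ t := fun t => e.apply_symm_apply _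
    have hΘ : ∀ (d : D) (t : A₀), Θ (d • t) = d • Θ t := fun d t => e.injective (by
      rw [he, heΘ, heΘ]
      exact Subtype.ext (hπ d t))
    refine isMinimalSplittingAlgebra_of_fractions_eq_top b
      (f := fun j => Θ.toLinearMap ∘ₗ principalHom b f w j)
      (w := Θ ⟨w, mem_principalAlgebra_self b f w⟩) (fun j d v => ?_) ?_ ?_
    · have h : principalHom b f w j (d • v) = d • principalHom b f w j v :=
        Subtype.ext (hf j d v)
      change Θ (principalHom b f w j (d • v)) = d • Θ (principalHom b f w j v)
      rw [h, hΘ]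
    · rw [det_valueMatrix_comp, ← map_mul, det_principalHom_mul b hw, map_one]
    · rw [← range_eq_principalAlgebra, eq_top_iff]
      rintro y -
      obtain ⟨_, ⟨t, rfl⟩, htu, t', ht'⟩ := (e y).2
      refine ⟨Θ t, ⟨t, rfl⟩, ?_, t', e.injective ?_⟩
      · have h : IsUnit (e (Θ t)) := by
          rw [heΘ]
          exact isUnit_fractions htu
        exact (isUnit_map_iff e _).1 h
      · rw [map_mul]
        change e (Θ t') = e y * e (Θ t)
        rw [heΘ, heΘ]
        exact Subtype.ext ht'

end Existence

/-! ### Uniqueness of minimal splitting algebras -/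

section Uniqueness

theorem isAlgClosed_of_ringEquiv {k : Type*} {k' : Type*} [Field k] [Field k'] [IsAlgClosed k]
    (e : k ≃+* k') : IsAlgClosed k' := by
  refine IsAlgClosed.of_exists_root _ fun p _ hp => ?_
  have hdeg : (p.map (e.symm : k' →+* k)).degree ≠ 0 := by
    rw [Polynomial.degree_map]
    exact (Polynomial.degree_pos_of_irreducible hp).ne'
  obtain ⟨x, hx⟩ := IsAlgClosed.exists_root _ hdeg
  refine ⟨e x, e.symm.injective ?_⟩
  rw [map_zero]
  have h := Polynomial.eval₂_hom (p := p) (e.symm : k' →+* k) (e x)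
  rw [Polynomial.IsRoot, Polynomial.eval_map] at hx
  refine h.symm.trans ?_
  rw [← hx]
  congr 1
  exact e.symm_apply_apply x

/-- A surjective endomorphism of a noetherian ring is injective. -/
theorem injective_of_surjective_ringHom {A : Type*} [CommRing A] [IsNoetherianRing A]
    (f : A →+* A) (hf : Function.Surjective f) : Function.Injective f := by
  let k : ℕ →o Ideal A :=
    { toFun := fun n => RingHom.ker (f ^ n)
      monotone' := by
        refine monotone_nat_of_le_succ fun n x hx => ?_
        rw [RingHom.mem_ker] at hx ⊢
        rw [pow_succ', RingHom.mul_def, RingHom.comp_apply, hx, map_zero] }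
  obtain ⟨n, hn⟩ := monotone_stabilizes_iff_noetherian.2 (inferInstance : IsNoetherian A A) k
  rw [injective_iff_map_eq_zero]
  intro x hx
  have hs : Function.Surjective (f ^ n) := by
    rw [RingHom.coe_pow]
    exact hf.iterate n
  obtain ⟨y, rfl⟩ := hs x
  have h₁ : y ∈ k (n + 1) := by
    change (f ^ (n + 1)) y = 0
    rw [pow_succ', RingHom.mul_def, RingHom.comp_apply, hx]
  rw [← hn (n + 1) (Nat.le_succ n)] at h₁
  exact h₁

variable {R : Type u} {D : Type v} [Field R] [Ring D] [HopfAlgebra R D] [Coalgebra.IsCocomm R D]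
variable {K : Type w} {V : Type x} [CommRing K] [Algebra R K] [Module D K] [IsScalarTower R D K]
  [IsModuleAlgebra R D K]
  [AddCommGroup V] [Module R V] [Module K V] [Module D V]
  [IsScalarTower R K V] [IsScalarTower R D V] [IsSmashModule R D K V]
  {n : ℕ} (b : Module.Basis (Fin n) K V)

theorem principalAlgebra_le_of_mul {M : Type*} [CommRing M] [Algebra K M]
    {f g : Fin n → V →ₗ[K] M} {w w' : M} (hw : (valueMatrix b f).det * w = 1)
    (hw' : (valueMatrix b g).det * w' = 1) {a : Matrix (Fin n) (Fin n) K} (ha : IsUnit a.det)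
    (h : valueMatrix b g = valueMatrix b f * (algebraMap K M).mapMatrix a) :
    principalAlgebra b g w' ≤ principalAlgebra b f w := by
  refine principalAlgebra_le b (fun i j => ?_) ?_
  · rw [← valueMatrix_apply b g, h, Matrix.mul_apply]
    exact sum_mem fun k _ => mul_mem (hom_basis_mem_principalAlgebra b f w i k)
      (Subalgebra.algebraMap_mem _ _)
  · obtain ⟨y, hy⟩ := ha.exists_right_inv
    have hdet := congrArg Matrix.det h
    rw [Matrix.det_mul, ← RingHom.map_det] at hdet
    have hy' : algebraMap K M a.det * algebraMap K M y = 1 := by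
      rw [← map_mul, hy, map_one]
    have h₁ : w' = w * algebraMap K M y := by
      rw [hdet] at hw'
      generalize (valueMatrix b f).det = p at hw hw'
      generalize algebraMap K M a.det = r at hy' hw'
      generalize algebraMap K M y = s at hy'
      calc w' = w' * (p * w) * (r * s) := by rw [hw, hy', mul_one, mul_one]
        _ = p * r * w' * (w * s) := by ring
        _ = w * s := by rw [hw', one_mul]
    rw [h₁]
    exact mul_mem (mem_principalAlgebra_self b f w) (Subalgebra.algebraMap_mem _ _)

theorem SameConstants.isAlgClosed {L : Type w₁} [CommRing L] [Algebra R L] [Module D L]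
    [IsScalarTower R D L] [IsModuleAlgebra R D L] [Algebra K L] [IsScalarTower R K L]
    [IsExtension D K L] [IsAS D K] [IsAS D L] [IsAlgClosed (constants R D K)]
    (h : SameConstants R D K L) : IsAlgClosed (constants R D L) := by
  let φ : constants R D K →+* constants R D L :=
    ((algebraMap K L).comp (constants R D K).val.toRingHom).codRestrict (constants R D L)
      fun a => algebraMap_mem_constants (K := K) (a := (a : K)) a.2
  have hφ : Function.Bijective φ := by
    refine ⟨fun x y hxy => Subtype.ext (IsExtension.injective D (K := K) (L := L)
      (congrArg Subtype.val hxy)), fun c => ?_⟩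
    obtain ⟨a, ha, hac⟩ := h.exists_algebraMap_eq c.2
    exact ⟨⟨a, ha⟩, Subtype.ext hac⟩
  exact isAlgClosed_of_ringEquiv (RingEquiv.ofBijective φ hφ)

variable {L₁ : Type w₁} [CommRing L₁] [Algebra R L₁] [Module D L₁] [IsScalarTower R D L₁]
  [IsModuleAlgebra R D L₁] [Algebra K L₁] [IsScalarTower R K L₁] [IsExtension D K L₁]
  {L₂ : Type w₂} [CommRing L₂] [Algebra R L₂] [Module D L₂] [IsScalarTower R D L₂]
  [IsModuleAlgebra R D L₂] [Algebra K L₂] [IsScalarTower R K L₂] [IsExtension D K L₂]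

/-- In a `D`-simple image of `L₁ ⊗ A₂` the two fundamental matrices differ by an invertible matrix
over `K^D`, so both principal algebras have the same image. On the side of `L₁` the map is
injective, and inverting it there gives `ψ`. -/
theorem exists_surjective_principalAlgebra (hD : IsPointed R D) (hBW : IsBirkhoffWitt R D)
    [IsAS D K] [IsAlgClosed (constants R D K)] [IsAS D L₁] [IsAS D L₂]
    (hsc : SameConstants R D K L₁)
    {f₁ : Fin n → V →ₗ[K] L₁} (hf₁ : ∀ j (d : D) (v : V), f₁ j (d • v) = d • f₁ j v) {w₁ : L₁}
    (hw₁ : (valueMatrix b f₁).det * w₁ = 1)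
    {f₂ : Fin n → V →ₗ[K] L₂} (hf₂ : ∀ j (d : D) (v : V), f₂ j (d • v) = d • f₂ j v) {w₂ : L₂}
    (hw₂ : (valueMatrix b f₂).det * w₂ = 1)
    [IsStable D (principalAlgebra b f₁ w₁)] [IsStable D (principalAlgebra b f₂ w₂)] :
    ∃ ψ : principalAlgebra b f₂ w₂ →ₐ[K] principalAlgebra b f₁ w₁, Function.Surjective ψ ∧
      ∀ (d : D) x, ψ (d • x) = d • ψ x := by
  have : IsArtinianRing K := IsAS.artinian D
  have : IsArtinianRing L₁ := IsAS.artinian D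
  have : Nontrivial K := IsAS.nontrivial D
  have : Nontrivial L₁ := IsAS.nontrivial D
  have : IsReduced K := IsDSimple.isReduced (R := R) (D := D) hD hBW IsAS.isDSimple
  have := IsArtinianRing.isSemisimpleRing_of_isReduced K
  -- Flatness of `L₁` over `K` ensures that the tensor product is not zero.
  have : Module.Projective K L₁ := Module.projective_of_isSemisimpleRing K L₁
  have hcl : IsAlgClosed (constants R D L₁) := hsc.isAlgClosed
  let A₂ := principalAlgebra b f₂ w₂
  let T := DiagTensor R K L₁ A₂
  have : Algebra.FiniteType L₁ T :=
    inferInstanceAs (Algebra.FiniteType L₁ (L₁ ⊗[K] A₂))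
  have : IsNoetherianRing T := Algebra.FiniteType.isNoetherianRing L₁ _
  have : Nontrivial T := by
    have hinj : Function.Injective (DiagTensor.inl R K L₁ A₂) :=
      Algebra.TensorProduct.includeLeft_injective (S := K)
        (IsExtension.injective D (K := K) (L := A₂))
    exact hinj.nontrivial
  obtain ⟨M, _, _, _, _, _, _, _, π, _, hπ, hBs, -⟩ :=
    exists_isDSimple_range (R := R) (D := D) (K := L₁) hD T
  let B := π.range
  have : Nontrivial B := hBs.nontrivial
  have : Nontrivial M := (Subtype.val_injective : Function.Injective (B.val)).nontrivial
  have hL₁M : ∀ (d : D) (l : L₁), algebraMap L₁ M (d • l) = d • algebraMap L₁ M l := fun d l => by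
    rw [← π.commutes, ← π.commutes, ← hπ]
    exact congrArg π (DiagTensor.smul_inl R K L₁ A₂ d l).symm
  have : IsExtension D L₁ M := isExtension_of_map_smul hL₁M
  have : Algebra.FiniteType L₁ B := Algebra.FiniteType.of_surjective π.rangeRestrict
    π.rangeRestrict_surjective
  let _ : Algebra K M := ((algebraMap L₁ M).comp (algebraMap K L₁)).toAlgebra
  have : IsScalarTower K L₁ M := IsScalarTower.of_algebraMap_eq fun _ => rfl
  have : IsScalarTower K L₁ T := inferInstanceAs (IsScalarTower K L₁ (L₁ ⊗[K] A₂))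
  let J : L₁ →ₐ[K] M := IsScalarTower.toAlgHom K L₁ M
  let q : A₂ →ₐ[K] M := (π.restrictScalars K).comp (DiagTensor.inr R K L₁ A₂)
  have hJ : Function.Injective J := IsExtension.injective D (K := L₁) (L := M)
  have hq : ∀ (d : D) (x : A₂), q (d • x) = d • q x := fun d x => by
    change π (DiagTensor.inr R K L₁ A₂ (d • x)) = d • π (DiagTensor.inr R K L₁ A₂ x)
    rw [← DiagTensor.smul_inr, hπ]
  have hπl : ∀ l : L₁, π (DiagTensor.inl R K L₁ A₂ l) = J l := fun l => π.commutes l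
  let P₂ := principalHom b f₂ w₂
  let F₁ : Fin n → V →ₗ[K] T := fun j => (DiagTensor.inl R K L₁ A₂).toLinearMap ∘ₗ f₁ j
  let F₂ : Fin n → V →ₗ[K] T := fun j => (DiagTensor.inr R K L₁ A₂).toLinearMap ∘ₗ P₂ j
  have hF₁ : ∀ j (d : D) (v : V), F₁ j (d • v) = d • F₁ j v := fun j d v => by
    change DiagTensor.inl R K L₁ A₂ (f₁ j (d • v)) = d • DiagTensor.inl R K L₁ A₂ (f₁ j v)
    rw [hf₁, DiagTensor.smul_inl]
  have hF₂ : ∀ j (d : D) (v : V), F₂ j (d • v) = d • F₂ j v := fun j d v => by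
    have h : P₂ j (d • v) = d • P₂ j v := Subtype.ext (hf₂ j d v)
    change DiagTensor.inr R K L₁ A₂ (P₂ j (d • v)) = d • DiagTensor.inr R K L₁ A₂ (P₂ j v)
    rw [h, DiagTensor.smul_inr]
  have hd₁ : (valueMatrix b F₁).det * DiagTensor.inl R K L₁ A₂ w₁ = 1 := by
    rw [det_valueMatrix_comp b (DiagTensor.inl R K L₁ A₂) f₁, ← map_mul, hw₁, map_one]
  choose c hc hcF using fun j => exists_constant_coefficients (R := R) b hF₁
    (IsUnit.of_mul_eq_one _ hd₁) (hF₂ j)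
  -- The image is of finite type over `L₁`, whose constants are algebraically closed, so its
  -- constants come from `L₁` and then from `K`.
  have hca : ∀ k j, ∃ a ∈ constants R D K, algebraMap K M a = π (c j k) := fun k j => by
    obtain ⟨l, hl, hlc⟩ := hBs.exists_algebraMap_eq (R := R) (K := L₁)
      (c := π.rangeRestrict (c j k)) (fun d => Subtype.ext (by
        have h := congrArg π (hc j k d)
        rw [hπ, ← algebraMap_smul L₁, map_smul, algebraMap_smul] at h
        exact h))
    obtain ⟨a, ha, hal⟩ := hsc.exists_algebraMap_eq hl
    refine ⟨a, ha, ?_⟩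
    change algebraMap L₁ M (algebraMap K L₁ a) = _
    rw [hal]
    exact congrArg (fun x : B => (x : M)) hlc
  choose a ha hac using hca
  let G₁ : Fin n → V →ₗ[K] M := fun j => J.toLinearMap ∘ₗ f₁ j
  let G₂ : Fin n → V →ₗ[K] M := fun j => q.toLinearMap ∘ₗ P₂ j
  let w₂' : A₂ := ⟨w₂, mem_principalAlgebra_self b f₂ w₂⟩
  have hG₁ : (valueMatrix b G₁).det * J w₁ = 1 := by
    rw [det_valueMatrix_comp b J f₁, ← map_mul, hw₁, map_one]
  have hG₂ : (valueMatrix b G₂).det * q w₂' = 1 := by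
    rw [det_valueMatrix_comp b q P₂, ← map_mul, det_principalHom_mul b hw₂, map_one]
  have hmul : valueMatrix b G₂ =
      valueMatrix b G₁ * (algebraMap K M).mapMatrix (Matrix.of a) := by
    ext i j
    change π (F₂ j (b i)) = _
    rw [hcF, map_sum, Matrix.mul_apply]
    refine Finset.sum_congr rfl fun k _ => ?_
    rw [map_mul, ← hac]
    congr 1
    exact hπl _
  have hdeta : IsUnit (Matrix.of a).det := by
    refine IsDSimple.isUnit_of_mem_constants (R := R) (D := D) IsAS.isDSimple
      (det_mem (B := constants R D K) fun i j => ha i j) fun h0 => ?_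
    have h := congrArg Matrix.det hmul
    rw [Matrix.det_mul, ← RingHom.map_det, h0, map_zero, mul_zero] at h
    rw [h, zero_mul] at hG₂
    exact zero_ne_one hG₂
  obtain ⟨a', haa'⟩ := ((Matrix.isUnit_iff_isUnit_det _).2 hdeta).exists_right_inv
  have hdeta' : IsUnit a'.det := by
    have h := congrArg Matrix.det haa'
    rw [Matrix.det_mul, Matrix.det_one] at h
    exact IsUnit.of_mul_eq_one_right _ h
  have hmul' : valueMatrix b G₁ = valueMatrix b G₂ * (algebraMap K M).mapMatrix a' := by
    rw [hmul, Matrix.mul_assoc, ← map_mul, haa', map_one, Matrix.mul_one]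
  have hrange : q.range = (principalAlgebra b f₁ w₁).map J := by
    rw [map_principalAlgebra, range_eq_principalAlgebra]
    exact le_antisymm (principalAlgebra_le_of_mul b hG₁ hG₂ hdeta hmul)
      (principalAlgebra_le_of_mul b hG₂ hG₁ hdeta' hmul')
  have hex : ∀ x : A₂, ∃ y : principalAlgebra b f₁ w₁, J y = q x := fun x => by
    have h : q x ∈ (principalAlgebra b f₁ w₁).map J := hrange ▸ ⟨x, rfl⟩
    obtain ⟨y, hy, h⟩ := h
    exact ⟨⟨y, hy⟩, h⟩
  choose ψ hψ using hex
  have hJ' : ∀ {y z : principalAlgebra b f₁ w₁}, J (y : L₁) = J (z : L₁) → y = z :=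
    fun h => Subtype.ext (hJ h)
  let Ψ : A₂ →ₐ[K] principalAlgebra b f₁ w₁ :=
    { toFun := ψ
      map_one' := hJ' (by rw [hψ, map_one, Subalgebra.coe_one, map_one])
      map_mul' := fun x y => hJ' (by rw [hψ, map_mul, Subalgebra.coe_mul, map_mul, hψ, hψ])
      map_zero' := hJ' (by rw [hψ, map_zero, ZeroMemClass.coe_zero, map_zero])
      map_add' := fun x y => hJ' (by rw [hψ, map_add, Subalgebra.coe_add, map_add, hψ, hψ])
      commutes' := fun r => hJ' (by
        rw [hψ, AlgHom.commutes]
        exact (J.commutes r).symm) }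
  refine ⟨Ψ, fun y => ?_, fun d x => hJ' ?_⟩
  · have h : J y ∈ q.range := hrange ▸ ⟨y, y.2, rfl⟩
    obtain ⟨x, hx⟩ := h
    exact ⟨x, hJ' ((hψ x).trans hx)⟩
  · have h : J (d • (ψ x : L₁)) = d • J (ψ x : L₁) := hL₁M d _
    rw [coe_stable_smul]
    refine (hψ (d • x)).trans ?_
    rw [hq, ← hψ]
    exact h.symm

theorem exists_algEquiv (hD : IsPointed R D) (hBW : IsBirkhoffWitt R D)
    [IsAS D K] [IsAlgClosed (constants R D K)] [IsAS D L₁] [IsAS D L₂] [Module.Finite K V]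
    (hsc₁ : SameConstants R D K L₁) (hmin₁ : IsMinimalSplittingAlgebra R D K L₁ V)
    (hsc₂ : SameConstants R D K L₂) (hmin₂ : IsMinimalSplittingAlgebra R D K L₂ V) :
    ∃ e : L₁ ≃ₐ[K] L₂, ∀ (d : D) (y : L₁), e (d • y) = d • e y := by
  have : IsArtinianRing K := IsAS.artinian D
  have : IsArtinianRing L₁ := IsAS.artinian D
  have : IsArtinianRing L₂ := IsAS.artinian D
  obtain ⟨n, ⟨b⟩⟩ := exists_basis R D K V hD hBW
  obtain ⟨f₁, hf₁, hu₁⟩ := hmin₁.splits.exists_isUnit_det b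
  obtain ⟨f₂, hf₂, hu₂⟩ := hmin₂.splits.exists_isUnit_det b
  obtain ⟨w₁, hw₁⟩ := hu₁.exists_right_inv
  obtain ⟨w₂, hw₂⟩ := hu₂.exists_right_inv
  let A₁ := principalAlgebra b f₁ w₁
  let A₂ := principalAlgebra b f₂ w₂
  have : IsStable D A₁ := isStable_principalAlgebra b hD IsExtension.map_smul hf₁ hw₁
  have : IsStable D A₂ := isStable_principalAlgebra b hD IsExtension.map_smul hf₂ hw₂
  have : IsNoetherianRing A₂ := Algebra.FiniteType.isNoetherianRing K _
  have : IsFractionRing A₁ L₁ := isFractionRing_of_fractions_eq_top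
    (fractions_principalAlgebra_eq_top b hD hBW hsc₁ hmin₁ hf₁ hw₁)
  have : IsFractionRing A₂ L₂ := isFractionRing_of_fractions_eq_top
    (fractions_principalAlgebra_eq_top b hD hBW hsc₂ hmin₂ hf₂ hw₂)
  obtain ⟨ψ, hψs, -⟩ :=
    exists_surjective_principalAlgebra b hD hBW hsc₁ hf₁ hw₁ hf₂ hw₂
  obtain ⟨χ, hχs, hχ⟩ :=
    exists_surjective_principalAlgebra b hD hBW hsc₂ hf₂ hw₂ hf₁ hw₁
  -- The composite of the two surjections is a surjective endomorphism of a noetherian ring, hence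
  -- injective.
  have hinj : Function.Injective χ := by
    have h₁ := injective_of_surjective_ringHom ((χ : A₁ →+* A₂).comp (ψ : A₂ →+* A₁))
      (hχs.comp hψs)
    intro x y hxy
    obtain ⟨x, rfl⟩ := hψs x
    obtain ⟨y, rfl⟩ := hψs y
    rw [h₁ hxy]
  let ε : A₁ ≃ₐ[K] A₂ := AlgEquiv.ofBijective χ ⟨hinj, hχs⟩
  let e₀ : L₁ ≃+* L₂ := IsFractionRing.ringEquivOfRingEquiv ε.toRingEquiv
  have he₀ : ∀ a : A₁, e₀ (a : L₁) = (χ a : L₂) := fun a =>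
    IsFractionRing.ringEquivOfRingEquiv_algebraMap ε.toRingEquiv a
  let e : L₁ ≃ₐ[K] L₂ := AlgEquiv.ofRingEquiv (f := e₀) fun r => by
    have h := he₀ (algebraMap K A₁ r)
    rw [χ.commutes] at h
    exact h
  -- Linearity over `D` says that two ring homomorphisms into `Hom_R(D, L₂)` agree. They agree on
  -- `A₁`, hence on its localization `L₁`.
  let α : L₁ →+* WithConv (D →ₗ[R] L₂) := orbitHom (e.toAlgHom.restrictScalars R)
  let β : L₁ →+* WithConv (D →ₗ[R] L₂) := (orbitHom (AlgHom.id R L₂)).comp (e : L₁ →+* L₂)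
  have hαβ : α = β := by
    refine IsLocalization.ringHom_ext (nonZeroDivisors A₁) (RingHom.ext fun a => ?_)
    ext d
    change e₀ (d • (a : L₁)) = d • e₀ (a : L₁)
    rw [he₀, ← coe_stable_smul, he₀, hχ, coe_stable_smul]
  exact ⟨e, fun d y => congrArg
    (fun φ : L₁ →+* WithConv (D →ₗ[R] L₂) => (φ y).ofConv d) hαβ⟩

end Uniqueness

end PVTheory

/-! ### The main theorem -/

theorem mainTheorem4
    {R : Type u} [Field R]
    {D : Type v} [Ring D] [HopfAlgebra R D] [Coalgebra.IsCocomm R D]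
    (hD : IsPointed R D) (hBW : IsBirkhoffWitt R D)
    {K : Type w} [CommRing K] [Algebra R K] [Module D K] [IsScalarTower R D K]
    [IsModuleAlgebra R D K] [IsAS D K] [IsAlgClosed (constants R D K)]
    {V : Type x} [AddCommGroup V] [Module R V] [Module K V] [Module D V]
    [IsScalarTower R K V] [IsScalarTower R D V] [IsSmashModule R D K V] [Module.Finite K V] :
    (∃ (L : Type w) (_ : CommRing L) (_ : Algebra R L) (_ : Module D L) (_ : IsScalarTower R D L)
      (_ : IsModuleAlgebra R D L) (_ : IsAS D L)
      (_ : Algebra K L) (_ : IsScalarTower R K L) (_ : IsExtension D K L),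
      SameConstants R D K L ∧ IsMinimalSplittingAlgebra R D K L V ∧
      IsFinitelyGenerated D K L ∧ IsPVExtension R D K L) ∧
    (∀ (L : Type w₁) [CommRing L] [Algebra R L] [Module D L] [IsScalarTower R D L]
      [IsModuleAlgebra R D L] [IsAS D L]
      [Algebra K L] [IsScalarTower R K L] [IsExtension D K L],
      SameConstants R D K L → IsMinimalSplittingAlgebra R D K L V →
      IsFinitelyGenerated D K L ∧ IsPVExtension R D K L) ∧
    (∀ (L₁ : Type w₁) [CommRing L₁] [Algebra R L₁] [Module D L₁] [IsScalarTower R D L₁]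
      [IsModuleAlgebra R D L₁] [IsAS D L₁]
      [Algebra K L₁] [IsScalarTower R K L₁] [IsExtension D K L₁]
      (L₂ : Type w₂) [CommRing L₂] [Algebra R L₂] [Module D L₂] [IsScalarTower R D L₂]
      [IsModuleAlgebra R D L₂] [IsAS D L₂]
      [Algebra K L₂] [IsScalarTower R K L₂] [IsExtension D K L₂],
      SameConstants R D K L₁ → IsMinimalSplittingAlgebra R D K L₁ V →
      SameConstants R D K L₂ → IsMinimalSplittingAlgebra R D K L₂ V →
      ∃ e : L₁ ≃ₐ[K] L₂, ∀ (d : D) (y : L₁), e (d • y) = d • e y) := by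
  refine ⟨?_, ?_, ?_⟩
  · obtain ⟨L, _, _, _, _, _, _, _, _, _, hsc, hmin⟩ :=
      exists_isMinimalSplittingAlgebra (R := R) (D := D) (K := K) (V := V) hD hBW
    obtain ⟨n, ⟨b⟩⟩ := exists_basis R D K V hD hBW
    obtain ⟨f, hf, hu⟩ := hmin.splits.exists_isUnit_det b
    exact ⟨L, inferInstance, inferInstance, inferInstance, inferInstance, inferInstance,
      inferInstance, inferInstance, inferInstance, inferInstance, hsc, hmin,
      isFinitelyGenerated_of_isMinimalSplittingAlgebra b hsc hmin hf hu,
      isPVExtension_of_isMinimalSplittingAlgebra b hD hBW hsc hmin hf hu⟩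
  · intro L _ _ _ _ _ _ _ _ _ hsc hmin
    obtain ⟨n, ⟨b⟩⟩ := exists_basis R D K V hD hBW
    obtain ⟨f, hf, hu⟩ := hmin.splits.exists_isUnit_det b
    exact ⟨isFinitelyGenerated_of_isMinimalSplittingAlgebra b hsc hmin hf hu,
      isPVExtension_of_isMinimalSplittingAlgebra b hD hBW hsc hmin hf hu⟩
  · intro L₁ _ _ _ _ _ _ _ _ _ L₂ _ _ _ _ _ _ _ _ _ hsc₁ hmin₁ hsc₂ hmin₂
    exact exists_algEquiv hD hBW hsc₁ hmin₁ hsc₂ hmin₂
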